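/- **Setting.** Let $\mathbb X$ be a compact connected smooth Riemannian manifold without boundary, $\rho$ its geodesic distance, $B(x,r)=\{y:\rho(x,y)\le r\}$, and $\mu$ a Borel probability measure on $\mathbb X$ with $\mu(B(x,r))\le\kappa_1r^\alpha$ for all $x\in\mathbb X$, $r>0$, where $\alpha,\kappa_1>0$. Let $\kappa_2,\kappa_3,\kappa_4>0$. An *admissible system* is a sequence $\{\phi_k\}_{k\ge0}$ of continuous functions $\mathbb X\to\mathbb C$, orthonormal in $L^2(\mu)$, with $\phi_0\equiv1$, and a nondecreasing sequence $\ell_k\uparrow\infty$ with $0\le\ell_0\le1$, such that the heat kernel $K_t(x,y)=\sum_{k}e^{-\ell_k^2t}\phi_k(x)\overline{\phi_k(y)}$ converges, is differentiable in $y$, and satisfies, for all $x,y\in\mathbb X$, $t\in(0,1]$, $$|K_t(x,y)|\le\kappa_2t^{-\alpha/2}e^{-\kappa_3\rho(x,y)^2/t},\qquad |\nabla_yK_t(x,y)|\le\kappa_2t^{-\alpha/2-1/2}e^{-\kappa_3\rho(x,y)^2/t},\qquad K_t(x,x)\ge\kappa_4t^{-\alpha/2}.$$ Put $\Pi_L=\mathrm{span}_{\mathbb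 C}\{\phi_j:\ell_j\le L\}$. For a (finite) signed Borel measure $\nu$ with total variation measure $|\nu|$ put $\|f\|_{\nu;p}=\left(\int|f|^p\,d|\nu|\right)^{1/p}$. For $d>0$, $\nu$ is *$d$-regular* if there is $c>0$ with $|\nu|(B(x,d))\le c\,d^\alpha$ for all $x\in\mathbb X$, and $|\!|\!|\nu|\!|\!|_{R,d}$ is the infimum of such $c$; $\nu$ is *$d$-dominant* if there is $c>0$ with $|\nu|(B(x,d))\ge c\,d^\alpha$ for all $x\in\mathbb X$, and $|\!|\!|\nu|\!|\!|_{D,d}^{-1}$ is the supremum of such $c$. **Theorem.** Let $1\le p<\infty$. There are positive constants as below, depending only on $\mathbb X$ (with its metric), $\mu$, $\alpha,\kappa_1,\dots,\kappa_4$ and $p$ (and on $S$ where indicated), but not on the admissible system, such that the following holds for every admissible system $\{\phi_k\},\{\ell_k\}$, every $L\ge2$ and every signed Borel measure $\nu$. (a) If $\nu$ is $1/L$-regular, then $\|P\|_{\nu;p}\le c_1|\!|\!|\nu|\!|\!|_{R,1/L}^{1/p}\|P\|_{\mu;p}$ for all $P\in\Pi_L$. Conversely, if $A>0$ and $\|P\|_{\nu;p}\le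 A^{1/p}\|P\|_{\mu;p}$ for all $P\in\Pi_L$, then $\nu$ is $1/L$-regular and $|\!|\!|\nu|\!|\!|_{R,1/L}\le c_2A$. (b) If $L\ge c$ and $\nu$ is $c_4/L$-dominant, then $\|P\|_{\mu;p}\le c_3|\!|\!|\nu|\!|\!|_{D,c_4/L}^{1/p}\|P\|_{\nu;p}$ for all $P\in\Pi_L$. Conversely, let $\nu$ be $1/L$-regular and let $S>\alpha$ be an integer. If $A_1>0$ and $\|P\|_{\mu;p}\le A_1^{1/p}\|P\|_{\nu;p}$ for all $P\in\Pi_L$, then with $$d=c_5(S)\,\max\left(1,|\!|\!|\nu|\!|\!|_{R,1/L}A_1\right)^{1/(S-\alpha)}L^{-1}$$ the measure $\nu$ is $d$-dominant and $|\!|\!|\nu|\!|\!|_{D,d}\le c_6(S)\,A_1\max(1,d)^\alpha$; if moreover $S\ge2\alpha$, then $|\!|\!|\nu|\!|\!|_{D,d}\le c_6(S)\,A_1$. -/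

import Mathlib

open MeasureTheory Set Filter Topology Manifold Bundle
open scoped ContDiff ComplexConjugate

noncomputable section

/-- The diffusion polynomials of degree at most `L`: the span of the `φ j` with `ℓ j ≤ L`. -/
def diffusionPolynomials {M : Type*} (φ : ℕ → M → ℂ) (ℓ : ℕ → ℝ) (L : ℝ) :
    Submodule ℂ (M → ℂ) :=
  Submodule.span ℂ (φ '' {j | ℓ j ≤ L})

/-- The heat kernel `K_t(x, y) = ∑ₖ exp(-ℓₖ² t) φₖ(x) conj φₖ(y)`. -/
def heatKernel {M : Type*} (φ : ℕ → M → ℂ) (ℓ : ℕ → ℝ) (t : ℝ) (x y : M) : ℂ :=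
  ∑' k, (Real.exp (-(ℓ k) ^ 2 * t) : ℂ) * φ k x * conj (φ k y)

/-- The derivative of a complex valued function on a manifold at `y` in the direction of the
tangent vector `v`. -/
def dirDeriv {n : ℕ} {M : Type*} [TopologicalSpace M] [ChartedSpace (EuclideanSpace ℝ (Fin n)) M]
    (u : M → ℂ) (y : M) (v : TangentSpace (𝓡 n) y) : ℂ :=
  mfderiv (𝓡 n) 𝓘(ℝ, ℂ) u y v

/-- `φ`, `ℓ` is an admissible system: `φ` is an orthonormal system of continuous functions with
`φ 0 = 1`, `ℓ` is nondecreasing and unbounded with `0 ≤ ℓ 0 ≤ 1`, and the heat kernel satisfies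
Gaussian upper bounds, Gaussian gradient bounds and on-diagonal lower bounds for times in `(0, 1]`,
with exponent `α` and constants `κ₂`, `κ₃`, `κ₄`.
The gradient bound `|∇_y K_t(x, y)| ≤ B` is written as `|dK_t(x, ·)_y (v)| ≤ B |v|` for every tangent
vector `v` at `y`, the norm of `v` being the one of the Riemannian metric. -/
structure IsDiffusionSystem {n : ℕ} {M : Type*} [MetricSpace M]
    [ChartedSpace (EuclideanSpace ℝ (Fin n)) M]
    [RiemannianBundle (fun x : M => TangentSpace (𝓡 n) x)]
    [MeasurableSpace M] (μ : Measure M) (α κ₂ κ₃ κ₄ : ℝ)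
    (φ : ℕ → M → ℂ) (ℓ : ℕ → ℝ) : Prop where
  continuous : ∀ k, Continuous (φ k)
  orthonormal : ∀ j k, ∫ x, φ j x * conj (φ k x) ∂μ = if j = k then 1 else 0
  phi_zero : ∀ x, φ 0 x = 1
  monotone : Monotone ℓ
  ell_zero_nonneg : 0 ≤ ℓ 0
  ell_zero_le_one : ℓ 0 ≤ 1
  tendsto : Tendsto ℓ atTop atTop
  summable : ∀ x : M, ∀ t ∈ Ioc (0 : ℝ) 1,
    Summable fun k => Real.exp (-(ℓ k) ^ 2 * t) * ‖φ k x‖ ^ 2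
  gaussian : ∀ x y : M, ∀ t ∈ Ioc (0 : ℝ) 1,
    ‖heatKernel φ ℓ t x y‖ ≤ κ₂ * t ^ (-α / 2) * Real.exp (-κ₃ * dist x y ^ 2 / t)
  differentiable : ∀ x : M, ∀ t ∈ Ioc (0 : ℝ) 1,
    MDifferentiable (𝓡 n) 𝓘(ℝ, ℂ) fun y => heatKernel φ ℓ t x y
  gradient : ∀ x y : M, ∀ t ∈ Ioc (0 : ℝ) 1, ∀ v : TangentSpace (𝓡 n) y,
    ‖dirDeriv (fun z => heatKernel φ ℓ t x z) y v‖ ≤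
      κ₂ * t ^ (-α / 2 - 1 / 2) * Real.exp (-κ₃ * dist x y ^ 2 / t) * ‖v‖
  diagonal : ∀ x : M, ∀ t ∈ Ioc (0 : ℝ) 1,
    κ₄ * t ^ (-α / 2) ≤ (heatKernel φ ℓ t x x).re

/-- `(∫ |f|^p dτ)^{1/p}`. For a signed measure `ν`, the `p`-norm of `f` with respect to `ν` is
`pNorm ν.totalVariation p f`. -/
def pNorm {M : Type*} [MeasurableSpace M] (τ : Measure M) (p : ℝ) (f : M → ℂ) : ℝ :=
  (∫ x, ‖f x‖ ^ p ∂τ) ^ (1 / p)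

section Regularity

variable {M : Type*} [MetricSpace M] [MeasurableSpace M]

/-- The constants `c` with `|ν|(B(x, d)) ≤ c d^α` for all `x`. -/
def regularConstants (ν : SignedMeasure M) (α d : ℝ) : Set ℝ :=
  {c | ∀ x, ν.totalVariation.real (Metric.closedBall x d) ≤ c * d ^ α}

/-- The constants `c` with `|ν|(B(x, d)) ≥ c d^α` for all `x`. -/
def dominantConstants (ν : SignedMeasure M) (α d : ℝ) : Set ℝ :=
  {c | ∀ x, c * d ^ α ≤ ν.totalVariation.real (Metric.closedBall x d)}

/-- `ν` is `d`-regular. -/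
def IsRegularMeasure (ν : SignedMeasure M) (α d : ℝ) : Prop :=
  ∃ c, 0 < c ∧ c ∈ regularConstants ν α d

/-- `ν` is `d`-dominant. -/
def IsDominantMeasure (ν : SignedMeasure M) (α d : ℝ) : Prop :=
  ∃ c, 0 < c ∧ c ∈ dominantConstants ν α d

/-- `|||ν|||_{R,d}`, the infimum of the constants in the regularity condition. -/
def regularNorm (ν : SignedMeasure M) (α d : ℝ) : ℝ :=
  sInf (regularConstants ν α d)

/-- `|||ν|||_{D,d}`, the reciprocal of the supremum of the constants in the dominance condition. -/
def dominantNorm (ν : SignedMeasure M) (α d : ℝ) : ℝ :=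
  (sSup (dominantConstants ν α d))⁻¹

end Regularity

end

/-! ### Increments of a function from bounds on its Riemannian gradient. -/

section Gradient

variable {n : ℕ} {M : Type*} [MetricSpace M]
  [ChartedSpace (EuclideanSpace ℝ (Fin n)) M]
  [RiemannianBundle (fun x : M => TangentSpace (𝓡 n) x)]

/-! Everything is extracted from the heat kernel at a scale `h`, through the nodes s_k = exp(-ℓ_k²
h²). Since ∑ s_k^(m+1) φ_k(x) conj φ_k(y) = K_{(m+1)h²}(x,y), the Gaussian bounds control all power
moments of the weights w_k = s_k φ_k(x) conj φ_k(y): the m-th is at most W exp(-R²/(m+1)), with W ~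
h^(-α) and R ~ ρ(x,y)/h. Expanding exponentials shows that ∑ w_j exp(i k s_j) is exponentially small
in R as long as e|k| ≤ R, and Fourier inversion turns this into ∑ w_j g(s_j) = O(W (1+R)^(-S)) for
every Schwartz g (`exists_norm_tsum_mul_schwartz_le`). So smooth multipliers of the nodes have
kernels localized at scale `h` to any polynomial order (`exists_norm_spectralKernel_le`).

Two multipliers suffice. For the direct parts take h = 1/L: the nodes with ℓ_k ≤ L lie in [exp(-1),
1], and if g(s) = s⁻² there, then s · (s g(s)) = 1. Hence P = K_{h²}Q, where Q is the image of P
under the kernel ∑ s_k g(s_k) φ_k(x) conj φ_k(y). By localization of the heat kernel and of its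
gradient, |P| and its oscillations are bounded by weighted averages of |Q|, and |Q| by averages of
|P| (`exists_decayAverage_bounds`). Schur's test gives (a), because regular measures integrate the
weights as μ does. In (b) the oscillation of P on balls of radius δh is small in L^p(μ) and is
absorbed.

For the converses, a cutoff in the nodes truncates the heat kernel to an element of Π_L which is
still localized and has size h^(-α) near its centre (`exists_localized_polynomials`). Put into the
upper inequality, it bounds the measure of small balls. Put into the lower one, it has a definite
p-th moment for ν; regularity makes the part outside B(x,d) at most half of it once d is large
enough, and averaging over centres in B(x,d/2) gives dominance (`mul_measureReal_le_of_localized`).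

Lower volume bounds for μ are not assumed: they follow from localization and ∫ K_{h²}(x,·) dμ =
exp(-ℓ_0² h²) ≥ exp(-1) (`exists_le_measureReal_closedBall`). -/

/-- Along a `C^1` path, the increment of a differentiable function is at most the length of the
path times a bound on the gradient. -/
theorem enorm_sub_le_pathELength {u : M → ℂ} (hu : MDifferentiable (𝓡 n) 𝓘(ℝ, ℂ) u)
    {γ : ℝ → M} (hγ : ContMDiff 𝓘(ℝ, ℝ) (𝓡 n) 1 γ) {B : ℝ} (hB0 : 0 ≤ B)
    (hB : ∀ t ∈ Icc (0 : ℝ) 1, ∀ v : TangentSpace (𝓡 n) (γ t), ‖dirDeriv u (γ t) v‖ ≤ B * ‖v‖) :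
    ‖u (γ 1) - u (γ 0)‖ₑ ≤ ENNReal.ofReal B * pathELength (𝓡 n) γ 0 1 := by
  have hγd : MDifferentiable 𝓘(ℝ, ℝ) (𝓡 n) γ := hγ.mdifferentiable one_ne_zero
  have hfd : Differentiable ℝ (u ∘ γ) := by
    rw [← mdifferentiable_iff_differentiable]
    exact hu.comp hγd
  have hderiv : ∀ t, deriv (u ∘ γ) t = dirDeriv u (γ t) (mfderiv 𝓘(ℝ, ℝ) (𝓡 n) γ t 1) := by
    intro t
    have h := mfderiv_comp t (hu (γ t)) (hγd t)
    rw [← fderiv_apply_one_eq_deriv, ← mfderiv_eq_fderiv, h]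
    rfl
  have hle : ∫⁻ t in Icc (0 : ℝ) 1, ‖deriv (u ∘ γ) t‖ₑ ≤
      ENNReal.ofReal B * pathELength (𝓡 n) γ 0 1 := by
    rw [pathELength_eq_lintegral_mfderiv_Icc, ← lintegral_const_mul' _ _ ENNReal.ofReal_ne_top]
    refine setLIntegral_mono' measurableSet_Icc fun t ht => ?_
    rw [hderiv, ← ofReal_norm, ← ofReal_norm, ← ENNReal.ofReal_mul hB0]
    exact ENNReal.ofReal_le_ofReal (hB t ht _)
  -- The derivative of `u` need not be continuous, so its integrability along the path is not
  -- automatic. If the integral is infinite, so is the right-hand side.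
  rcases eq_or_ne (∫⁻ t in Icc (0 : ℝ) 1, ‖deriv (u ∘ γ) t‖ₑ) ⊤ with htop | hfin
  · rw [htop] at hle
    exact le_top.trans hle
  refine le_trans ?_ hle
  have hmeas : AEStronglyMeasurable (deriv (u ∘ γ)) (volume.restrict (Icc (0 : ℝ) 1)) :=
    (stronglyMeasurable_deriv _).aestronglyMeasurable
  have hint : IntegrableOn (fun t => ‖deriv (u ∘ γ) t‖) (Icc (0 : ℝ) 1) :=
    Integrable.norm ⟨hmeas, lt_top_iff_ne_top.2 hfin⟩
  have := norm_sub_le_integral_of_norm_deriv_le_of_le (f := u ∘ γ) (zero_le_one' ℝ)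
    hfd.continuous.continuousOn hfd.differentiableOn (Eventually.of_forall fun t _ => le_rfl)
    ((intervalIntegrable_iff_integrableOn_Icc_of_le zero_le_one).2 hint)
  rw [intervalIntegral.integral_of_le zero_le_one, ← integral_Icc_eq_integral_Ioc,
    integral_norm_eq_lintegral_enorm hmeas] at this
  rw [← ofReal_norm]
  exact ENNReal.ofReal_le_of_le_toReal this

variable [IsRiemannianManifold (𝓡 n) M]

/-- A gradient bound on a ball of radius `r` around `x` bounds the increments from `x`. -/
theorem norm_sub_le_of_dirDeriv_le {u : M → ℂ} (hu : MDifferentiable (𝓡 n) 𝓘(ℝ, ℂ) u)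
    {x : M} {r B : ℝ} (hB0 : 0 ≤ B)
    (hB : ∀ y, dist x y < r → ∀ v : TangentSpace (𝓡 n) y, ‖dirDeriv u y v‖ ≤ B * ‖v‖)
    {y : M} (hy : dist x y < r) : ‖u y - u x‖ ≤ B * dist x y := by
  have key : ∀ ε, dist x y < ε → ε < r → ‖u y - u x‖ ≤ B * ε := by
    intro ε hε hεr
    have hlt : riemannianEDist (𝓡 n) x y < ENNReal.ofReal ε := by
      rw [← IsRiemannianManifold.out (I := 𝓡 n) x y, edist_dist]
      exact (ENNReal.ofReal_lt_ofReal_iff (dist_nonneg.trans_lt hε)).2 hε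
    obtain ⟨γ, h0, h1, hγ, hlen, -, -⟩ :=
      exists_lt_locally_constant_of_riemannianEDist_lt hlt (zero_lt_one' ℝ)
    -- A path of length less than `ε` starting at `x` stays within `ε` of `x`, since its initial
    -- pieces are no longer. So the gradient bound is only needed on the ball.
    have hball : ∀ t ∈ Icc (0 : ℝ) 1, dist x (γ t) < r := by
      intro t ht
      have h2 : edist x (γ t) < ENNReal.ofReal ε := by
        rw [IsRiemannianManifold.out (I := 𝓡 n) x (γ t)]
        refine (riemannianEDist_le_pathELength (hγ.contMDiffOn (s := Icc 0 t)) h0 rfl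
          ht.1).trans_lt ?_
        exact (pathELength_mono le_rfl ht.2).trans_lt hlen
      rw [edist_dist, ENNReal.ofReal_lt_ofReal_iff (dist_nonneg.trans_lt hε)] at h2
      exact h2.trans hεr
    have h3 := enorm_sub_le_pathELength hu hγ hB0 fun t ht => hB _ (hball t ht)
    rw [h0, h1] at h3
    have h4 := h3.trans (mul_le_mul_right hlen.le _)
    rw [← ofReal_norm, ← ENNReal.ofReal_mul hB0] at h4
    exact (ENNReal.ofReal_le_ofReal_iff (mul_nonneg hB0 (dist_nonneg.trans hε.le))).1 h4
  have hlim : Tendsto (fun ε => B * ε) (𝓝[>] (dist x y)) (𝓝 (B * dist x y)) :=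
    ((continuous_const.mul continuous_id).tendsto _).mono_left nhdsWithin_le_nhds
  refine ge_of_tendsto hlim ?_
  filter_upwards [Ioo_mem_nhdsGT hy] with ε hε using key ε hε.1 hε.2

end Gradient

/-! ### From Gaussian moment bounds to decay of Schwartz multipliers. -/

section Localization

open FourierTransform SchwartzMap

/-- Gaussian decay of all the moments `∑ w_j s_j^m` makes the exponential sums
`∑ w_j exp(i k s_j)` small for `|k|` small with respect to `R`. -/
theorem norm_tsum_mul_cexp_le {w : ℕ → ℂ} {s : ℕ → ℝ} {W R : ℝ} (hW : 0 ≤ W)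
    (hw : Summable fun j => ‖w j‖) (hs : ∀ j, s j ∈ Icc (0 : ℝ) 1)
    (hm : ∀ m : ℕ, ‖∑' j, w j * (s j : ℂ) ^ m‖ ≤ W * Real.exp (-R ^ 2 / (m + 1))) (k : ℝ) :
    ‖∑' j, w j * Complex.exp (Complex.I * k * s j)‖ ≤
      W * Real.exp (1 - 2 * R + Real.exp 1 * |k|) := by
  have hexp : ∀ j, Complex.exp (Complex.I * k * s j) =
      ∑' m : ℕ, (Complex.I * k) ^ m / (m.factorial : ℂ) * (s j : ℂ) ^ m := by
    intro j
    rw [Complex.exp_eq_exp_ℂ, NormedSpace.exp_eq_tsum_div]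
    simp only [mul_pow]
    exact tsum_congr fun m => by ring
  have hfac : Summable fun m : ℕ => |k| ^ m / (m.factorial : ℝ) :=
    Real.summable_pow_div_factorial |k|
  have hnorm : ∀ m : ℕ, ‖(Complex.I * k) ^ m / (m.factorial : ℂ)‖ = |k| ^ m / m.factorial := by
    intro m
    simp
  have hprod : Summable fun q : ℕ × ℕ =>
      w q.1 * ((Complex.I * k) ^ q.2 / (q.2.factorial : ℂ) * (s q.1 : ℂ) ^ q.2) := by
    refine Summable.of_norm_bounded (hw.mul_of_nonneg hfac (fun _ => norm_nonneg _)
      fun _ => by positivity) fun q => ?_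
    rw [norm_mul, norm_mul, hnorm, norm_pow, Complex.norm_real, Real.norm_eq_abs,
      abs_of_nonneg (hs q.1).1]
    exact mul_le_mul_of_nonneg_left
      (mul_le_of_le_one_right (by positivity) (pow_le_one₀ (hs q.1).1 (hs q.1).2)) (norm_nonneg _)
  have hswap : ∑' j, w j * Complex.exp (Complex.I * k * s j) =
      ∑' m : ℕ, (Complex.I * k) ^ m / (m.factorial : ℂ) * ∑' j, w j * (s j : ℂ) ^ m := by
    simp only [hexp, ← tsum_mul_left]
    rw [← Summable.tsum_comm (f := fun j m : ℕ =>
      w j * ((Complex.I * k) ^ m / (m.factorial : ℂ) * (s j : ℂ) ^ m)) hprod]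
    exact tsum_congr fun m => tsum_congr fun j => mul_left_comm _ _ _
  have hterm : ∀ m : ℕ, ‖(Complex.I * k) ^ m / (m.factorial : ℂ) * ∑' j, w j * (s j : ℂ) ^ m‖ ≤
      W * Real.exp (1 - 2 * R) * ((Real.exp 1 * |k|) ^ m / m.factorial) := by
    intro m
    rw [norm_mul, hnorm]
    -- From (R - (m+1))² ≥ 0: the Gaussian decay in `R` is traded for decay exp(-2R) and a growth
    -- e^m that the factorials absorb.
    have h1 : -R ^ 2 / ((m : ℝ) + 1) ≤ 1 - 2 * R + m := by
      rw [div_le_iff₀ (by positivity)]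
      nlinarith [sq_nonneg (R - (m + 1))]
    calc |k| ^ m / m.factorial * ‖∑' j, w j * (s j : ℂ) ^ m‖
        ≤ |k| ^ m / m.factorial * (W * Real.exp (1 - 2 * R + m)) := by
          refine mul_le_mul_of_nonneg_left ((hm m).trans ?_) (by positivity)
          exact mul_le_mul_of_nonneg_left (Real.exp_le_exp.2 h1) hW
      _ = W * Real.exp (1 - 2 * R) * ((Real.exp 1 * |k|) ^ m / m.factorial) := by
          rw [Real.exp_add, mul_pow, ← Real.exp_nat_mul, mul_one]
          ring
  have hsum : HasSum (fun m : ℕ => W * Real.exp (1 - 2 * R) *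
      ((Real.exp 1 * |k|) ^ m / m.factorial))
      (W * Real.exp (1 - 2 * R) * Real.exp (Real.exp 1 * |k|)) := by
    have := NormedSpace.expSeries_div_hasSum_exp (𝔸 := ℝ) (Real.exp 1 * |k|)
    rw [← Real.exp_eq_exp_ℝ] at this
    exact this.mul_left _
  rw [hswap]
  refine (tsum_of_norm_bounded hsum hterm).trans_eq ?_
  rw [mul_assoc, ← Real.exp_add]

/-- Powers are dominated by the exponential. -/
theorem one_add_pow_le_factorial_mul_exp {R : ℝ} (hR : 0 ≤ R) (S : ℕ) :
    (1 + R) ^ S ≤ S.factorial * Real.exp (1 + R) := by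
  have := Real.pow_div_factorial_le_exp (1 + R) (by linarith) S
  rwa [div_le_iff₀' (by positivity)] at this

/-- Gaussian decay of all the moments `∑ w_j s_j^m` in `R` gives polynomial decay of every order of
`∑ w_j g(s_j)`, for any Schwartz function `g`. -/
theorem exists_norm_tsum_mul_schwartz_le (g : 𝓢(ℝ, ℂ)) (S : ℕ) :
    ∃ C : ℝ, 0 < C ∧ ∀ (w : ℕ → ℂ) (s : ℕ → ℝ) (W R : ℝ), 0 ≤ R →
      (Summable fun j => ‖w j‖) → ∑' j, ‖w j‖ ≤ W → (∀ j, s j ∈ Icc (0 : ℝ) 1) →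
      (∀ m : ℕ, ‖∑' j, w j * (s j : ℂ) ^ m‖ ≤ W * Real.exp (-R ^ 2 / (m + 1))) →
      ‖∑' j, w j * g (s j)‖ ≤ C * W / (1 + R) ^ S := by
  set G : 𝓢(ℝ, ℂ) := 𝓕 g with hG
  -- The summands are the constants of the frequency ranges e|k| > R and e|k| ≤ R respectively.
  set A : ℝ := Real.exp S * 2 ^ S + S.factorial * Real.exp 2 with hA
  have hApos : 0 < A := by positivity
  have hint : Integrable fun ξ : ℝ => ‖G ξ‖ * (1 + (2 * Real.pi) ^ S * |ξ| ^ S) := by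
    have h1 := (G.integrable_pow_mul volume S).const_mul ((2 * Real.pi) ^ S)
    refine (G.integrable.norm.add h1).congr (Eventually.of_forall fun ξ => ?_)
    simp only [Pi.add_apply, Real.norm_eq_abs]
    ring
  set I : ℝ := ∫ ξ : ℝ, ‖G ξ‖ * (1 + (2 * Real.pi) ^ S * |ξ| ^ S) with hI
  have hI0 : 0 ≤ I := integral_nonneg fun ξ => by positivity
  refine ⟨A * I + 1, by positivity, fun w s W R hR hw hwW hs hm => ?_⟩
  have hW : 0 ≤ W := (tsum_nonneg fun j => norm_nonneg _).trans hwW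
  have hinv : ∀ x : ℝ, g x = ∫ ξ : ℝ, Complex.exp (Complex.I * (2 * Real.pi * ξ : ℝ) * x) * G ξ := by
    intro x
    have h1 : g = 𝓕⁻ G := by rw [hG, fourierInv_fourier_eq]
    have h2 : g x = (𝓕⁻ (G : ℝ → ℂ)) x := by
      conv_lhs => rw [h1]
      rw [SchwartzMap.fourierInv_coe]
    rw [h2, Real.fourierInv_eq']
    refine integral_congr_ae (Eventually.of_forall fun ξ => ?_)
    simp only [smul_eq_mul, RCLike.inner_apply, conj_trivial]
    congr 2
    push_cast
    ring
  have hunit : ∀ (k x : ℝ), ‖Complex.exp (Complex.I * k * x)‖ = 1 := by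
    intro k x
    rw [show Complex.I * k * x = ((k * x : ℝ) : ℂ) * Complex.I by push_cast; ring]
    exact Complex.norm_exp_ofReal_mul_I _
  have hF : ∀ k : ℝ, ‖∑' j, w j * Complex.exp (Complex.I * k * s j)‖ ≤
      A * W * (1 + |k| ^ S) / (1 + R) ^ S := by
    intro k
    have hRS : 0 < (1 + R) ^ S := by positivity
    rw [le_div_iff₀ hRS]
    have hkS : 0 ≤ |k| ^ S := by positivity
    -- Low frequencies have the decay exp(1 - R). At high frequencies the trivial bound `W` is used:
    -- there 1 + R is at most e(1 + |k|), and the loss |k|^S is paid for by the rapid decay of the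
    -- Fourier transform of `g`.
    rcases le_or_gt (Real.exp 1 * |k|) R with hk | hk
    · have h1 := norm_tsum_mul_cexp_le hW hw hs hm k
      calc _ ≤ W * Real.exp (1 - R) * (S.factorial * Real.exp (1 + R)) := by
            refine mul_le_mul (h1.trans ?_) (one_add_pow_le_factorial_mul_exp hR S) hRS.le
              (by positivity)
            exact mul_le_mul_of_nonneg_left (Real.exp_le_exp.2 (by linarith)) hW
        _ = W * (S.factorial * (Real.exp (1 - R) * Real.exp (1 + R))) := by ring
        _ = W * (S.factorial * Real.exp 2) := by rw [← Real.exp_add]; norm_num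
        _ ≤ W * (A * (1 + |k| ^ S)) := by
            refine mul_le_mul_of_nonneg_left ?_ hW
            have : S.factorial * Real.exp 2 ≤ A := by rw [hA]; linarith [show 0 ≤ Real.exp S * 2 ^ S by positivity]
            nlinarith
        _ = A * W * (1 + |k| ^ S) := by ring
    · have h1 : ‖∑' j, w j * Complex.exp (Complex.I * k * s j)‖ ≤ W := by
        refine (norm_tsum_le_tsum_norm (by simpa [hunit] using hw)).trans ?_
        simpa [hunit] using hwW
      have h2 : 1 + R ≤ Real.exp 1 * (1 + |k|) := by
        have : 1 ≤ Real.exp 1 := Real.one_le_exp zero_le_one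
        linarith
      have h3 : (1 + |k|) ^ S ≤ 2 ^ S * (1 + |k| ^ S) := by
        have h4 : 1 + |k| ≤ 2 * max 1 |k| := by
          linarith [le_max_left 1 |k|, le_max_right 1 |k|]
        refine (pow_le_pow_left₀ (by positivity) h4 S).trans ?_
        rw [mul_pow]
        refine mul_le_mul_of_nonneg_left ?_ (by positivity)
        rcases max_choice 1 |k| with h | h <;> rw [h] <;> simp
      calc _ ≤ W * (Real.exp S * (2 ^ S * (1 + |k| ^ S))) := by
            refine mul_le_mul h1 ?_ hRS.le hW
            refine (pow_le_pow_left₀ (by positivity) h2 S).trans ?_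
            rw [mul_pow, ← Real.exp_nat_mul, mul_one]
            exact mul_le_mul_of_nonneg_left h3 (Real.exp_pos _).le
        _ ≤ W * (A * (1 + |k| ^ S)) := by
            refine mul_le_mul_of_nonneg_left ?_ hW
            rw [← mul_assoc]
            refine mul_le_mul_of_nonneg_right ?_ (by positivity)
            rw [hA]
            linarith [show 0 ≤ S.factorial * Real.exp 2 by positivity]
        _ = A * W * (1 + |k| ^ S) := by ring
  have hswap : ∑' j, w j * g (s j) = ∫ ξ : ℝ,
      (∑' j, w j * Complex.exp (Complex.I * (2 * Real.pi * ξ : ℝ) * s j)) * G ξ := by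
    have h1 : ∀ j, w j * g (s j) = ∫ ξ : ℝ,
        w j * Complex.exp (Complex.I * (2 * Real.pi * ξ : ℝ) * s j) * G ξ := by
      intro j
      rw [hinv, ← integral_const_mul]
      exact integral_congr_ae (Eventually.of_forall fun ξ => by simp only [mul_assoc])
    have hnorm : ∀ j (ξ : ℝ), ‖w j * Complex.exp (Complex.I * (2 * Real.pi * ξ : ℝ) * s j) * G ξ‖ =
        ‖w j‖ * ‖G ξ‖ := by
      intro j ξ
      rw [norm_mul, norm_mul, hunit, mul_one]
    simp only [h1, ← tsum_mul_right]
    refine (integral_tsum_of_summable_integral_norm (fun j => ?_) ?_)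
    · refine (G.integrable.norm.const_mul ‖w j‖).mono' ?_
        (Eventually.of_forall fun ξ => (hnorm j ξ).le)
      exact (by fun_prop : Continuous fun ξ : ℝ =>
        w j * Complex.exp (Complex.I * (2 * Real.pi * ξ : ℝ) * s j) * G ξ).aestronglyMeasurable
    · simp only [hnorm, integral_const_mul]
      exact hw.mul_right _
  rw [hswap]
  refine (norm_integral_le_of_norm_le (hint.const_mul (A * W / (1 + R) ^ S))
    (Eventually.of_forall fun ξ => ?_)).trans ?_
  · rw [norm_mul]
    refine (mul_le_mul_of_nonneg_right (hF _) (norm_nonneg _)).trans_eq ?_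
    rw [abs_mul, abs_of_pos Real.two_pi_pos, mul_pow]
    ring
  · rw [integral_const_mul, ← hI, div_mul_eq_mul_div]
    refine div_le_div_of_nonneg_right ?_ (by positivity)
    nlinarith

end Localization

/-! ### Decaying weights, and the heat kernel as moments of the nodes. -/

section Kernels


/-- The weight `(1 + ρ(x, y) / h)^(-m)`. -/
noncomputable def decayWeight {M : Type*} [MetricSpace M] (h : ℝ) (m : ℕ) (x y : M) : ℝ :=
  ((1 + dist x y / h) ^ m)⁻¹

section Decay

variable {M : Type*} [MetricSpace M] {h : ℝ}

theorem one_le_one_add_dist_div (hh : 0 < h) (x y : M) : 1 ≤ 1 + dist x y / h := by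
  have : 0 ≤ dist x y / h := by positivity
  linarith

theorem decayWeight_pos (hh : 0 < h) (m : ℕ) (x y : M) : 0 < decayWeight h m x y := by
  unfold decayWeight
  positivity

theorem decayWeight_le_one (hh : 0 < h) (m : ℕ) (x y : M) : decayWeight h m x y ≤ 1 :=
  inv_le_one_of_one_le₀ (one_le_pow₀ (one_le_one_add_dist_div hh x y))

theorem decayWeight_comm (h : ℝ) (m : ℕ) (x y : M) : decayWeight h m x y = decayWeight h m y x := by
  rw [decayWeight, decayWeight, dist_comm]

theorem decayWeight_add (h : ℝ) (m m' : ℕ) (x y : M) :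
    decayWeight h (m + m') x y = decayWeight h m x y * decayWeight h m' x y := by
  rw [decayWeight, decayWeight, decayWeight, pow_add, mul_inv]

theorem continuous_decayWeight (hh : 0 < h) (m : ℕ) :
    Continuous fun q : M × M => decayWeight h m q.1 q.2 := by
  unfold decayWeight
  refine Continuous.inv₀ (by fun_prop) fun q => ?_
  positivity

/-- The weight varies by a bounded factor on balls of radius comparable to `h`. -/
theorem decayWeight_le_mul_decayWeight (hh : 0 < h) (m : ℕ) {a : ℝ} (ha : 0 ≤ a) {x y z : M}
    (hyz : dist y z ≤ a * h) : decayWeight h m x y ≤ (1 + a) ^ m * decayWeight h m x z := by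
  unfold decayWeight
  rw [inv_eq_one_div, div_le_iff₀ (by positivity), ← div_eq_mul_inv, div_mul_eq_mul_div,
    one_le_div (by positivity), ← mul_pow]
  refine pow_le_pow_left₀ (by positivity) ?_ m
  have h1 : dist x z / h ≤ dist x y / h + a := by
    rw [div_le_iff₀ hh, add_mul, div_mul_cancel₀ _ hh.ne']
    linarith [dist_triangle x y z]
  have h2 : 0 ≤ a * (dist x y / h) := by positivity
  nlinarith

/-- Gaussians are dominated by polynomially decaying weights. -/
theorem exists_exp_neg_mul_sq_le {κ : ℝ} (hκ : 0 < κ) (S : ℕ) :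
    ∃ C : ℝ, 0 < C ∧ ∀ r : ℝ, 0 ≤ r → Real.exp (-κ * r ^ 2) ≤ C * ((1 + r) ^ S)⁻¹ := by
  -- 1 + 1/(4κ) is the maximum of 1 + r - κ r² over r.
  refine ⟨S.factorial * Real.exp (1 + 1 / (4 * κ)), by positivity, fun r hr => ?_⟩
  rw [← div_eq_mul_inv, le_div_iff₀ (by positivity)]
  calc Real.exp (-κ * r ^ 2) * (1 + r) ^ S
      ≤ Real.exp (-κ * r ^ 2) * (S.factorial * Real.exp (1 + r)) :=
        mul_le_mul_of_nonneg_left (one_add_pow_le_factorial_mul_exp hr S) (Real.exp_pos _).le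
    _ = S.factorial * Real.exp (-κ * r ^ 2 + (1 + r)) := by
        rw [Real.exp_add (-κ * r ^ 2) (1 + r)]
        ring
    _ ≤ _ := by
        refine mul_le_mul_of_nonneg_left (Real.exp_le_exp.2 ?_) (by positivity)
        have h1 : κ * r ^ 2 - r + 1 / (4 * κ) = κ * (r - 1 / (2 * κ)) ^ 2 := by
          field_simp
          ring
        have h2 : 0 ≤ κ * (r - 1 / (2 * κ)) ^ 2 := by positivity
        linarith

end Decay

/-- The nodes `exp(-ℓₖ² h²)`. -/
noncomputable def heatNode (ℓ : ℕ → ℝ) (h : ℝ) (k : ℕ) : ℝ :=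
  Real.exp (-(ℓ k) ^ 2 * h ^ 2)

theorem heatNode_pos (ℓ : ℕ → ℝ) (h : ℝ) (k : ℕ) : 0 < heatNode ℓ h k := Real.exp_pos _

theorem heatNode_mem_Icc (ℓ : ℕ → ℝ) (h : ℝ) (k : ℕ) : heatNode ℓ h k ∈ Icc (0 : ℝ) 1 := by
  refine ⟨(heatNode_pos ℓ h k).le, Real.exp_le_one_iff.2 ?_⟩
  rw [neg_mul, neg_nonpos]
  positivity

/-- The kernel `∑ₖ sₖ g(sₖ) φₖ(x) conj φₖ(y)` with `sₖ = exp(-ℓₖ² h²)`. -/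
noncomputable def spectralKernel {M : Type*} (φ : ℕ → M → ℂ) (ℓ : ℕ → ℝ) (h : ℝ) (g : ℝ → ℂ) (x y : M) : ℂ :=
  ∑' k, (heatNode ℓ h k : ℂ) * φ k x * conj (φ k y) * g (heatNode ℓ h k)

theorem spectralKernel_one {M : Type*} (φ : ℕ → M → ℂ) (ℓ : ℕ → ℝ) (h : ℝ) (x y : M) :
    spectralKernel φ ℓ h (fun _ => 1) x y = heatKernel φ ℓ (h ^ 2) x y := by
  simp only [spectralKernel, heatKernel, heatNode, mul_one]

theorem rpow_sq_neg_div_two {h : ℝ} (hh : 0 < h) (α : ℝ) : (h ^ 2) ^ (-α / 2) = h ^ (-α) := by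
  rw [← Real.rpow_natCast, ← Real.rpow_mul hh.le]
  congr 1
  push_cast
  ring

theorem heatKernel_conj {M : Type*} (φ : ℕ → M → ℂ) (ℓ : ℕ → ℝ) (t : ℝ) (x y : M) :
    conj (heatKernel φ ℓ t x y) = heatKernel φ ℓ t y x := by
  rw [heatKernel, heatKernel, Complex.conj_tsum]
  refine tsum_congr fun k => ?_
  simp only [map_mul, Complex.conj_ofReal, Complex.conj_conj]
  ring

theorem sq_mem_Ioc {h : ℝ} (hh : h ∈ Ioc (0 : ℝ) 1) : h ^ 2 ∈ Ioc (0 : ℝ) 1 :=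
  ⟨by have := hh.1; positivity, pow_le_one₀ hh.1.le hh.2⟩

/-- The arithmetic–geometric mean inequality reduces absolute convergence off the diagonal to the
diagonal, the only place where summability is assumed. -/
theorem norm_weight_le {M : Type*} (φ : ℕ → M → ℂ) (ℓ : ℕ → ℝ) (h : ℝ) (x y : M) (k : ℕ) :
    ‖(heatNode ℓ h k : ℂ) * φ k x * conj (φ k y)‖ ≤
      heatNode ℓ h k * ‖φ k x‖ ^ 2 / 2 + heatNode ℓ h k * ‖φ k y‖ ^ 2 / 2 := by
  rw [norm_mul, norm_mul, Complex.norm_real, Real.norm_eq_abs, abs_of_pos (heatNode_pos ℓ h k),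
    RCLike.norm_conj]
  nlinarith [sq_nonneg (‖φ k x‖ - ‖φ k y‖), heatNode_pos ℓ h k]

namespace IsDiffusionSystem

variable {n : ℕ} {M : Type*} [MetricSpace M] [ChartedSpace (EuclideanSpace ℝ (Fin n)) M]
  [RiemannianBundle (fun x : M => TangentSpace (𝓡 n) x)] [MeasurableSpace M] {μ : Measure M}
  {α κ₂ κ₃ κ₄ : ℝ} {φ : ℕ → M → ℂ} {ℓ : ℕ → ℝ}

theorem norm_heatKernel_sq_le (hS : IsDiffusionSystem (n := n) μ α κ₂ κ₃ κ₄ φ ℓ) {h : ℝ}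
    (hh : h ∈ Ioc (0 : ℝ) 1) (x y : M) :
    ‖heatKernel φ ℓ (h ^ 2) x y‖ ≤ κ₂ * h ^ (-α) * Real.exp (-κ₃ * (dist x y / h) ^ 2) := by
  have := hS.gaussian x y (h ^ 2) (sq_mem_Ioc hh)
  rwa [rpow_sq_neg_div_two hh.1, mul_div_assoc, ← div_pow] at this

theorem tsum_heatNode_sq_le (hS : IsDiffusionSystem (n := n) μ α κ₂ κ₃ κ₄ φ ℓ) {h : ℝ}
    (hh : h ∈ Ioc (0 : ℝ) 1) (x : M) :
    ∑' k, heatNode ℓ h k * ‖φ k x‖ ^ 2 ≤ κ₂ * h ^ (-α) := by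
  have h1 := hS.norm_heatKernel_sq_le hh x x
  have h2 : heatKernel φ ℓ (h ^ 2) x x = ((∑' k, heatNode ℓ h k * ‖φ k x‖ ^ 2 : ℝ) : ℂ) := by
    rw [heatKernel, Complex.ofReal_tsum]
    refine tsum_congr fun k => ?_
    rw [mul_assoc, Complex.mul_conj, Complex.normSq_eq_norm_sq, ← Complex.ofReal_mul]
    rfl
  rw [h2, Complex.norm_real, dist_self, zero_div, zero_pow two_ne_zero, mul_zero, Real.exp_zero,
    mul_one] at h1
  exact (le_abs_self _).trans h1

theorem summable_heatNode_sq (hS : IsDiffusionSystem (n := n) μ α κ₂ κ₃ κ₄ φ ℓ) {h : ℝ}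
    (hh : h ∈ Ioc (0 : ℝ) 1) (x : M) : Summable fun k => heatNode ℓ h k * ‖φ k x‖ ^ 2 :=
  hS.summable x (h ^ 2) (sq_mem_Ioc hh)

theorem summable_norm_weight (hS : IsDiffusionSystem (n := n) μ α κ₂ κ₃ κ₄ φ ℓ) {h : ℝ}
    (hh : h ∈ Ioc (0 : ℝ) 1) (x y : M) :
    Summable fun k => ‖(heatNode ℓ h k : ℂ) * φ k x * conj (φ k y)‖ :=
  Summable.of_nonneg_of_le (fun _ => norm_nonneg _) (norm_weight_le φ ℓ h x y)
    (((hS.summable_heatNode_sq hh x).div_const 2).add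
      ((hS.summable_heatNode_sq hh y).div_const 2))

theorem tsum_norm_weight_le (hS : IsDiffusionSystem (n := n) μ α κ₂ κ₃ κ₄ φ ℓ) {h : ℝ}
    (hh : h ∈ Ioc (0 : ℝ) 1) (x y : M) :
    ∑' k, ‖(heatNode ℓ h k : ℂ) * φ k x * conj (φ k y)‖ ≤ κ₂ * h ^ (-α) := by
  have hx := (hS.summable_heatNode_sq hh x).div_const 2
  have hy := (hS.summable_heatNode_sq hh y).div_const 2
  refine ((hS.summable_norm_weight hh x y).tsum_le_tsum (norm_weight_le φ ℓ h x y)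
    (hx.add hy)).trans ?_
  rw [hx.tsum_add hy, tsum_div_const, tsum_div_const]
  linarith [hS.tsum_heatNode_sq_le hh x, hS.tsum_heatNode_sq_le hh y]

/-- The factor s_k built into `spectralKernel` provides convergence, so that `g` only has to be
bounded on [0, 1]. -/
theorem summable_spectralKernel (hS : IsDiffusionSystem (n := n) μ α κ₂ κ₃ κ₄ φ ℓ) {h : ℝ}
    (hh : h ∈ Ioc (0 : ℝ) 1) {g : ℝ → ℂ} {b : ℝ} (hg : ∀ s ∈ Icc (0 : ℝ) 1, ‖g s‖ ≤ b) (x y : M) :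
    Summable fun k => (heatNode ℓ h k : ℂ) * φ k x * conj (φ k y) * g (heatNode ℓ h k) := by
  refine Summable.of_norm_bounded ((hS.summable_norm_weight hh x y).mul_right b) fun k => ?_
  rw [norm_mul]
  exact mul_le_mul_of_nonneg_left (hg _ (heatNode_mem_Icc ℓ h k)) (norm_nonneg _)

/-- The moments of the weights `sₖ φₖ(x) conj φₖ(y)` are values of the heat kernel. -/
theorem norm_tsum_weight_mul_pow_le (hS : IsDiffusionSystem (n := n) μ α κ₂ κ₃ κ₄ φ ℓ)
    (hα : 0 < α) (hκ₂ : 0 < κ₂) (hκ₃ : 0 < κ₃) {D : ℝ} {h : ℝ} (hh : h ∈ Ioc (0 : ℝ) 1) {x y : M}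
    (hD : dist x y ≤ D) (m : ℕ) :
    ‖∑' k, (heatNode ℓ h k : ℂ) * φ k x * conj (φ k y) * (heatNode ℓ h k : ℂ) ^ m‖ ≤
      κ₂ * Real.exp (κ₃ * D ^ 2) * h ^ (-α) *
        Real.exp (-(Real.sqrt κ₃ * (dist x y / h)) ^ 2 / (m + 1)) := by
  have hh0 := hh.1
  have hm : (0 : ℝ) < m + 1 := by positivity
  have hnode : ∀ k, heatNode ℓ h k * heatNode ℓ h k ^ m =
      Real.exp (-(ℓ k) ^ 2 * ((m + 1) * h ^ 2)) := by
    intro k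
    rw [heatNode, ← pow_succ', ← Real.exp_nat_mul]
    congr 1
    push_cast
    ring
  have hexp : -(Real.sqrt κ₃ * (dist x y / h)) ^ 2 / ((m : ℝ) + 1) =
      -κ₃ * dist x y ^ 2 / ((m + 1) * h ^ 2) := by
    rw [mul_pow, Real.sq_sqrt hκ₃.le]
    field_simp
  have hh1 : 1 ≤ h ^ (-α) := Real.one_le_rpow_of_pos_of_le_one_of_nonpos hh0 hh.2 (by linarith)
  rw [hexp]
  -- The m-th moment is the heat kernel at time (m+1)h², to which the Gaussian bound applies only up
  -- to time 1. Beyond it, the sum is compared with absolute values at time 1; the Gaussian factor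
  -- is then at least exp(-κ₃ D²), which the factor exp(κ₃ D²) in the bound compensates.
  rcases le_or_gt (((m : ℝ) + 1) * h ^ 2) 1 with ht | ht
  · have h1 : ∑' k, (heatNode ℓ h k : ℂ) * φ k x * conj (φ k y) * (heatNode ℓ h k : ℂ) ^ m =
        heatKernel φ ℓ ((m + 1) * h ^ 2) x y := by
      refine tsum_congr fun k => ?_
      rw [← hnode]
      push_cast
      ring
    rw [h1]
    refine (hS.gaussian x y _ ⟨by positivity, ht⟩).trans ?_
    refine mul_le_mul_of_nonneg_right ?_ (Real.exp_pos _).le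
    have h2 : (((m : ℝ) + 1) * h ^ 2) ^ (-α / 2) ≤ h ^ (-α) := by
      rw [← rpow_sq_neg_div_two hh0]
      refine Real.rpow_le_rpow_of_nonpos (by positivity) ?_ (by linarith)
      have : 0 ≤ (m : ℝ) * h ^ 2 := by positivity
      linarith
    have h3 : 1 ≤ Real.exp (κ₃ * D ^ 2) := Real.one_le_exp (by positivity)
    calc _ ≤ κ₂ * h ^ (-α) := mul_le_mul_of_nonneg_left h2 hκ₂.le
      _ ≤ _ := by
        refine mul_le_mul_of_nonneg_right ?_ (by positivity)
        nlinarith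
  · have h1 : ‖∑' k, (heatNode ℓ h k : ℂ) * φ k x * conj (φ k y) * (heatNode ℓ h k : ℂ) ^ m‖ ≤
        κ₂ := by
      have hone : (1 : ℝ) ∈ Ioc (0 : ℝ) 1 := ⟨one_pos, le_rfl⟩
      refine (tsum_of_norm_bounded (hS.summable_norm_weight hone x y).hasSum fun k => ?_).trans
        ((hS.tsum_norm_weight_le hone x y).trans_eq (by rw [Real.one_rpow, mul_one]))
      rw [show (heatNode ℓ h k : ℂ) * φ k x * conj (φ k y) * (heatNode ℓ h k : ℂ) ^ m =
        ((heatNode ℓ h k * heatNode ℓ h k ^ m : ℝ) : ℂ) * φ k x * conj (φ k y) by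
          push_cast; ring, hnode]
      simp only [norm_mul, Complex.norm_real, Real.norm_eq_abs, abs_of_pos (Real.exp_pos _),
        abs_of_pos (heatNode_pos _ _ _)]
      refine mul_le_mul_of_nonneg_right (mul_le_mul_of_nonneg_right ?_ (norm_nonneg _))
        (norm_nonneg _)
      refine Real.exp_le_exp.2 ?_
      rw [one_pow]
      nlinarith [sq_nonneg (ℓ k)]
    refine h1.trans ?_
    have h2 : 1 ≤ Real.exp (κ₃ * D ^ 2) *
        Real.exp (-κ₃ * dist x y ^ 2 / (((m : ℝ) + 1) * h ^ 2)) := by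
      rw [← Real.exp_add]
      refine Real.one_le_exp ?_
      have h3 : κ₃ * dist x y ^ 2 / (((m : ℝ) + 1) * h ^ 2) ≤ κ₃ * dist x y ^ 2 :=
        div_le_self (by positivity) ht.le
      have h4 : κ₃ * dist x y ^ 2 ≤ κ₃ * D ^ 2 :=
        mul_le_mul_of_nonneg_left (pow_le_pow_left₀ dist_nonneg hD 2) hκ₃.le
      rw [neg_mul, neg_div]
      linarith
    calc κ₂ ≤ κ₂ * ((Real.exp (κ₃ * D ^ 2) *
        Real.exp (-κ₃ * dist x y ^ 2 / (((m : ℝ) + 1) * h ^ 2))) * h ^ (-α)) :=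
          le_mul_of_one_le_right hκ₂.le (one_le_mul_of_one_le_of_one_le h2 hh1)
      _ = _ := by ring

end IsDiffusionSystem

end Kernels

/-! ### Polynomial localization of the kernels and their action on the `φ j`. -/

section KernelBounds

open SchwartzMap

variable {n : ℕ} {M : Type*} [MetricSpace M] [ChartedSpace (EuclideanSpace ℝ (Fin n)) M]
  [RiemannianBundle (fun x : M => TangentSpace (𝓡 n) x)] [MeasurableSpace M]

/-- Spectral kernels with a Schwartz multiplier decay polynomially of every order. -/
theorem exists_norm_spectralKernel_le [CompactSpace M] (μ : Measure M) {α κ₂ κ₃ : ℝ} (κ₄ : ℝ)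
    (hα : 0 < α) (hκ₂ : 0 < κ₂) (hκ₃ : 0 < κ₃) (g : 𝓢(ℝ, ℂ)) (S : ℕ) :
    ∃ C : ℝ, 0 < C ∧ ∀ (φ : ℕ → M → ℂ) (ℓ : ℕ → ℝ),
      IsDiffusionSystem (n := n) μ α κ₂ κ₃ κ₄ φ ℓ → ∀ h ∈ Ioc (0 : ℝ) 1, ∀ x y : M,
        ‖spectralKernel φ ℓ h g x y‖ ≤ C * h ^ (-α) * decayWeight h S x y := by
  obtain ⟨C, hC, hmain⟩ := exists_norm_tsum_mul_schwartz_le g S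
  set D := Metric.diam (univ : Set M) with hDdef
  -- Allows replacing 1 + √κ₃ ρ/h by a multiple of 1 + ρ/h.
  set c : ℝ := min 1 (Real.sqrt κ₃) with hc
  have hc0 : 0 < c := lt_min one_pos (Real.sqrt_pos.2 hκ₃)
  refine ⟨C * (κ₂ * Real.exp (κ₃ * D ^ 2)) * (c ^ S)⁻¹, by positivity,
    fun φ ℓ hS h hh x y => ?_⟩
  have hh0 := hh.1
  have hD : dist x y ≤ D :=
    Metric.dist_le_diam_of_mem isCompact_univ.isBounded (mem_univ x) (mem_univ y)
  have hq : 0 ≤ dist x y / h := by positivity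
  have hexp : 1 ≤ Real.exp (κ₃ * D ^ 2) := Real.one_le_exp (by positivity)
  have hW : ∑' k, ‖(heatNode ℓ h k : ℂ) * φ k x * conj (φ k y)‖ ≤
      κ₂ * Real.exp (κ₃ * D ^ 2) * h ^ (-α) := by
    refine (hS.tsum_norm_weight_le hh x y).trans ?_
    refine mul_le_mul_of_nonneg_right ?_ (by positivity)
    nlinarith
  have h1 := hmain _ _ _ (Real.sqrt κ₃ * (dist x y / h)) (by positivity)
    (hS.summable_norm_weight hh x y) hW (heatNode_mem_Icc ℓ h)
    (hS.norm_tsum_weight_mul_pow_le hα hκ₂ hκ₃ hh hD)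
  refine h1.trans ?_
  have h2 : c * (1 + dist x y / h) ≤ 1 + Real.sqrt κ₃ * (dist x y / h) := by
    have h3 : c ≤ 1 := min_le_left _ _
    have h4 : c ≤ Real.sqrt κ₃ := min_le_right _ _
    nlinarith
  have h5 : ((1 + Real.sqrt κ₃ * (dist x y / h)) ^ S)⁻¹ ≤ (c ^ S)⁻¹ * decayWeight h S x y := by
    rw [decayWeight, ← mul_inv, ← mul_pow]
    exact inv_anti₀ (by positivity) (pow_le_pow_left₀ (by positivity) h2 S)
  calc _ = C * (κ₂ * Real.exp (κ₃ * D ^ 2) * h ^ (-α)) *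
        ((1 + Real.sqrt κ₃ * (dist x y / h)) ^ S)⁻¹ := by rw [div_eq_mul_inv]
    _ ≤ C * (κ₂ * Real.exp (κ₃ * D ^ 2) * h ^ (-α)) * ((c ^ S)⁻¹ * decayWeight h S x y) :=
        mul_le_mul_of_nonneg_left h5 (by positivity)
    _ = _ := by ring

/-- The heat kernel decays polynomially of every order. -/
theorem exists_norm_heatKernel_le (μ : Measure M) (α : ℝ) {κ₂ κ₃ : ℝ} (κ₄ : ℝ)
    (hκ₂ : 0 < κ₂) (hκ₃ : 0 < κ₃) (S : ℕ) :
    ∃ C : ℝ, 0 < C ∧ ∀ (φ : ℕ → M → ℂ) (ℓ : ℕ → ℝ),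
      IsDiffusionSystem (n := n) μ α κ₂ κ₃ κ₄ φ ℓ → ∀ h ∈ Ioc (0 : ℝ) 1, ∀ x y : M,
        ‖heatKernel φ ℓ (h ^ 2) x y‖ ≤ C * h ^ (-α) * decayWeight h S x y := by
  obtain ⟨C, hC, hexp⟩ := exists_exp_neg_mul_sq_le hκ₃ S
  refine ⟨κ₂ * C, by positivity, fun φ ℓ hS h hh x y => ?_⟩
  have hh0 := hh.1
  refine (hS.norm_heatKernel_sq_le hh x y).trans ?_
  calc _ ≤ κ₂ * h ^ (-α) * (C * decayWeight h S x y) :=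
        mul_le_mul_of_nonneg_left (hexp _ (by positivity)) (by positivity)
    _ = _ := by ring

/-- The increments of the heat kernel decay polynomially of every order. -/
theorem exists_norm_heatKernel_sub_le [IsRiemannianManifold (𝓡 n) M] (μ : Measure M) (α : ℝ)
    {κ₂ κ₃ : ℝ} (κ₄ : ℝ) (hκ₂ : 0 < κ₂) (hκ₃ : 0 < κ₃) (S : ℕ) :
    ∃ C : ℝ, 0 < C ∧ ∀ (φ : ℕ → M → ℂ) (ℓ : ℕ → ℝ),
      IsDiffusionSystem (n := n) μ α κ₂ κ₃ κ₄ φ ℓ → ∀ h ∈ Ioc (0 : ℝ) 1, ∀ x y z : M,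
        dist x y ≤ h → ‖heatKernel φ ℓ (h ^ 2) y z - heatKernel φ ℓ (h ^ 2) x z‖ ≤
          C * (dist x y / h) * h ^ (-α) * decayWeight h S x z := by
  obtain ⟨C, hC, hexp⟩ := exists_exp_neg_mul_sq_le hκ₃ S
  refine ⟨κ₂ * C * (1 + 2) ^ S, by positivity, fun φ ℓ hS h hh x y z hxy => ?_⟩
  have hh0 := hh.1
  have hpow : (h ^ 2) ^ (-α / 2 - 1 / 2) = h ^ (-α) * h⁻¹ := by
    rw [← Real.rpow_neg_one h, ← Real.rpow_add hh0, ← Real.rpow_natCast, ← Real.rpow_mul hh0.le]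
    congr 1
    push_cast
    ring
  have hdw := decayWeight_pos hh0 S z x
  -- The gradient bound concerns the second variable, so increments of K(z, ·) are estimated and
  -- transferred by Hermitian symmetry. Radius 2h leaves room for the strict inequality; on that
  -- ball the weight changes by at most 3^S.
  have hgrad := norm_sub_le_of_dirDeriv_le (hS.differentiable z (h ^ 2) (sq_mem_Ioc hh))
    (x := x) (r := 2 * h) (B := κ₂ * C * (1 + 2) ^ S * (h ^ (-α) * h⁻¹) * decayWeight h S z x)
    (by positivity) (fun ξ hξ v => ?_) (y := y) (by linarith)
  · rw [← heatKernel_conj φ ℓ _ z y, ← heatKernel_conj φ ℓ _ z x, ← map_sub, RCLike.norm_conj,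
      decayWeight_comm h S x z]
    refine hgrad.trans_eq ?_
    field_simp
  · refine (hS.gradient z ξ (h ^ 2) (sq_mem_Ioc hh) v).trans ?_
    refine mul_le_mul_of_nonneg_right ?_ (norm_nonneg v)
    rw [hpow, mul_div_assoc, ← div_pow]
    have h1 : Real.exp (-κ₃ * (dist z ξ / h) ^ 2) ≤ C * ((1 + 2) ^ S * decayWeight h S z x) :=
      (hexp _ (by positivity)).trans (mul_le_mul_of_nonneg_left
        (decayWeight_le_mul_decayWeight hh0 S zero_le_two (by rw [dist_comm]; exact hξ.le)) hC.le)
    calc _ ≤ κ₂ * (h ^ (-α) * h⁻¹) * (C * ((1 + 2) ^ S * decayWeight h S z x)) :=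
          mul_le_mul_of_nonneg_left h1 (by positivity)
      _ = _ := by ring

namespace IsDiffusionSystem

variable {μ : Measure M} {α κ₂ κ₃ κ₄ : ℝ} {φ : ℕ → M → ℂ} {ℓ : ℕ → ℝ}

theorem measurable_spectralKernel [BorelSpace M] [SecondCountableTopology M]
    (hS : IsDiffusionSystem (n := n) μ α κ₂ κ₃ κ₄ φ ℓ) {h : ℝ} (hh : h ∈ Ioc (0 : ℝ) 1)
    {g : ℝ → ℂ} {b : ℝ} (hg : ∀ s ∈ Icc (0 : ℝ) 1, ‖g s‖ ≤ b) :
    Measurable fun q : M × M => spectralKernel φ ℓ h g q.1 q.2 := by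
  refine measurable_of_tendsto_metrizable (f := fun (N : ℕ) (q : M × M) =>
    ∑ k ∈ Finset.range N, (heatNode ℓ h k : ℂ) * φ k q.1 * conj (φ k q.2) * g (heatNode ℓ h k))
    (fun N => ?_) ?_
  · refine Finset.measurable_sum _ fun k _ => Continuous.measurable ?_
    have h1 : Continuous fun q : M × M => φ k q.1 := (hS.continuous k).comp continuous_fst
    have h2 : Continuous fun q : M × M => φ k q.2 := (hS.continuous k).comp continuous_snd
    exact ((continuous_const.mul h1).mul (Complex.continuous_conj.comp h2)).mul continuous_const
  · rw [tendsto_pi_nhds]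
    exact fun q => (hS.summable_spectralKernel hh hg q.1 q.2).hasSum.tendsto_sum_nat

/-- Integration against a spectral kernel acts on the `φ j` as the multiplier `s ↦ s g(s)`. -/
theorem integral_spectralKernel_mul [BorelSpace M] [CompactSpace M] [IsFiniteMeasure μ]
    (hS : IsDiffusionSystem (n := n) μ α κ₂ κ₃ κ₄ φ ℓ) {h : ℝ} (hh : h ∈ Ioc (0 : ℝ) 1)
    {g : ℝ → ℂ} {b : ℝ} (hg : ∀ s ∈ Icc (0 : ℝ) 1, ‖g s‖ ≤ b) (x : M) (j : ℕ) :
    ∫ y, spectralKernel φ ℓ h g x y * φ j y ∂μ =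
      heatNode ℓ h j * g (heatNode ℓ h j) * φ j x := by
  obtain ⟨B, hB⟩ := isCompact_univ.exists_bound_of_continuousOn (hS.continuous j).continuousOn
  have hb : 0 ≤ b := (norm_nonneg _).trans (hg 0 ⟨le_rfl, zero_le_one⟩)
  have hterm : ∀ k, ∫ y, (heatNode ℓ h k : ℂ) * φ k x * conj (φ k y) * g (heatNode ℓ h k) * φ j y
      ∂μ = if k = j then heatNode ℓ h j * g (heatNode ℓ h j) * φ j x else 0 := by
    intro k
    have h1 : ∀ y, (heatNode ℓ h k : ℂ) * φ k x * conj (φ k y) * g (heatNode ℓ h k) * φ j y =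
        (heatNode ℓ h k * g (heatNode ℓ h k) * φ k x) * (φ j y * conj (φ k y)) :=
      fun y => by ring
    simp only [h1]
    rw [integral_const_mul, hS.orthonormal]
    rcases eq_or_ne k j with rfl | hkj
    · simp
    · simp [hkj, hkj.symm]
  have hcont : ∀ k, Continuous fun y =>
      (heatNode ℓ h k : ℂ) * φ k x * conj (φ k y) * g (heatNode ℓ h k) * φ j y := fun k =>
    ((continuous_const.mul (Complex.continuous_conj.comp (hS.continuous k))).mul
      continuous_const).mul (hS.continuous j)
  have hlim := tendsto_integral_of_dominated_convergence (μ := μ)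
    (F := fun (N : ℕ) y => ∑ k ∈ Finset.range N,
      (heatNode ℓ h k : ℂ) * φ k x * conj (φ k y) * g (heatNode ℓ h k) * φ j y)
    (f := fun y => spectralKernel φ ℓ h g x y * φ j y)
    (fun _ => κ₂ * h ^ (-α) * b * B)
    (fun N => (continuous_finsetSum _ fun k _ => hcont k).aestronglyMeasurable)
    (integrable_const _) (fun N => Eventually.of_forall fun y => ?_)
    (Eventually.of_forall fun y => ?_)
  · have hsum : ∀ N : ℕ, ∫ y, ∑ k ∈ Finset.range N,
        (heatNode ℓ h k : ℂ) * φ k x * conj (φ k y) * g (heatNode ℓ h k) * φ j y ∂μ =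
        ∑ k ∈ Finset.range N,
          if k = j then heatNode ℓ h j * g (heatNode ℓ h j) * φ j x else 0 := by
      intro N
      rw [integral_finsetSum _ fun k _ => (hcont k).integrable_of_hasCompactSupport
        (HasCompactSupport.of_compactSpace _)]
      exact Finset.sum_congr rfl fun k _ => hterm k
    simp only [hsum] at hlim
    exact tendsto_nhds_unique hlim (hasSum_ite_eq j _).tendsto_sum_nat
  · rw [← Finset.sum_mul, norm_mul]
    refine mul_le_mul ?_ (hB y (mem_univ y)) (norm_nonneg _) ?_
    · refine (norm_sum_le _ _).trans ?_
      calc _ ≤ ∑ k ∈ Finset.range N, ‖(heatNode ℓ h k : ℂ) * φ k x * conj (φ k y)‖ * b :=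
            Finset.sum_le_sum fun k _ => by
              rw [norm_mul]
              exact mul_le_mul_of_nonneg_left (hg _ (heatNode_mem_Icc ℓ h k)) (norm_nonneg _)
        _ = (∑ k ∈ Finset.range N, ‖(heatNode ℓ h k : ℂ) * φ k x * conj (φ k y)‖) * b := by
            rw [Finset.sum_mul]
        _ ≤ κ₂ * h ^ (-α) * b := by
            refine mul_le_mul_of_nonneg_right ?_ hb
            exact ((hS.summable_norm_weight hh x y).sum_le_tsum _ fun _ _ => norm_nonneg _).trans
              (hS.tsum_norm_weight_le hh x y)
    · refine mul_nonneg ?_ hb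
      exact (tsum_nonneg fun _ => norm_nonneg _).trans (hS.tsum_norm_weight_le hh x y)
  · have := (hS.summable_spectralKernel hh hg x y).hasSum.mul_right (φ j y)
    exact this.tendsto_sum_nat

end IsDiffusionSystem

end KernelBounds

/-! ### Jensen's inequality and Schur's test. -/

section Inequalities

/-- The graph of `a ↦ a ^ p` lies above its tangents. -/
theorem rpow_add_mul_sub_le {p a b : ℝ} (hp : 1 ≤ p) (ha : 0 ≤ a) (hb : 0 < b) :
    b ^ p + p * b ^ (p - 1) * (a - b) ≤ a ^ p := by
  have h1 : -1 ≤ a / b - 1 := by linarith [div_nonneg ha hb.le]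
  have h2 := one_add_mul_self_le_rpow_one_add h1 hp
  rw [add_sub_cancel, Real.div_rpow ha hb.le, le_div_iff₀ (by positivity)] at h2
  refine le_trans (le_of_eq ?_) h2
  rw [Real.rpow_sub_one hb.ne']
  field_simp

theorem add_rpow_le_two_rpow_mul {p a b : ℝ} (hp : 1 ≤ p) (ha : 0 ≤ a) (hb : 0 ≤ b) :
    (a + b) ^ p ≤ 2 ^ (p - 1) * (a ^ p + b ^ p) := by
  lift a to NNReal using ha
  lift b to NNReal using hb
  exact_mod_cast NNReal.rpow_add_le_mul_rpow_add_rpow a b hp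

/-- Jensen's inequality for powers, with a weight that need not be normalized. -/
theorem rpow_integral_mul_le {X : Type*} [MeasurableSpace X] {μ : Measure X} {w v : X → ℝ}
    {p : ℝ} (hp : 1 ≤ p) (hw0 : ∀ x, 0 ≤ w x) (hv0 : ∀ x, 0 ≤ v x) (hw : Integrable w μ)
    (hwv : Integrable (fun x => w x * v x) μ) (hwvp : Integrable (fun x => w x * v x ^ p) μ) :
    (∫ x, w x * v x ∂μ) ^ p ≤ (∫ x, w x ∂μ) ^ (p - 1) * ∫ x, w x * v x ^ p ∂μ := by
  have hp0 : p ≠ 0 := by linarith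
  have hW0 : 0 ≤ ∫ x, w x ∂μ := integral_nonneg hw0
  have hwvp0 : 0 ≤ ∫ x, w x * v x ^ p ∂μ :=
    integral_nonneg fun x => mul_nonneg (hw0 x) (Real.rpow_nonneg (hv0 x) p)
  have hI0 : 0 ≤ ∫ x, w x * v x ∂μ := integral_nonneg fun x => mul_nonneg (hw0 x) (hv0 x)
  rcases hI0.eq_or_lt with hI | hI
  · rw [← hI, Real.zero_rpow hp0]
    positivity
  rcases hW0.eq_or_lt with hW | hW
  · exfalso
    have h1 : w =ᵐ[μ] 0 := (integral_eq_zero_iff_of_nonneg hw0 hw).1 hW.symm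
    have h2 : ∫ x, w x * v x ∂μ = 0 := by
      rw [← integral_zero X ℝ (μ := μ)]
      refine integral_congr_ae ?_
      filter_upwards [h1] with x hx
      rw [hx, Pi.zero_apply, zero_mul]
    exact hI.ne' h2
  set I := ∫ x, w x * v x ∂μ with hIdef
  set W := ∫ x, w x ∂μ with hWdef
  -- The tangent to a ↦ a^p is taken at the weighted mean, so its linear term integrates to zero.
  set b := I / W with hb
  have hb0 : 0 < b := div_pos hI hW
  have h1 : ∫ x, (w x * (b ^ p - p * b ^ (p - 1) * b) + p * b ^ (p - 1) * (w x * v x)) ∂μ ≤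
      ∫ x, w x * v x ^ p ∂μ := by
    refine integral_mono ((hw.mul_const _).add (hwv.const_mul _)) hwvp fun x => ?_
    have := mul_le_mul_of_nonneg_left (rpow_add_mul_sub_le hp (hv0 x) hb0) (hw0 x)
    refine le_trans (le_of_eq ?_) this
    ring
  rw [integral_add (hw.mul_const _) (hwv.const_mul _), integral_mul_const,
    integral_const_mul, ← hIdef, ← hWdef] at h1
  have h2 : I = b * W := by rw [hb, div_mul_cancel₀ _ hW.ne']
  have h3 : W * b ^ p ≤ ∫ x, w x * v x ^ p ∂μ := by
    refine le_trans (le_of_eq ?_) h1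
    rw [h2]
    ring
  calc I ^ p = W ^ (p - 1) * (W * b ^ p) := by
        rw [h2, Real.mul_rpow hb0.le hW.le, ← mul_assoc, ← Real.rpow_add_one hW.ne',
          sub_add_cancel, mul_comm]
    _ ≤ _ := mul_le_mul_of_nonneg_left h3 (by positivity)

/-- Schur's test for `L^p` norms with respect to two different measures. -/
theorem integral_rpow_integral_mul_le {X : Type*} [MeasurableSpace X] {μ τ : Measure X}
    [IsFiniteMeasure μ] [IsFiniteMeasure τ] {k : X → X → ℝ} {v : X → ℝ} {p K V A B : ℝ}
    (hp : 1 ≤ p) (hk : Measurable (Function.uncurry k)) (hk0 : ∀ x y, 0 ≤ k x y)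
    (hkK : ∀ x y, k x y ≤ K) (hv : Measurable v) (hv0 : ∀ x, 0 ≤ v x) (hvV : ∀ x, v x ≤ V)
    (hA : ∀ x, ∫ y, k x y ∂μ ≤ A) (hB : ∀ y, ∫ x, k x y ∂τ ≤ B) :
    ∫ x, (∫ y, k x y * v y ∂μ) ^ p ∂τ ≤ A ^ (p - 1) * B * ∫ y, v y ^ p ∂μ := by
  rcases isEmpty_or_nonempty X with hX | ⟨⟨x₀⟩⟩
  · simp [Measure.eq_zero_of_isEmpty τ, Measure.eq_zero_of_isEmpty μ]
  have hp0 : 0 ≤ p := by linarith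
  have hA0 : 0 ≤ A := (integral_nonneg (hk0 x₀)).trans (hA x₀)
  have hK0 : 0 ≤ K := (hk0 x₀ x₀).trans (hkK x₀ x₀)
  have hV0 : 0 ≤ V := (hv0 x₀).trans (hvV x₀)
  have hvp : Measurable fun x => v x ^ p := hv.pow_const p
  have hkx : ∀ x, Measurable (k x) := fun x => hk.comp measurable_prodMk_left
  have hbd : ∀ x y, ‖k x y * v y ^ p‖ ≤ K * V ^ p := by
    intro x y
    have h1 := Real.rpow_nonneg (hv0 y) p
    rw [Real.norm_of_nonneg (mul_nonneg (hk0 x y) h1)]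
    exact mul_le_mul (hkK x y) (Real.rpow_le_rpow (hv0 y) (hvV y) hp0) h1 hK0
  have hint : Integrable (Function.uncurry fun x y => k x y * v y ^ p) (τ.prod μ) :=
    Integrable.of_bound (hk.mul (hvp.comp measurable_snd)).aestronglyMeasurable (K * V ^ p)
      (Eventually.of_forall fun q => hbd q.1 q.2)
  -- Jensen in `y` produces A^(p-1); the factor `B` comes from Fubini. The bounds `K` and `V` only
  -- ensure integrability and do not enter the estimate.
  have hpt : ∀ x, (∫ y, k x y * v y ∂μ) ^ p ≤ A ^ (p - 1) * ∫ y, k x y * v y ^ p ∂μ := by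
    intro x
    have hi1 : Integrable (k x) μ := Integrable.of_bound (hkx x).aestronglyMeasurable K
      (Eventually.of_forall fun y => by rw [Real.norm_of_nonneg (hk0 x y)]; exact hkK x y)
    have hi2 : Integrable (fun y => k x y * v y) μ :=
      Integrable.of_bound ((hkx x).mul hv).aestronglyMeasurable (K * V)
        (Eventually.of_forall fun y => by
          rw [Real.norm_of_nonneg (mul_nonneg (hk0 x y) (hv0 y))]
          exact mul_le_mul (hkK x y) (hvV y) (hv0 y) hK0)
    have hi3 : Integrable (fun y => k x y * v y ^ p) μ :=
      Integrable.of_bound ((hkx x).mul hvp).aestronglyMeasurable (K * V ^ p)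
        (Eventually.of_forall (hbd x))
    refine (rpow_integral_mul_le hp (hk0 x) hv0 hi1 hi2 hi3).trans ?_
    refine mul_le_mul_of_nonneg_right ?_
      (integral_nonneg fun y => mul_nonneg (hk0 x y) (Real.rpow_nonneg (hv0 y) p))
    exact Real.rpow_le_rpow (integral_nonneg (hk0 x)) (hA x) (by linarith)
  have hint2 : Integrable (fun y => v y ^ p) μ :=
    Integrable.of_bound hvp.aestronglyMeasurable (V ^ p) (Eventually.of_forall fun y => by
      rw [Real.norm_of_nonneg (Real.rpow_nonneg (hv0 y) p)]
      exact Real.rpow_le_rpow (hv0 y) (hvV y) hp0)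
  calc ∫ x, (∫ y, k x y * v y ∂μ) ^ p ∂τ
      ≤ ∫ x, A ^ (p - 1) * ∫ y, k x y * v y ^ p ∂μ ∂τ :=
        integral_mono_of_nonneg (Eventually.of_forall fun x => Real.rpow_nonneg
          (integral_nonneg fun y => mul_nonneg (hk0 x y) (hv0 y)) p)
          (hint.integral_prod_left.const_mul _) (Eventually.of_forall hpt)
    _ = A ^ (p - 1) * ∫ y, (∫ x, k x y ∂τ) * v y ^ p ∂μ := by
        rw [integral_const_mul, integral_integral_swap hint]
        simp only [integral_mul_const]
    _ ≤ A ^ (p - 1) * ∫ y, B * v y ^ p ∂μ := by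
        refine mul_le_mul_of_nonneg_left ?_ (Real.rpow_nonneg hA0 _)
        refine integral_mono_of_nonneg (Eventually.of_forall fun y => ?_)
          (hint2.const_mul B) (Eventually.of_forall fun y => ?_)
        · exact mul_nonneg (integral_nonneg fun x => hk0 x y) (Real.rpow_nonneg (hv0 y) p)
        · exact mul_le_mul_of_nonneg_right (hB y) (Real.rpow_nonneg (hv0 y) p)
    _ = _ := by rw [integral_const_mul]; ring

theorem integrable_mul_of_bound {X : Type*} [MeasurableSpace X] {μ : Measure X}
    [IsFiniteMeasure μ] {f g : X → ℝ} (hf : Measurable f) (hg : Measurable g)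
    {a b : ℝ} (hfa : ∀ x, |f x| ≤ a) (hgb : ∀ x, |g x| ≤ b) :
    Integrable (fun x => f x * g x) μ :=
  Integrable.of_bound (hf.mul hg).aestronglyMeasurable (a * b) (Eventually.of_forall fun x => by
    rw [norm_mul]
    exact mul_le_mul (hfa x) (hgb x) (abs_nonneg _) ((abs_nonneg _).trans (hfa x)))

end Inequalities

/-! ### Comparing two measures through averages over balls. -/

section Averages

variable {M : Type*} [MetricSpace M]

/-- The indicator function of the pairs of points at distance at most `r`. -/
noncomputable def nearIndicator (r : ℝ) (x y : M) : ℝ :=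
  (Metric.closedBall x r).indicator 1 y

theorem nearIndicator_nonneg (r : ℝ) (x y : M) : 0 ≤ nearIndicator r x y :=
  indicator_nonneg (fun _ _ => zero_le_one) _

theorem nearIndicator_le_one (r : ℝ) (x y : M) : nearIndicator r x y ≤ 1 :=
  indicator_le_self' (fun _ _ => zero_le_one) _

theorem nearIndicator_of_le {r : ℝ} {x y : M} (h : dist x y ≤ r) : nearIndicator r x y = 1 :=
  indicator_of_mem (Metric.mem_closedBall'.2 h) _

theorem nearIndicator_of_lt {r : ℝ} {x y : M} (h : r < dist x y) : nearIndicator r x y = 0 :=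
  indicator_of_notMem (fun h' => h.not_ge (Metric.mem_closedBall'.1 h')) _

theorem nearIndicator_comm (r : ℝ) (x y : M) : nearIndicator r x y = nearIndicator r y x := by
  rcases le_or_gt (dist x y) r with h | h
  · rw [nearIndicator_of_le h, nearIndicator_of_le (by rwa [dist_comm])]
  · rw [nearIndicator_of_lt h, nearIndicator_of_lt (by rwa [dist_comm])]

theorem abs_uncurry_nearIndicator_le (r : ℝ) (q : M × M) :
    |Function.uncurry (nearIndicator r) q| ≤ 1 :=
  (abs_of_nonneg (nearIndicator_nonneg r q.1 q.2)).trans_le (nearIndicator_le_one r q.1 q.2)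

variable [MeasurableSpace M] [BorelSpace M]

theorem integral_nearIndicator (μ : Measure M) (r : ℝ) (x : M) :
    ∫ y, nearIndicator r x y ∂μ = μ.real (Metric.closedBall x r) :=
  integral_indicator_one Metric.isClosed_closedBall.measurableSet

variable [SecondCountableTopology M] {μ τ : Measure M} [IsFiniteMeasure μ] [IsFiniteMeasure τ]

theorem measurable_nearIndicator (r : ℝ) :
    Measurable (Function.uncurry (nearIndicator r : M → M → ℝ)) := by
  have h1 : MeasurableSet {q : M × M | dist q.1 q.2 ≤ r} :=
    (isClosed_le continuous_dist continuous_const).measurableSet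
  have h2 : Function.uncurry (nearIndicator r : M → M → ℝ) =
      {q : M × M | dist q.1 q.2 ≤ r}.indicator 1 := by
    ext q
    rcases le_or_gt (dist q.1 q.2) r with h | h
    · rw [indicator_of_mem (by exact h)]
      exact nearIndicator_of_le h
    · rw [indicator_of_notMem (by exact h.not_ge)]
      exact nearIndicator_of_lt h
  rw [h2]
  exact measurable_const.indicator h1

/-- If balls of radius `r` have large `μ` measure and small `τ` measure, then integrals against `τ`
of functions which vary little at scale `r` are dominated by integrals against `μ`. -/
theorem mul_integral_le_of_measureReal_closedBall {f : M → ℝ} {F r a b c : ℝ}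
    (hf : Measurable f) (hf0 : ∀ x, 0 ≤ f x) (hfF : ∀ x, f x ≤ F)
    (ha0 : 0 ≤ a) (ha : ∀ y z, dist y z ≤ r → f y ≤ a * f z)
    (hc : ∀ z, c ≤ μ.real (Metric.closedBall z r)) (hb : ∀ z, τ.real (Metric.closedBall z r) ≤ b) :
    c * ∫ y, f y ∂τ ≤ a * b * ∫ z, f z ∂μ := by
  have hfabs : ∀ x, |f x| ≤ F := fun x => by rw [abs_of_nonneg (hf0 x)]; exact hfF x
  have hnear := abs_uncurry_nearIndicator_le (M := M) r
  have hnearm : ∀ y : M, Measurable (nearIndicator r y) := fun y =>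
    (measurable_nearIndicator r).comp measurable_prodMk_left
  have hint : Integrable (Function.uncurry fun y z => nearIndicator r y z * f z) (τ.prod μ) :=
    integrable_mul_of_bound (measurable_nearIndicator r) (hf.comp measurable_snd) hnear
      fun q => hfabs q.2
  have hfμ : Integrable f μ := Integrable.of_bound hf.aestronglyMeasurable F
    (Eventually.of_forall hfabs)
  have hfτ : Integrable f τ := Integrable.of_bound hf.aestronglyMeasurable F
    (Eventually.of_forall hfabs)
  -- Integrating over all pairs of points at distance at most `r` and exchanging the order of
  -- integration takes the place of a covering argument.
  have hpt : ∀ y, c * f y ≤ a * ∫ z, nearIndicator r y z * f z ∂μ := by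
    intro y
    calc c * f y ≤ μ.real (Metric.closedBall y r) * f y :=
          mul_le_mul_of_nonneg_right (hc y) (hf0 y)
      _ = ∫ z, nearIndicator r y z * f y ∂μ := by
          rw [integral_mul_const, integral_nearIndicator]
      _ ≤ ∫ z, a * (nearIndicator r y z * f z) ∂μ := by
          refine integral_mono
            (integrable_mul_of_bound (hnearm y) measurable_const (fun z => hnear (y, z))
              fun _ => hfabs y)
            ((integrable_mul_of_bound (hnearm y) hf (fun z => hnear (y, z)) hfabs).const_mul a)
            fun z => ?_
          rcases le_or_gt (dist y z) r with h | h
          · simpa [nearIndicator_of_le h] using ha y z h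
          · simp [nearIndicator_of_lt h]
      _ = _ := integral_const_mul _ _
  calc c * ∫ y, f y ∂τ = ∫ y, c * f y ∂τ := (integral_const_mul _ _).symm
    _ ≤ ∫ y, a * ∫ z, nearIndicator r y z * f z ∂μ ∂τ :=
        integral_mono (hfτ.const_mul c) (hint.integral_prod_left.const_mul a) hpt
    _ = a * ∫ z, τ.real (Metric.closedBall z r) * f z ∂μ := by
        rw [integral_const_mul, integral_integral_swap hint]
        simp only [integral_mul_const, nearIndicator_comm r _ (_ : M)]
        simp only [integral_nearIndicator]
    _ ≤ a * ∫ z, b * f z ∂μ := by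
        refine mul_le_mul_of_nonneg_left ?_ ha0
        exact integral_mono_of_nonneg
          (Eventually.of_forall fun z => mul_nonneg measureReal_nonneg (hf0 z))
          (hfμ.const_mul b) (Eventually.of_forall fun z =>
            mul_le_mul_of_nonneg_right (hb z) (hf0 z))
    _ = _ := by rw [integral_const_mul]; ring

/-- A function with small oscillation at scale `d` is controlled by its restriction to any measure
which charges all the balls of radius `d`. -/
theorem integral_rpow_le_of_oscillation {f u : M → ℝ} {p F U d b c : ℝ} (hp : 1 ≤ p)
    (hf : Measurable f) (hf0 : ∀ x, 0 ≤ f x) (hfF : ∀ x, f x ≤ F)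
    (hu : Measurable u) (hu0 : ∀ x, 0 ≤ u x) (huU : ∀ x, u x ≤ U)
    (hosc : ∀ x y, dist x y ≤ d → f x ≤ f y + u x) (hc0 : 0 < c)
    (hc : ∀ x, c ≤ τ.real (Metric.closedBall x d)) (hb : ∀ y, μ.real (Metric.closedBall y d) ≤ b) :
    ∫ x, f x ^ p ∂μ ≤
      2 ^ (p - 1) * (c⁻¹ * b * ∫ y, f y ^ p ∂τ) + 2 ^ (p - 1) * ∫ x, u x ^ p ∂μ := by
  have hp0 : 0 ≤ p := by linarith
  have hfp0 : ∀ x, 0 ≤ f x ^ p := fun x => Real.rpow_nonneg (hf0 x) p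
  have hup0 : ∀ x, 0 ≤ u x ^ p := fun x => Real.rpow_nonneg (hu0 x) p
  have hfp : Measurable fun x => f x ^ p := hf.pow_const p
  have hup : Measurable fun x => u x ^ p := hu.pow_const p
  have hfabs : ∀ x, |f x ^ p| ≤ F ^ p := fun x => by
    rw [abs_of_nonneg (hfp0 x)]
    exact Real.rpow_le_rpow (hf0 x) (hfF x) hp0
  have huabs : ∀ x, |u x ^ p| ≤ U ^ p := fun x => by
    rw [abs_of_nonneg (hup0 x)]
    exact Real.rpow_le_rpow (hu0 x) (huU x) hp0
  have hnear := abs_uncurry_nearIndicator_le (M := M) d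
  have hnearm : ∀ x : M, Measurable (nearIndicator d x) := fun x =>
    (measurable_nearIndicator d).comp measurable_prodMk_left
  have hint : Integrable (Function.uncurry fun x y => nearIndicator d x y * f y ^ p) (μ.prod τ) :=
    integrable_mul_of_bound (measurable_nearIndicator d) (hfp.comp measurable_snd) hnear
      fun q => hfabs q.2
  have hint' : Integrable (fun x => ∫ y, nearIndicator d x y * f y ^ p ∂τ) μ :=
    hint.integral_prod_left
  have hiu : Integrable (fun x => u x ^ p) μ := Integrable.of_bound hup.aestronglyMeasurable
    (U ^ p) (Eventually.of_forall huabs)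
  have hif : Integrable (fun x => f x ^ p) τ := Integrable.of_bound hfp.aestronglyMeasurable
    (F ^ p) (Eventually.of_forall hfabs)
  have h2 : (0 : ℝ) ≤ 2 ^ (p - 1) := by positivity
  -- The oscillation inequality is averaged over y ∈ B(x,d) with respect to `τ`, whose mass there is
  -- at least `c`.
  have hpt : ∀ x, f x ^ p ≤ 2 ^ (p - 1) * c⁻¹ * (∫ y, nearIndicator d x y * f y ^ p ∂τ) +
      2 ^ (p - 1) * u x ^ p := by
    intro x
    set m := τ.real (Metric.closedBall x d) with hm
    have hm0 : 0 < m := hc0.trans_le (hc x)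
    have hI0 : 0 ≤ ∫ y, nearIndicator d x y * f y ^ p ∂τ :=
      integral_nonneg fun y => mul_nonneg (nearIndicator_nonneg d x y) (hfp0 y)
    have hi1 := integrable_mul_of_bound (μ := τ) (hnearm x) hfp (fun y => hnear (x, y)) hfabs
    have hi2 := integrable_mul_of_bound (μ := τ) (hnearm x) (measurable_const (a := u x ^ p))
      (fun y => hnear (x, y)) (fun _ => huabs x)
    have h3 : m * f x ^ p ≤ 2 ^ (p - 1) * (∫ y, nearIndicator d x y * f y ^ p ∂τ) +
        2 ^ (p - 1) * (m * u x ^ p) := by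
      calc m * f x ^ p = ∫ y, nearIndicator d x y * f x ^ p ∂τ := by
            rw [integral_mul_const, integral_nearIndicator]
        _ ≤ ∫ y, (2 ^ (p - 1) * (nearIndicator d x y * f y ^ p) +
              2 ^ (p - 1) * (nearIndicator d x y * u x ^ p)) ∂τ := by
            refine integral_mono
              (integrable_mul_of_bound (hnearm x) measurable_const (fun y => hnear (x, y))
                fun _ => hfabs x)
              ((hi1.const_mul _).add (hi2.const_mul _)) fun y => ?_
            rcases le_or_gt (dist x y) d with h | h
            · simp only [nearIndicator_of_le h, one_mul]
              refine (Real.rpow_le_rpow (hf0 x) (hosc x y h) hp0).trans ?_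
              rw [← mul_add]
              exact add_rpow_le_two_rpow_mul hp (hf0 y) (hu0 x)
            · simp [nearIndicator_of_lt h]
        _ = _ := by
            rw [integral_add (hi1.const_mul _) (hi2.const_mul _), integral_const_mul,
              integral_const_mul, integral_mul_const, integral_nearIndicator]
    have h4 : f x ^ p ≤ m⁻¹ * (2 ^ (p - 1) * (∫ y, nearIndicator d x y * f y ^ p ∂τ)) +
        2 ^ (p - 1) * u x ^ p := by
      rw [← mul_le_mul_iff_right₀ hm0]
      refine h3.trans_eq ?_
      field_simp
    refine h4.trans (add_le_add_left ?_ _)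
    have h5 : m⁻¹ ≤ c⁻¹ := inv_anti₀ hc0 (hc x)
    calc _ ≤ c⁻¹ * (2 ^ (p - 1) * (∫ y, nearIndicator d x y * f y ^ p ∂τ)) :=
          mul_le_mul_of_nonneg_right h5 (by positivity)
      _ = _ := by ring
  have hb' : ∫ x, ∫ y, nearIndicator d x y * f y ^ p ∂τ ∂μ ≤ b * ∫ y, f y ^ p ∂τ := by
    rw [integral_integral_swap hint, ← integral_const_mul]
    simp only [integral_mul_const, nearIndicator_comm d _ (_ : M)]
    simp only [integral_nearIndicator]
    exact integral_mono_of_nonneg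
      (Eventually.of_forall fun z => mul_nonneg measureReal_nonneg (hfp0 z))
      (hif.const_mul b) (Eventually.of_forall fun z =>
        mul_le_mul_of_nonneg_right (hb z) (hfp0 z))
  calc ∫ x, f x ^ p ∂μ ≤ ∫ x, (2 ^ (p - 1) * c⁻¹ * (∫ y, nearIndicator d x y * f y ^ p ∂τ) +
        2 ^ (p - 1) * u x ^ p) ∂μ :=
        integral_mono_of_nonneg (Eventually.of_forall hfp0)
          ((hint'.const_mul _).add (hiu.const_mul _)) (Eventually.of_forall hpt)
    _ = 2 ^ (p - 1) * c⁻¹ * (∫ x, ∫ y, nearIndicator d x y * f y ^ p ∂τ ∂μ) +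
        2 ^ (p - 1) * ∫ x, u x ^ p ∂μ := by
        rw [integral_add (hint'.const_mul _) (hiu.const_mul _),
          integral_const_mul, integral_const_mul]
    _ ≤ 2 ^ (p - 1) * c⁻¹ * (b * ∫ y, f y ^ p ∂τ) + 2 ^ (p - 1) * ∫ x, u x ^ p ∂μ :=
        add_le_add_left (mul_le_mul_of_nonneg_left hb' (by positivity)) _
    _ = _ := by ring

end Averages

/-! ### Integrals of the weights, and lower bounds for volumes. -/

section BallMeasure

/-- On a space whose balls of radius `r` have measure at most `κ r^α`, the integrals of the weights
`(1 + ρ(x, ·) / h)^(-m)` with `m > α` are at most a multiple of `h^α`. -/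
theorem exists_integral_decayWeight_le {M : Type*} [MetricSpace M] [MeasurableSpace M]
    [BorelSpace M] (μ : Measure M) [IsFiniteMeasure μ] {α κ : ℝ} (hκ : 0 < κ)
    (hball : ∀ (x : M) (r : ℝ), 0 < r → μ.real (Metric.closedBall x r) ≤ κ * r ^ α)
    {m : ℕ} (hm : α < m) :
    ∃ C : ℝ, 0 < C ∧ ∀ h : ℝ, 0 < h → ∀ x : M, ∫ y, decayWeight h m x y ∂μ ≤ C * h ^ α := by
  set q : ℝ := 2 ^ (α - m) with hq
  have hq0 : 0 < q := by positivity
  have hq1 : q < 1 := Real.rpow_lt_one_of_one_lt_of_neg one_lt_two (by linarith)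
  refine ⟨κ * 2 ^ α * (1 - q)⁻¹, by have := sub_pos.2 hq1; positivity, fun h hh x => ?_⟩
  have hgeom := hasSum_geometric_of_lt_one hq0.le hq1
  have hpt : ∀ y, ENNReal.ofReal (decayWeight h m x y) ≤
      ∑' k : ℕ, (Metric.closedBall x (2 ^ (k + 1) * h)).indicator
        (fun _ => ENNReal.ofReal ((2 ^ (k * m))⁻¹)) y := by
    intro y
    -- Dyadic shell of `y`: the weight is at most 2^(-km) on a ball of volume of order (2^k h)^α, so
    -- the series is geometric with ratio 2^(α-m).
    obtain ⟨k, hk1, hk2⟩ := exists_nat_pow_near (one_le_one_add_dist_div hh x y) one_lt_two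
    refine le_trans ?_ (ENNReal.le_tsum k)
    have hmem : y ∈ Metric.closedBall x (2 ^ (k + 1) * h) := by
      rw [Metric.mem_closedBall', ← div_le_iff₀ hh]
      linarith
    rw [indicator_of_mem hmem]
    refine ENNReal.ofReal_le_ofReal (inv_anti₀ (by positivity) ?_)
    rw [pow_mul]
    exact pow_le_pow_left₀ (by positivity) hk1 m
  have hterm : ∀ k : ℕ, ENNReal.ofReal ((2 ^ (k * m))⁻¹) *
      μ (Metric.closedBall x (2 ^ (k + 1) * h)) ≤
        ENNReal.ofReal (κ * 2 ^ α * h ^ α * q ^ k) := by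
    intro k
    rw [← ofReal_measureReal, ← ENNReal.ofReal_mul (by positivity)]
    refine ENNReal.ofReal_le_ofReal ?_
    refine (mul_le_mul_of_nonneg_left (hball x _ (by positivity)) (by positivity)).trans_eq ?_
    rw [Real.mul_rpow (by positivity) hh.le, hq, pow_succ, Real.mul_rpow (by positivity) (by norm_num),
      Real.rpow_sub two_pos, div_pow, Real.rpow_natCast, ← pow_mul, mul_comm m k,
      ← Real.rpow_natCast ((2 : ℝ) ^ α) k, ← Real.rpow_mul two_pos.le, ← Real.rpow_natCast 2 k,
      ← Real.rpow_mul two_pos.le, mul_comm α]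
    ring
  have hl : ∫⁻ y, ENNReal.ofReal (decayWeight h m x y) ∂μ ≤
      ENNReal.ofReal (κ * 2 ^ α * (1 - q)⁻¹ * h ^ α) := by
    calc _ ≤ ∫⁻ y, (∑' k : ℕ, (Metric.closedBall x (2 ^ (k + 1) * h)).indicator
        (fun _ => ENNReal.ofReal ((2 ^ (k * m))⁻¹)) y) ∂μ := lintegral_mono hpt
      _ = ∑' k : ℕ, ENNReal.ofReal ((2 ^ (k * m))⁻¹) *
          μ (Metric.closedBall x (2 ^ (k + 1) * h)) := by
        rw [lintegral_tsum fun k => (measurable_const.indicator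
          Metric.isClosed_closedBall.measurableSet).aemeasurable]
        exact tsum_congr fun k =>
          lintegral_indicator_const Metric.isClosed_closedBall.measurableSet _
      _ ≤ ∑' k : ℕ, ENNReal.ofReal (κ * 2 ^ α * h ^ α * q ^ k) := ENNReal.tsum_le_tsum hterm
      _ = ENNReal.ofReal (κ * 2 ^ α * (1 - q)⁻¹ * h ^ α) := by
        rw [← ENNReal.ofReal_tsum_of_nonneg (fun k => by positivity) (hgeom.summable.mul_left _),
          tsum_mul_left, hgeom.tsum_eq]
        congr 1
        ring
  have hpos : 0 ≤ κ * 2 ^ α * (1 - q)⁻¹ * h ^ α := by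
    have := sub_pos.2 hq1
    positivity
  rw [integral_eq_lintegral_of_nonneg_ae
    (Eventually.of_forall fun y => (decayWeight_pos hh m x y).le)
    ((continuous_decayWeight hh m).comp (Continuous.prodMk_right x)).aestronglyMeasurable]
  exact ENNReal.toReal_le_of_le_ofReal hpos hl

variable {n : ℕ} {M : Type*} [MetricSpace M] [ChartedSpace (EuclideanSpace ℝ (Fin n)) M]
  [RiemannianBundle (fun x : M => TangentSpace (𝓡 n) x)] [MeasurableSpace M]

namespace IsDiffusionSystem

variable {μ : Measure M} {α κ₂ κ₃ κ₄ : ℝ} {φ : ℕ → M → ℂ} {ℓ : ℕ → ℝ}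

theorem norm_spectralKernel_le (hS : IsDiffusionSystem (n := n) μ α κ₂ κ₃ κ₄ φ ℓ) {h : ℝ}
    (hh : h ∈ Ioc (0 : ℝ) 1) {g : ℝ → ℂ} {b : ℝ} (hg : ∀ s ∈ Icc (0 : ℝ) 1, ‖g s‖ ≤ b) (x y : M) :
    ‖spectralKernel φ ℓ h g x y‖ ≤ κ₂ * h ^ (-α) * b := by
  have hb : 0 ≤ b := (norm_nonneg _).trans (hg 0 ⟨le_rfl, zero_le_one⟩)
  have hsum := (hS.summable_norm_weight hh x y).hasSum.mul_right b
  rw [spectralKernel]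
  refine (tsum_of_norm_bounded hsum fun k => ?_).trans
    (mul_le_mul_of_nonneg_right (hS.tsum_norm_weight_le hh x y) hb)
  rw [norm_mul]
  exact mul_le_mul_of_nonneg_left (hg _ (heatNode_mem_Icc ℓ h k)) (norm_nonneg _)

theorem integrable_spectralKernel_mul [BorelSpace M] [CompactSpace M] [IsFiniteMeasure μ]
    (hS : IsDiffusionSystem (n := n) μ α κ₂ κ₃ κ₄ φ ℓ) {h : ℝ} (hh : h ∈ Ioc (0 : ℝ) 1)
    {g : ℝ → ℂ} {b : ℝ} (hg : ∀ s ∈ Icc (0 : ℝ) 1, ‖g s‖ ≤ b) {f : M → ℂ} (hf : Continuous f)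
    (x : M) : Integrable (fun y => spectralKernel φ ℓ h g x y * f y) μ := by
  obtain ⟨B, hB⟩ := isCompact_univ.exists_bound_of_continuousOn hf.continuousOn
  have hmeas : Measurable (spectralKernel φ ℓ h g x) :=
    Measurable.of_uncurry_left (f := spectralKernel φ ℓ h g) (hS.measurable_spectralKernel hh hg)
  have hmul : Measurable fun y => spectralKernel φ ℓ h g x y * f y := hmeas.mul hf.measurable
  refine Integrable.of_bound hmul.aestronglyMeasurable (κ₂ * h ^ (-α) * b * B)
    (Eventually.of_forall fun y => ?_)
  rw [norm_mul]
  have hk := hS.norm_spectralKernel_le hh hg x y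
  exact mul_le_mul hk (hB y (mem_univ y)) (norm_nonneg _) ((norm_nonneg _).trans hk)

theorem ell_nonneg (hS : IsDiffusionSystem (n := n) μ α κ₂ κ₃ κ₄ φ ℓ) (k : ℕ) : 0 ≤ ℓ k :=
  hS.ell_zero_nonneg.trans (hS.monotone (Nat.zero_le k))

/-- Frequencies up to `L` keep their nodes away from 0 when Lh ≤ 1, so the heat operator can be
inverted on Π_L by a smooth multiplier. -/
theorem exp_neg_one_le_heatNode (hS : IsDiffusionSystem (n := n) μ α κ₂ κ₃ κ₄ φ ℓ) {h L : ℝ}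
    (hh : 0 ≤ h) (hhL : L * h ≤ 1) {k : ℕ} (hk : ℓ k ≤ L) : Real.exp (-1) ≤ heatNode ℓ h k := by
  refine Real.exp_le_exp.2 ?_
  have h1 : ℓ k * h ≤ 1 := (mul_le_mul_of_nonneg_right hk hh).trans hhL
  have h2 : (ℓ k * h) ^ 2 ≤ 1 := pow_le_one₀ (mul_nonneg (hS.ell_nonneg k) hh) h1
  rw [mul_pow] at h2
  linarith

end IsDiffusionSystem

/-- The existence of an admissible system forces lower bounds for the measures of balls. -/
theorem exists_le_measureReal_closedBall [BorelSpace M] [CompactSpace M] (μ : Measure M)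
    [IsFiniteMeasure μ] {α κ₁ κ₂ κ₃ : ℝ} (κ₄ : ℝ) (hκ₁ : 0 < κ₁) (hκ₂ : 0 < κ₂)
    (hκ₃ : 0 < κ₃)
    (hball : ∀ (x : M) (r : ℝ), 0 < r → μ.real (Metric.closedBall x r) ≤ κ₁ * r ^ α) :
    ∃ c : ℝ, 0 < c ∧ ∀ (φ : ℕ → M → ℂ) (ℓ : ℕ → ℝ),
      IsDiffusionSystem (n := n) μ α κ₂ κ₃ κ₄ φ ℓ → ∀ r ∈ Ioc (0 : ℝ) 1, ∀ x : M,
        c * r ^ α ≤ μ.real (Metric.closedBall x r) := by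
  obtain ⟨m, hm⟩ := exists_nat_gt α
  obtain ⟨C₁, hC₁, hint⟩ := exists_integral_decayWeight_le μ hκ₁ hball hm
  -- One order of decay beyond `m` supplies the small factor 1/(1+R) outside B(x, Rh). The value of
  -- `R` makes that part of the integral of the kernel at most half of exp(-1).
  obtain ⟨C, hC, hheat⟩ := exists_norm_heatKernel_le (n := n) μ α κ₄ hκ₂ hκ₃ (m + 1)
  set R : ℝ := 1 + 2 * C * C₁ * Real.exp 1 with hR
  have hR1 : 1 ≤ R := by
    have : 0 ≤ 2 * C * C₁ * Real.exp 1 := by positivity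
    linarith
  have hR0 : 0 < R := by linarith
  refine ⟨Real.exp (-1) / (2 * C) * (R ^ α)⁻¹, by positivity, fun φ ℓ hS r hr x => ?_⟩
  set h := r / R with hhdef
  have hh0 : 0 < h := div_pos hr.1 hR0
  have hh : h ∈ Ioc (0 : ℝ) 1 := ⟨hh0, (div_le_self hr.1.le hR1).trans hr.2⟩
  have hrR : r = R * h := by rw [hhdef]; field_simp
  -- Since φ_0 ≡ 1, the integral of the kernel is the node of φ_0, which is at least exp(-1) because
  -- ℓ_0 ≤ 1.
  have h1 : ‖∫ y, heatKernel φ ℓ (h ^ 2) x y ∂μ‖ = heatNode ℓ h 0 := by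
    have := hS.integral_spectralKernel_mul hh (g := fun _ => 1) (b := 1) (fun _ _ => by simp) x 0
    simp only [spectralKernel_one, hS.phi_zero, mul_one] at this
    rw [this, Complex.norm_real, Real.norm_of_nonneg (heatNode_pos ℓ h 0).le]
  have h2 : Real.exp (-1) ≤ heatNode ℓ h 0 :=
    hS.exp_neg_one_le_heatNode hh0.le (L := 1) (by rw [one_mul]; exact hh.2) hS.ell_zero_le_one
  have hdec : ∀ y, decayWeight h (m + 1) x y ≤
      (Metric.closedBall x r).indicator 1 y + (1 + R)⁻¹ * decayWeight h m x y := by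
    intro y
    have hd := (decayWeight_pos hh0 m x y).le
    by_cases hy : y ∈ Metric.closedBall x r
    · rw [indicator_of_mem hy]
      have := decayWeight_le_one hh0 (m + 1) x y
      have : 0 ≤ (1 + R)⁻¹ * decayWeight h m x y := by positivity
      simp only [Pi.one_apply]
      linarith
    · rw [indicator_of_notMem hy, zero_add, add_comm m 1, decayWeight_add]
      refine mul_le_mul_of_nonneg_right ?_ hd
      rw [decayWeight, pow_one]
      refine inv_anti₀ (by positivity) ?_
      have h3 : R < dist x y / h := by
        rw [lt_div_iff₀ hh0, ← hrR]
        rw [Metric.mem_closedBall'] at hy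
        exact not_le.1 hy
      linarith
  have hcontd : Integrable (fun y => decayWeight h m x y) μ :=
    ((continuous_decayWeight hh0 m).comp (Continuous.prodMk_right x)).integrable_of_hasCompactSupport
      (HasCompactSupport.of_compactSpace _)
  have hmeasB : MeasurableSet (Metric.closedBall x r) := Metric.isClosed_closedBall.measurableSet
  have hindi : Integrable ((Metric.closedBall x r).indicator (1 : M → ℝ)) μ :=
    (integrable_const (1 : ℝ)).indicator hmeasB
  have h4 : heatNode ℓ h 0 ≤
      C * h ^ (-α) * (μ.real (Metric.closedBall x r) + (1 + R)⁻¹ * (C₁ * h ^ α)) := by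
    rw [← h1]
    refine (norm_integral_le_of_norm_le ((hindi.add (hcontd.const_mul (1 + R)⁻¹)).const_mul (C * h ^ (-α)))
      (Eventually.of_forall fun y => ?_)).trans ?_
    · exact (hheat φ ℓ hS h hh x y).trans (mul_le_mul_of_nonneg_left (hdec y) (by positivity))
    · rw [integral_const_mul]
      refine mul_le_mul_of_nonneg_left ?_ (by positivity)
      simp only [Pi.add_apply]
      rw [integral_add hindi (hcontd.const_mul _), integral_const_mul,
        integral_indicator_one hmeasB]
      exact add_le_add_right (mul_le_mul_of_nonneg_left (hint h hh0 x) (by positivity)) _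
  have hhα : h ^ (-α) * h ^ α = 1 := by
    rw [← Real.rpow_add hh0, neg_add_cancel, Real.rpow_zero]
  have h5 : C * C₁ * (1 + R)⁻¹ ≤ Real.exp (-1) / 2 := by
    rw [← div_eq_mul_inv, div_le_div_iff₀ (by positivity) two_pos, Real.exp_neg,
      inv_mul_eq_div, le_div_iff₀ (Real.exp_pos 1)]
    nlinarith
  have h6 : Real.exp (-1) / 2 ≤ C * h ^ (-α) * μ.real (Metric.closedBall x r) := by
    have h7 : C * h ^ (-α) * ((1 + R)⁻¹ * (C₁ * h ^ α)) = C * C₁ * (1 + R)⁻¹ := by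
      calc _ = C * C₁ * (1 + R)⁻¹ * (h ^ (-α) * h ^ α) := by ring
        _ = _ := by rw [hhα, mul_one]
    rw [mul_add, h7] at h4
    linarith
  have h8 := mul_le_mul_of_nonneg_left h6 (show 0 ≤ h ^ α / C by positivity)
  calc Real.exp (-1) / (2 * C) * (R ^ α)⁻¹ * r ^ α = h ^ α / C * (Real.exp (-1) / 2) := by
        rw [hhdef, Real.div_rpow hr.1.le hR0.le]
        field_simp
    _ ≤ _ := h8
    _ = (h ^ (-α) * h ^ α) * μ.real (Metric.closedBall x r) := by field_simp
    _ = _ := by rw [hhα, one_mul]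

end BallMeasure

/-! ### Schwartz multipliers. -/

section Cutoffs

open SchwartzMap

/-- A Schwartz function which equals `s⁻²` on `[a, 1]`. -/
theorem exists_schwartz_eq_inv_sq {a : ℝ} (ha0 : 0 < a) (ha1 : a < 1) :
    ∃ g : 𝓢(ℝ, ℂ), ∀ s ∈ Icc a 1, g s = ((s : ℂ) ^ 2)⁻¹ := by
  -- This bump is 1 on [a, 1] and 0 for s ≤ a/2, which removes the singularity of s⁻² at 0.
  let χ : ContDiffBump (1 : ℝ) := ⟨1 - a, 1 - a / 2, by linarith, by linarith⟩
  have hzero : ∀ s : ℝ, s ≤ a / 2 → χ s = 0 := by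
    intro s hs
    refine χ.zero_of_le_dist ?_
    rw [Real.dist_eq, abs_sub_comm]
    exact le_trans (show 1 - a / 2 ≤ 1 - s by linarith) (le_abs_self _)
  set f : ℝ → ℂ := fun s => ((χ s * (s ^ 2)⁻¹ : ℝ) : ℂ) with hf
  have hcs : HasCompactSupport f := by
    refine χ.hasCompactSupport.mono fun s hs => ?_
    rw [Function.mem_support] at hs ⊢
    intro h0
    exact hs (by simp [hf, h0])
  have hsm : ContDiff ℝ ∞ f := by
    refine Complex.ofRealCLM.contDiff.comp ?_
    rw [contDiff_iff_contDiffAt]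
    intro s
    rcases eq_or_ne s 0 with rfl | hs
    · refine (contDiffAt_const (c := (0 : ℝ))).congr_of_eventuallyEq ?_
      filter_upwards [Iio_mem_nhds (show (0 : ℝ) < a / 2 by positivity)] with s hs
      change χ s * (s ^ 2)⁻¹ = 0
      rw [hzero s (le_of_lt hs), zero_mul]
    · exact χ.contDiff.contDiffAt.mul ((contDiffAt_id.pow 2).inv (pow_ne_zero 2 hs))
  refine ⟨hcs.toSchwartzMap hsm, fun s hs => ?_⟩
  have hone : χ s = 1 := by
    refine χ.one_of_mem_closedBall ?_
    rw [Metric.mem_closedBall, Real.dist_eq, abs_sub_comm, abs_of_nonneg (by linarith [hs.2])]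
    exact (show 1 - s ≤ 1 - a by linarith [hs.1])
  rw [HasCompactSupport.toSchwartzMap_toFun, hf]
  simp [hone]

/-- A Schwartz cutoff function which equals `1` on `[b, 1]` and vanishes on `(-∞, a]`. -/
theorem exists_schwartz_cutoff {a b : ℝ} (hab : a < b) (hb : b < 1) :
    ∃ g : 𝓢(ℝ, ℂ), (∀ s ∈ Icc b 1, g s = 1) ∧ (∀ s ≤ a, g s = 0) ∧ ∀ s, ‖1 - g s‖ ≤ 1 := by
  let χ : ContDiffBump (1 : ℝ) := ⟨1 - b, 1 - a, by linarith, by linarith⟩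
  have hcs : HasCompactSupport fun s => (χ s : ℂ) :=
    χ.hasCompactSupport.comp_left Complex.ofReal_zero
  have hsm : ContDiff ℝ ∞ fun s => (χ s : ℂ) := Complex.ofRealCLM.contDiff.comp χ.contDiff
  refine ⟨hcs.toSchwartzMap hsm, fun s hs => ?_,
    fun s hs => ?_, fun s => ?_⟩
  · rw [HasCompactSupport.toSchwartzMap_toFun, χ.one_of_mem_closedBall, Complex.ofReal_one]
    rw [Metric.mem_closedBall, Real.dist_eq, abs_sub_comm, abs_of_nonneg (by linarith [hs.2])]
    exact (show 1 - s ≤ 1 - b by linarith [hs.1])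
  · rw [HasCompactSupport.toSchwartzMap_toFun, χ.zero_of_le_dist, Complex.ofReal_zero]
    rw [Real.dist_eq, abs_sub_comm]
    exact le_trans (show 1 - a ≤ 1 - s by linarith) (le_abs_self _)
  · rw [HasCompactSupport.toSchwartzMap_toFun, ← Complex.ofReal_one, ← Complex.ofReal_sub,
      Complex.norm_real, Real.norm_of_nonneg (sub_nonneg.2 χ.le_one)]
    linarith [χ.nonneg (x := s)]

end Cutoffs

/-! ### Reproducing formula and localized diffusion polynomials. -/

section Polynomials

open SchwartzMap

variable {n : ℕ} {M : Type*} [MetricSpace M] [ChartedSpace (EuclideanSpace ℝ (Fin n)) M]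
  [RiemannianBundle (fun x : M => TangentSpace (𝓡 n) x)] [MeasurableSpace M]

/-- The average of `v` at scale `h` around `x`, with polynomially decaying weights. -/
noncomputable def decayAverage (μ : Measure M) (α h : ℝ) (m : ℕ) (v : M → ℝ) (x : M) : ℝ :=
  ∫ y, h ^ (-α) * decayWeight h m x y * v y ∂μ

theorem SchwartzMap.exists_bound_Icc (g : 𝓢(ℝ, ℂ)) : ∃ b : ℝ, ∀ s ∈ Icc (0 : ℝ) 1, ‖g s‖ ≤ b :=
  isCompact_Icc.exists_bound_of_continuousOn g.continuous.continuousOn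

theorem norm_integral_mul_le_decayAverage [BorelSpace M] [CompactSpace M] {μ : Measure M}
    [IsFiniteMeasure μ] {α h C : ℝ} (hh : 0 < h) {m : ℕ} {k f : M → ℂ} {x : M}
    (hf : Continuous f) (hk : ∀ y, ‖k y‖ ≤ C * h ^ (-α) * decayWeight h m x y) :
    ‖∫ y, k y * f y ∂μ‖ ≤ C * decayAverage μ α h m (fun y => ‖f y‖) x := by
  have hc : Continuous fun y => decayWeight h m x y :=
    (continuous_decayWeight hh m).comp (Continuous.prodMk_right x)
  have hint : Integrable (fun y => C * (h ^ (-α) * decayWeight h m x y * ‖f y‖)) μ :=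
    (continuous_const.mul ((continuous_const.mul hc).mul hf.norm)).integrable_of_hasCompactSupport
      (HasCompactSupport.of_compactSpace _)
  rw [decayAverage, ← integral_const_mul]
  refine norm_integral_le_of_norm_le hint (Eventually.of_forall fun y => ?_)
  rw [norm_mul]
  refine (mul_le_mul_of_nonneg_right (hk y) (norm_nonneg _)).trans_eq ?_
  ring

theorem IsDiffusionSystem.continuous_of_mem {μ : Measure M} {α κ₂ κ₃ κ₄ : ℝ} {φ : ℕ → M → ℂ}
    {ℓ : ℕ → ℝ} (hS : IsDiffusionSystem (n := n) μ α κ₂ κ₃ κ₄ φ ℓ) {L : ℝ} {P : M → ℂ}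
    (hP : P ∈ diffusionPolynomials φ ℓ L) : Continuous P := by
  refine Submodule.span_induction (p := fun P _ => Continuous P) ?_ continuous_const
    (fun _ _ _ _ h1 h2 => h1.add h2) (fun a _ _ h => h.const_smul a) hP
  rintro _ ⟨j, -, rfl⟩
  exact hS.continuous j

/-- Constants serve as test functions for small `L`, where localized polynomials would require a
scale above 1. -/
theorem IsDiffusionSystem.const_mem {μ : Measure M} {α κ₂ κ₃ κ₄ : ℝ} {φ : ℕ → M → ℂ}
    {ℓ : ℕ → ℝ} (hS : IsDiffusionSystem (n := n) μ α κ₂ κ₃ κ₄ φ ℓ) {L : ℝ} (hL : 1 ≤ L) :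
    (fun _ => 1) ∈ diffusionPolynomials φ ℓ L := by
  have h0 : φ 0 = fun _ => 1 := funext hS.phi_zero
  exact h0 ▸ Submodule.subset_span ⟨0, hS.ell_zero_le_one.trans hL, rfl⟩

/-- If `s g(s)` inverts `s` on `[exp(-1), 1]`, then the heat operator composed with the operator
with kernel `spectralKernel φ ℓ h g` is the identity on diffusion polynomials. -/
theorem IsDiffusionSystem.heatKernel_representation [BorelSpace M] [CompactSpace M]
    {μ : Measure M} [IsFiniteMeasure μ] {α κ₂ κ₃ κ₄ : ℝ} {φ : ℕ → M → ℂ} {ℓ : ℕ → ℝ}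
    (hS : IsDiffusionSystem (n := n) μ α κ₂ κ₃ κ₄ φ ℓ) {g : 𝓢(ℝ, ℂ)}
    (hg : ∀ s ∈ Icc (Real.exp (-1)) 1, g s = ((s : ℂ) ^ 2)⁻¹) {h L : ℝ} (hh : h ∈ Ioc (0 : ℝ) 1)
    (hL : L * h ≤ 1) {P : M → ℂ} (hP : P ∈ diffusionPolynomials φ ℓ L) :
    (Continuous fun x => ∫ y, spectralKernel φ ℓ h g x y * P y ∂μ) ∧
      ∀ x, ∫ y, heatKernel φ ℓ (h ^ 2) x y * ∫ z, spectralKernel φ ℓ h g y z * P z ∂μ ∂μ =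
        P x := by
  obtain ⟨b, hb⟩ := SchwartzMap.exists_bound_Icc g
  have hone : ∀ s ∈ Icc (0 : ℝ) 1, ‖(fun _ : ℝ => (1 : ℂ)) s‖ ≤ 1 := fun _ _ => by simp
  have hiG : ∀ {f : M → ℂ}, Continuous f → ∀ x,
      Integrable (fun y => spectralKernel φ ℓ h g x y * f y) μ := fun hf x =>
    hS.integrable_spectralKernel_mul hh hb hf x
  have hiK : ∀ {f : M → ℂ}, Continuous f → ∀ x,
      Integrable (fun y => heatKernel φ ℓ (h ^ 2) x y * f y) μ := fun hf x => by
    have := hS.integrable_spectralKernel_mul hh hone hf x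
    simpa only [spectralKernel_one] using this
  -- Continuity is carried through the induction because splitting the integrals of a sum needs
  -- integrability.
  have hmain : Continuous P ∧ (Continuous fun x => ∫ y, spectralKernel φ ℓ h g x y * P y ∂μ) ∧
      ∀ x, ∫ y, heatKernel φ ℓ (h ^ 2) x y * ∫ z, spectralKernel φ ℓ h g y z * P z ∂μ ∂μ =
        P x := by
    refine Submodule.span_induction (p := fun P _ => Continuous P ∧
      (Continuous fun x => ∫ y, spectralKernel φ ℓ h g x y * P y ∂μ) ∧
      ∀ x, ∫ y, heatKernel φ ℓ (h ^ 2) x y * ∫ z, spectralKernel φ ℓ h g y z * P z ∂μ ∂μ = P x)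
      ?_ ?_ ?_ ?_ hP
    · rintro _ ⟨j, hj, rfl⟩
      have hnode : Real.exp (-1) ≤ heatNode ℓ h j := hS.exp_neg_one_le_heatNode hh.1.le hL hj
      have hne : (heatNode ℓ h j : ℂ) ≠ 0 := Complex.ofReal_ne_zero.2 (heatNode_pos ℓ h j).ne'
      have hGj : ∀ x, ∫ y, spectralKernel φ ℓ h g x y * φ j y ∂μ =
          (heatNode ℓ h j : ℂ)⁻¹ * φ j x := by
        intro x
        rw [hS.integral_spectralKernel_mul hh hb, hg _ ⟨hnode, (heatNode_mem_Icc ℓ h j).2⟩]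
        field_simp
      refine ⟨hS.continuous j, ?_, fun x => ?_⟩
      · simp only [hGj]
        exact continuous_const.mul (hS.continuous j)
      · have h1 := hS.integral_spectralKernel_mul hh hone x j
        simp only [spectralKernel_one, mul_one] at h1
        simp only [hGj, mul_left_comm _ (heatNode ℓ h j : ℂ)⁻¹]
        rw [integral_const_mul, h1, inv_mul_cancel_left₀ hne]
    · refine ⟨continuous_const, ?_, fun x => ?_⟩
      · simpa using continuous_const
      · simp
    · rintro P Q - - ⟨hP1, hP2, hP3⟩ ⟨hQ1, hQ2, hQ3⟩
      have hadd : ∀ x, ∫ y, spectralKernel φ ℓ h g x y * (P + Q) y ∂μ =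
          (∫ y, spectralKernel φ ℓ h g x y * P y ∂μ) +
            ∫ y, spectralKernel φ ℓ h g x y * Q y ∂μ := by
        intro x
        simp only [Pi.add_apply, mul_add]
        exact integral_add (hiG hP1 x) (hiG hQ1 x)
      refine ⟨hP1.add hQ1, ?_, fun x => ?_⟩
      · simp only [hadd]
        exact hP2.add hQ2
      · simp only [hadd, mul_add]
        rw [integral_add (hiK hP2 x) (hiK hQ2 x), hP3, hQ3, Pi.add_apply]
    · rintro a P - ⟨hP1, hP2, hP3⟩
      have hsmul : ∀ x, ∫ y, spectralKernel φ ℓ h g x y * (a • P) y ∂μ =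
          a * ∫ y, spectralKernel φ ℓ h g x y * P y ∂μ := by
        intro x
        simp only [Pi.smul_apply, smul_eq_mul, mul_left_comm _ a]
        exact integral_const_mul _ _
      refine ⟨hP1.const_smul a, ?_, fun x => ?_⟩
      · simp only [hsmul]
        exact continuous_const.mul hP2
      · simp only [hsmul, mul_left_comm _ a]
        rw [integral_const_mul, hP3, Pi.smul_apply, smul_eq_mul]
  exact hmain.2

/-- A diffusion polynomial of degree `1 / h` and its oscillations at scale `h` are controlled by
averages of a continuous function, which is itself controlled by averages of the polynomial. -/
theorem exists_decayAverage_bounds [BorelSpace M] [CompactSpace M]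
    [IsRiemannianManifold (𝓡 n) M] (μ : Measure M) [IsFiniteMeasure μ]
    {α κ₂ κ₃ : ℝ} (κ₄ : ℝ) (hα : 0 < α) (hκ₂ : 0 < κ₂) (hκ₃ : 0 < κ₃) (m : ℕ) :
    ∃ C : ℝ, 0 < C ∧ ∀ (φ : ℕ → M → ℂ) (ℓ : ℕ → ℝ),
      IsDiffusionSystem (n := n) μ α κ₂ κ₃ κ₄ φ ℓ → ∀ h ∈ Ioc (0 : ℝ) 1, ∀ L : ℝ, L * h ≤ 1 →
        ∀ P ∈ diffusionPolynomials φ ℓ L, ∃ v : M → ℝ, Continuous v ∧ (∀ x, 0 ≤ v x) ∧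
          (∀ x, v x ≤ C * decayAverage μ α h m (fun y => ‖P y‖) x) ∧
          (∀ x, ‖P x‖ ≤ C * decayAverage μ α h m v x) ∧
          ∀ x y, dist x y ≤ h → ‖P y - P x‖ ≤ C * (dist x y / h) * decayAverage μ α h m v x := by
  obtain ⟨g, hg⟩ := exists_schwartz_eq_inv_sq (Real.exp_pos (-1))
    (Real.exp_lt_one_iff.2 (show (-1 : ℝ) < 0 by norm_num))
  obtain ⟨C₁, hC₁, hspec⟩ := exists_norm_spectralKernel_le (n := n) μ κ₄ hα hκ₂ hκ₃ g m
  obtain ⟨C₂, hC₂, hheat⟩ := exists_norm_heatKernel_le (n := n) μ α κ₄ hκ₂ hκ₃ m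
  obtain ⟨C₃, hC₃, hgrad⟩ := exists_norm_heatKernel_sub_le (n := n) μ α κ₄ hκ₂ hκ₃ m
  refine ⟨C₁ + C₂ + C₃, by positivity, fun φ ℓ hS h hh L hL P hP => ?_⟩
  have hh0 := hh.1
  have hPc := hS.continuous_of_mem hP
  obtain ⟨hQc, hrep⟩ := hS.heatKernel_representation hg hh hL hP
  set Q : M → ℂ := fun x => ∫ y, spectralKernel φ ℓ h g x y * P y ∂μ with hQ
  have havg : ∀ (f : M → ℂ) x, 0 ≤ decayAverage μ α h m (fun y => ‖f y‖) x := fun f x =>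
    integral_nonneg fun y => by
      have := decayWeight_pos hh0 m x y
      positivity
  refine ⟨fun x => ‖Q x‖, hQc.norm, fun x => norm_nonneg _, fun x => ?_, fun x => ?_,
    fun x y hxy => ?_⟩
  · refine (norm_integral_mul_le_decayAverage hh0 hPc (hspec φ ℓ hS h hh x)).trans ?_
    exact mul_le_mul_of_nonneg_right (by linarith) (havg P x)
  · rw [← hrep x]
    refine (norm_integral_mul_le_decayAverage hh0 hQc (hheat φ ℓ hS h hh x)).trans ?_
    exact mul_le_mul_of_nonneg_right (by linarith) (havg Q x)
  · have hiK : ∀ x, Integrable (fun y => heatKernel φ ℓ (h ^ 2) x y * Q y) μ := fun x => by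
      have := hS.integrable_spectralKernel_mul hh (g := fun _ => 1) (b := 1)
        (fun _ _ => by simp) hQc x
      simpa only [spectralKernel_one] using this
    rw [← hrep x, ← hrep y, ← integral_sub (hiK y) (hiK x)]
    simp only [← sub_mul]
    refine (norm_integral_mul_le_decayAverage hh0 hQc
      (fun z => hgrad φ ℓ hS h hh x y z hxy)).trans ?_
    refine mul_le_mul_of_nonneg_right ?_ (havg Q x)
    exact mul_le_mul_of_nonneg_right (by linarith) (by positivity)

/-- Localized diffusion polynomials: they decay polynomially of order `S` at scale `h`, and are
bounded below on balls of radius comparable to `h`. -/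
theorem exists_localized_polynomials [BorelSpace M] [CompactSpace M]
    [IsRiemannianManifold (𝓡 n) M] (μ : Measure M)
    {α κ₂ κ₃ κ₄ : ℝ} (hα : 0 < α) (hκ₂ : 0 < κ₂) (hκ₃ : 0 < κ₃) (hκ₄ : 0 < κ₄) (S : ℕ) :
    ∃ N C c ε : ℝ, 1 ≤ N ∧ 0 < C ∧ 0 < c ∧ 0 < ε ∧ ε ≤ 1 ∧ ∀ (φ : ℕ → M → ℂ) (ℓ : ℕ → ℝ),
      IsDiffusionSystem (n := n) μ α κ₂ κ₃ κ₄ φ ℓ → ∀ h ∈ Ioc (0 : ℝ) 1, ∃ Φ : M → M → ℂ,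
        Measurable (Function.uncurry Φ) ∧
        (∀ L y, N ≤ L * h → Φ y ∈ diffusionPolynomials φ ℓ L) ∧
        (∀ y z, ‖Φ y z‖ ≤ C * h ^ (-α) * decayWeight h S y z) ∧
        ∀ y z, dist y z ≤ ε * h → c * h ^ (-α) ≤ ‖Φ y z‖ := by
  -- `N` is chosen so that truncating the kernel costs at most a quarter of the on-diagonal lower
  -- bound.
  obtain ⟨N, hN1, hN⟩ : ∃ N : ℝ, 1 ≤ N ∧
      κ₂ * 2 ^ (α / 2) * Real.exp (-(N ^ 2 / 4)) ≤ κ₄ / 4 := by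
    have hlim : Tendsto (fun N : ℝ => κ₂ * 2 ^ (α / 2) * Real.exp (-(N ^ 2 / 4))) atTop (𝓝 0) := by
      have h1 : Tendsto (fun N : ℝ => N ^ 2 / 4) atTop atTop :=
        (tendsto_pow_atTop two_ne_zero).atTop_div_const (by norm_num)
      simpa using (Real.tendsto_exp_neg_atTop_nhds_zero.comp h1).const_mul (κ₂ * 2 ^ (α / 2))
    exact ((eventually_ge_atTop 1).and
      (hlim.eventually (eventually_le_nhds (show 0 < κ₄ / 4 by positivity)))).exists
  have hab : Real.exp (-N ^ 2) < Real.exp (-(N ^ 2 / 2)) := Real.exp_lt_exp.2 (by nlinarith)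
  -- The cutoff kills the frequencies with ℓ_k h ≥ N, so the kernel becomes a polynomial of degree
  -- N/h, and leaves those with (ℓ_k h)² ≤ N²/2 untouched.
  obtain ⟨g, hg1, hg0, hgle⟩ := exists_schwartz_cutoff hab (Real.exp_lt_one_iff.2 (by nlinarith))
  obtain ⟨C, hC, hspec⟩ := exists_norm_spectralKernel_le (n := n) μ κ₄ hα hκ₂ hκ₃ g S
  obtain ⟨C₃, hC₃, hgrad⟩ := exists_norm_heatKernel_sub_le (n := n) μ α κ₄ hκ₂ hκ₃ 0
  set ε : ℝ := min 1 (κ₄ / (4 * C₃)) with hε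
  refine ⟨N, C, κ₄ / 2, ε, hN1, hC, by positivity, lt_min one_pos (by positivity),
    min_le_left _ _, fun φ ℓ hS h hh => ?_⟩
  have hh0 := hh.1
  obtain ⟨b, hb⟩ := SchwartzMap.exists_bound_Icc g
  have hmeas : Measurable (Function.uncurry (spectralKernel φ ℓ h g)) :=
    hS.measurable_spectralKernel hh hb
  have hmeas' : Measurable (Function.uncurry fun y z => spectralKernel φ ℓ h g z y) := by
    have h1 : Measurable (Function.uncurry (spectralKernel φ ℓ h g) ∘ Prod.swap) :=
      Measurable.comp hmeas measurable_swap
    have h2 : (Function.uncurry fun y z => spectralKernel φ ℓ h g z y) =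
        Function.uncurry (spectralKernel φ ℓ h g) ∘ Prod.swap := by
      ext ⟨y, z⟩
      rfl
    rwa [h2]
  -- The arguments are exchanged because the kernel is a combination of the φ_k in its first
  -- variable and of their conjugates in the second.
  refine ⟨fun y z => spectralKernel φ ℓ h g z y, hmeas', fun L y hNL => ?_, fun y z => ?_,
    fun y z hyz => ?_⟩
  · have hvan : ∀ k, L < ℓ k → g (heatNode ℓ h k) = 0 := by
      intro k hk
      refine hg0 _ (Real.exp_le_exp.2 ?_)
      have h1 : N ≤ ℓ k * h := hNL.trans (mul_le_mul_of_nonneg_right hk.le hh0.le)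
      have h2 : N ^ 2 ≤ (ℓ k * h) ^ 2 := pow_le_pow_left₀ (by linarith) h1 2
      rw [mul_pow] at h2
      linarith
    obtain ⟨K, hK⟩ := eventually_atTop.1 (hS.tendsto.eventually_gt_atTop L)
    have hfin : (fun z => spectralKernel φ ℓ h g z y) = ∑ k ∈ Finset.range K,
        ((heatNode ℓ h k : ℂ) * conj (φ k y) * g (heatNode ℓ h k)) • φ k := by
      ext z
      rw [spectralKernel, tsum_eq_sum (s := Finset.range K), Finset.sum_apply]
      · refine Finset.sum_congr rfl fun k _ => ?_
        rw [Pi.smul_apply, smul_eq_mul]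
        ring
      · intro k hk
        rw [hvan k (hK k (by simpa using hk)), mul_zero]
    change (fun z => spectralKernel φ ℓ h g z y) ∈ _
    rw [hfin]
    refine Submodule.sum_mem _ fun k _ => ?_
    rcases le_or_gt (ℓ k) L with hk | hk
    · exact Submodule.smul_mem _ _ (Submodule.subset_span ⟨k, hk, rfl⟩)
    · rw [hvan k hk, mul_zero, zero_smul]
      exact Submodule.zero_mem _
  · rw [decayWeight_comm]
    exact hspec φ ℓ hS h hh z y
  · have hhα : 0 < h ^ (-α) := by positivity
    have hdiag : κ₄ * h ^ (-α) ≤ ‖heatKernel φ ℓ (h ^ 2) y y‖ := by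
      have h1 := hS.diagonal y (h ^ 2) (sq_mem_Ioc hh)
      rw [rpow_sq_neg_div_two hh0] at h1
      exact h1.trans (Complex.re_le_norm _)
    have hosc : ‖heatKernel φ ℓ (h ^ 2) z y - heatKernel φ ℓ (h ^ 2) y y‖ ≤
        κ₄ / 4 * h ^ (-α) := by
      have hle : dist y z ≤ h := hyz.trans (mul_le_of_le_one_left hh0.le (min_le_left _ _))
      have h1 := hgrad φ ℓ hS h hh y z y hle
      rw [decayWeight, pow_zero, inv_one, mul_one] at h1
      refine h1.trans (mul_le_mul_of_nonneg_right ?_ hhα.le)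
      have h2 : dist y z / h ≤ κ₄ / (4 * C₃) :=
        ((div_le_iff₀ hh0).2 hyz).trans (min_le_right _ _)
      calc C₃ * (dist y z / h) ≤ C₃ * (κ₄ / (4 * C₃)) := mul_le_mul_of_nonneg_left h2 hC₃.le
        _ = κ₄ / 4 := by field_simp
    have htrunc : ‖heatKernel φ ℓ (h ^ 2) z y - spectralKernel φ ℓ h g z y‖ ≤
        κ₄ / 4 * h ^ (-α) := by
      -- Each node at scale `h` is the square of the node at scale h/√2. On the truncated range one
      -- factor is at most exp(-N²/4) and the other keeps the series convergent.
      set h' := h / Real.sqrt 2 with hh'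
      have hs2 : 1 ≤ Real.sqrt 2 := Real.one_le_sqrt.2 one_le_two
      have hh'mem : h' ∈ Ioc (0 : ℝ) 1 :=
        ⟨by positivity, (div_le_self hh0.le hs2).trans hh.2⟩
      have hnode : ∀ k, heatNode ℓ h k = heatNode ℓ h' k * heatNode ℓ h' k := by
        intro k
        rw [heatNode, heatNode, ← Real.exp_add, hh', div_pow, Real.sq_sqrt zero_le_two]
        congr 1
        ring
      have hone : ∀ s ∈ Icc (0 : ℝ) 1, ‖(fun _ : ℝ => (1 : ℂ)) s‖ ≤ 1 := fun _ _ => by simp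
      have hterm : ∀ k, ‖(heatNode ℓ h k : ℂ) * φ k z * conj (φ k y) * 1 -
          (heatNode ℓ h k : ℂ) * φ k z * conj (φ k y) * g (heatNode ℓ h k)‖ ≤
          Real.exp (-(N ^ 2 / 4)) * ‖(heatNode ℓ h' k : ℂ) * φ k z * conj (φ k y)‖ := by
        intro k
        rw [← mul_sub, norm_mul]
        rcases le_or_gt (Real.exp (-(N ^ 2 / 2))) (heatNode ℓ h k) with hk | hk
        · rw [hg1 _ ⟨hk, (heatNode_mem_Icc ℓ h k).2⟩, sub_self, norm_zero, mul_zero]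
          positivity
        · refine (mul_le_of_le_one_right (norm_nonneg _) (hgle _)).trans ?_
          have h1 : heatNode ℓ h' k ≤ Real.exp (-(N ^ 2 / 4)) := by
            refine le_of_sq_le_sq ?_ (Real.exp_pos _).le
            rw [sq, ← hnode, ← Real.exp_nat_mul]
            refine hk.le.trans_eq ?_
            congr 1
            push_cast
            ring
          rw [hnode, Complex.ofReal_mul, mul_assoc (_ * _ : ℂ), mul_assoc (heatNode ℓ h' k : ℂ),
            norm_mul, mul_assoc (heatNode ℓ h' k : ℂ), Complex.norm_real,
            Real.norm_of_nonneg (heatNode_pos ℓ h' k).le]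
          exact mul_le_mul_of_nonneg_right h1 (norm_nonneg _)
      have hsum := (hS.summable_norm_weight hh'mem z y).hasSum.mul_left (Real.exp (-(N ^ 2 / 4)))
      rw [← spectralKernel_one, spectralKernel, spectralKernel,
        ← (hS.summable_spectralKernel hh hone z y).tsum_sub (hS.summable_spectralKernel hh hb z y)]
      refine (tsum_of_norm_bounded hsum hterm).trans ?_
      have h2 : h' ^ (-α) = 2 ^ (α / 2) * h ^ (-α) := by
        rw [hh', Real.div_rpow hh0.le (by positivity), Real.sqrt_eq_rpow,
          ← Real.rpow_mul zero_le_two, div_eq_mul_inv, ← Real.rpow_neg zero_le_two, mul_comm]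
        congr 2
        ring
      calc _ ≤ Real.exp (-(N ^ 2 / 4)) * (κ₂ * h' ^ (-α)) :=
            mul_le_mul_of_nonneg_left (hS.tsum_norm_weight_le hh'mem z y) (Real.exp_pos _).le
        _ = κ₂ * 2 ^ (α / 2) * Real.exp (-(N ^ 2 / 4)) * h ^ (-α) := by rw [h2]; ring
        _ ≤ _ := mul_le_mul_of_nonneg_right hN hhα.le
    -- Oscillation and truncation each cost κ₄/4 of the diagonal value κ₄, leaving κ₄/2.
    have h3 := norm_sub_norm_le (heatKernel φ ℓ (h ^ 2) y y) (heatKernel φ ℓ (h ^ 2) z y)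
    have h4 := norm_sub_norm_le (heatKernel φ ℓ (h ^ 2) z y) (spectralKernel φ ℓ h g z y)
    rw [norm_sub_rev] at h3
    change _ ≤ ‖spectralKernel φ ℓ h g z y‖
    linarith

end Polynomials

/-! ### The direct inequalities. -/

section MarcinkiewiczZygmund

theorem mul_measureReal_le_integral {X : Type*} [MeasurableSpace X] {τ : Measure X}
    [IsFiniteMeasure τ] {f : X → ℝ} (hf : Integrable f τ) (hf0 : ∀ x, 0 ≤ f x) {s : Set X}
    (hs : MeasurableSet s) {a : ℝ} (ha : ∀ x ∈ s, a ≤ f x) : a * τ.real s ≤ ∫ x, f x ∂τ := by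
  calc a * τ.real s = ∫ x, s.indicator (fun _ => a) x ∂τ := by
        rw [integral_indicator_const _ hs, smul_eq_mul, mul_comm]
    _ ≤ ∫ x, f x ∂τ := by
        refine integral_mono ((integrable_const a).indicator hs) hf fun x => ?_
        by_cases hx : x ∈ s
        · simpa [hx] using ha x hx
        · simpa [hx] using hf0 x

theorem decayAverage_nonneg {M : Type*} [MetricSpace M] [MeasurableSpace M] {μ : Measure M}
    {α h : ℝ} {m : ℕ} (hh : 0 < h) {v : M → ℝ} (hv0 : ∀ x, 0 ≤ v x) (x : M) :
    0 ≤ decayAverage μ α h m v x :=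
  integral_nonneg fun y => by
    have := decayWeight_pos hh m x y
    have := hv0 y
    positivity

section Weights

variable {M : Type*} [MetricSpace M] [MeasurableSpace M] [BorelSpace M] [CompactSpace M]
  {μ τ : Measure M} [IsFiniteMeasure μ] [IsFiniteMeasure τ] {α h : ℝ} {m : ℕ}

theorem integrable_decayWeight (hh : 0 < h) (m : ℕ) (x : M) :
    Integrable (fun y => decayWeight h m x y) τ :=
  ((continuous_decayWeight hh m).comp (Continuous.prodMk_right x)).integrable_of_hasCompactSupport
    (HasCompactSupport.of_compactSpace _)

theorem continuous_decayAverage (hh : 0 < h) {v : M → ℝ} (hv : Continuous v) :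
    Continuous (decayAverage μ α h m v) := by
  obtain ⟨V, hV⟩ := isCompact_univ.exists_bound_of_continuousOn hv.continuousOn
  have hc : Continuous fun q : M × M => h ^ (-α) * decayWeight h m q.1 q.2 * v q.2 :=
    (continuous_const.mul (continuous_decayWeight hh m)).mul (hv.comp continuous_snd)
  refine continuous_of_dominated (bound := fun _ => h ^ (-α) * 1 * V)
    (fun x => (hc.comp (Continuous.prodMk_right x)).aestronglyMeasurable)
    (fun x => Eventually.of_forall fun y => ?_) (integrable_const _)
    (Eventually.of_forall fun y => hc.comp (Continuous.prodMk_left y))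
  have hd := decayWeight_pos hh m x y
  have hp : 0 < h ^ (-α) := by positivity
  rw [norm_mul, Real.norm_of_nonneg (by positivity)]
  exact mul_le_mul (mul_le_mul_of_nonneg_left (decayWeight_le_one hh m x y) hp.le)
    (hV y (mem_univ y)) (norm_nonneg _) (by positivity)

/-- Averages at scale `h` are bounded from `L^p(μ)` to `L^p(τ)`. -/
theorem integral_decayAverage_rpow_le {p A B : ℝ} (hp : 1 ≤ p) (hh : 0 < h)
    (hA : ∀ x, ∫ y, decayWeight h m x y ∂μ ≤ A * h ^ α)
    (hB : ∀ x, ∫ y, decayWeight h m x y ∂τ ≤ B * h ^ α) {v : M → ℝ} (hv : Continuous v)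
    (hv0 : ∀ x, 0 ≤ v x) :
    ∫ x, decayAverage μ α h m v x ^ p ∂τ ≤ A ^ (p - 1) * B * ∫ y, v y ^ p ∂μ := by
  obtain ⟨V, hV⟩ := isCompact_univ.exists_bound_of_continuousOn hv.continuousOn
  have hpos : 0 < h ^ (-α) := by positivity
  have hhα : h ^ (-α) * h ^ α = 1 := by
    rw [← Real.rpow_add hh, neg_add_cancel, Real.rpow_zero]
  have hscale : ∀ {I c : ℝ}, I ≤ c * h ^ α → h ^ (-α) * I ≤ c := by
    intro I c hI
    calc h ^ (-α) * I ≤ h ^ (-α) * (c * h ^ α) := mul_le_mul_of_nonneg_left hI hpos.le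
      _ = c * (h ^ (-α) * h ^ α) := by ring
      _ = c := by rw [hhα, mul_one]
  refine integral_rpow_integral_mul_le (k := fun x y => h ^ (-α) * decayWeight h m x y)
    (K := h ^ (-α) * 1) (V := V) hp
    (continuous_const.mul (continuous_decayWeight hh m)).measurable
    (fun x y => mul_nonneg hpos.le (decayWeight_pos hh m x y).le)
    (fun x y => mul_le_mul_of_nonneg_left (decayWeight_le_one hh m x y) hpos.le)
    hv.measurable hv0 (fun x => (le_abs_self _).trans (hV x (mem_univ x)))
    (fun x => ?_) fun y => ?_
  · rw [integral_const_mul]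
    exact hscale (hA x)
  · simp only [decayWeight_comm h m _ y]
    rw [integral_const_mul]
    exact hscale (hB y)

/-- A function which is at most `C` times the averages of `g` is bounded in `L^p(τ)` by `g` in
`L^p(μ)`. -/
theorem integral_rpow_le_of_le_decayAverage {p A B C : ℝ} (hp : 1 ≤ p) (hh : 0 < h)
    (hA : ∀ x, ∫ y, decayWeight h m x y ∂μ ≤ A * h ^ α)
    (hB : ∀ x, ∫ y, decayWeight h m x y ∂τ ≤ B * h ^ α) (hC : 0 ≤ C) {f g : M → ℝ}
    (hg : Continuous g) (hf0 : ∀ x, 0 ≤ f x) (hg0 : ∀ x, 0 ≤ g x)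
    (hfg : ∀ x, f x ≤ C * decayAverage μ α h m g x) :
    ∫ x, f x ^ p ∂τ ≤ C ^ p * (A ^ (p - 1) * B * ∫ y, g y ^ p ∂μ) := by
  have hp0 : 0 ≤ p := by linarith
  have hcont : Continuous fun x => C ^ p * decayAverage μ α h m g x ^ p :=
    continuous_const.mul ((continuous_decayAverage hh hg).rpow_const fun _ => Or.inr hp0)
  have hpt : ∀ x, f x ^ p ≤ C ^ p * decayAverage μ α h m g x ^ p := fun x => by
    rw [← Real.mul_rpow hC (decayAverage_nonneg hh hg0 x)]
    exact Real.rpow_le_rpow (hf0 x) (hfg x) hp0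
  refine (integral_mono_of_nonneg (Eventually.of_forall fun x => Real.rpow_nonneg (hf0 x) p)
    (hcont.integrable_of_hasCompactSupport (HasCompactSupport.of_compactSpace _))
    (Eventually.of_forall hpt)).trans ?_
  rw [integral_const_mul]
  exact mul_le_mul_of_nonneg_left (integral_decayAverage_rpow_le hp hh hA hB hg hg0)
    (Real.rpow_nonneg hC p)

/-- The weights have integrals of order `h^α` with respect to measures which are regular at a
smaller scale `r`. -/
theorem integral_decayWeight_le_of_regular {r A b c : ℝ} (hr : 0 < r) (hrh : r ≤ h)
    (hA : ∀ x, ∫ y, decayWeight h m x y ∂μ ≤ A * h ^ α) (hc0 : 0 < c)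
    (hc : ∀ z, c * r ^ α ≤ μ.real (Metric.closedBall z r)) (hb0 : 0 ≤ b)
    (hb : ∀ z, τ.real (Metric.closedBall z r) ≤ b * r ^ α) (x : M) :
    ∫ y, decayWeight h m x y ∂τ ≤ (2 ^ m * b / c * A) * h ^ α := by
  have hh : 0 < h := hr.trans_le hrh
  have hrα : 0 < r ^ α := by positivity
  -- As r ≤ h, the weight changes by at most 2^m on balls of radius `r`, so `τ` can be compared with
  -- `μ` ball by ball.
  have h1 := mul_integral_le_of_measureReal_closedBall (μ := μ) (τ := τ)
    (f := fun y => decayWeight h m x y) (F := 1) (a := 2 ^ m)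
    ((continuous_decayWeight hh m).comp (Continuous.prodMk_right x)).measurable
    (fun y => (decayWeight_pos hh m x y).le) (fun y => decayWeight_le_one hh m x y)
    (by positivity) (fun y z hyz => ?_) hc hb
  · have h2 : c * ∫ y, decayWeight h m x y ∂τ ≤ 2 ^ m * b * ∫ y, decayWeight h m x y ∂μ := by
      rw [← mul_le_mul_iff_right₀ hrα]
      refine le_trans (le_of_eq ?_) (h1.trans_eq ?_) <;> ring
    rw [← mul_le_mul_iff_right₀ hc0]
    refine (h2.trans (mul_le_mul_of_nonneg_left (hA x) (by positivity))).trans_eq ?_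
    field_simp
  · have := decayWeight_le_mul_decayWeight hh m zero_le_one (x := x) (y := y) (z := z)
      (by linarith)
    rwa [one_add_one_eq_two] at this

end Weights

variable {n : ℕ} {M : Type*} [MetricSpace M] [ChartedSpace (EuclideanSpace ℝ (Fin n)) M]
  [RiemannianBundle (fun x : M => TangentSpace (𝓡 n) x)] [IsRiemannianManifold (𝓡 n) M]
  [MeasurableSpace M] [BorelSpace M] [CompactSpace M]

/-- Regular measures satisfy the upper Marcinkiewicz–Zygmund inequality. -/
theorem exists_integral_rpow_le_of_regular (μ : Measure M) [IsFiniteMeasure μ]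
    {α κ₁ κ₂ κ₃ : ℝ} (κ₄ : ℝ) (hα : 0 < α) (hκ₁ : 0 < κ₁) (hκ₂ : 0 < κ₂) (hκ₃ : 0 < κ₃)
    (hball : ∀ (x : M) (r : ℝ), 0 < r → μ.real (Metric.closedBall x r) ≤ κ₁ * r ^ α)
    {p : ℝ} (hp : 1 ≤ p) :
    ∃ C : ℝ, 0 < C ∧ ∀ (φ : ℕ → M → ℂ) (ℓ : ℕ → ℝ),
      IsDiffusionSystem (n := n) μ α κ₂ κ₃ κ₄ φ ℓ → ∀ h ∈ Ioc (0 : ℝ) 1, ∀ L : ℝ, L * h ≤ 1 →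
        ∀ (τ : Measure M) [IsFiniteMeasure τ] (b : ℝ), 0 ≤ b →
        (∀ z, τ.real (Metric.closedBall z h) ≤ b * h ^ α) →
        ∀ P ∈ diffusionPolynomials φ ℓ L, ∫ x, ‖P x‖ ^ p ∂τ ≤ C * b * ∫ x, ‖P x‖ ^ p ∂μ := by
  have hp0 : 0 ≤ p := by linarith
  obtain ⟨m, hm⟩ := exists_nat_gt α
  obtain ⟨A, hA0, hA⟩ := exists_integral_decayWeight_le μ hκ₁ hball hm
  obtain ⟨c, hc0, hc⟩ := exists_le_measureReal_closedBall (n := n) μ κ₄ hκ₁ hκ₂ hκ₃ hball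
  obtain ⟨C, hC0, hC⟩ := exists_decayAverage_bounds (n := n) μ κ₄ hα hκ₂ hκ₃ m
  refine ⟨C ^ p * (A ^ (p - 1) * (2 ^ m / c * A)) * (C ^ p * (A ^ (p - 1) * A)), by positivity,
    fun φ ℓ hS h hh L hL τ _ b hb0 hb P hP => ?_⟩
  have hh0 := hh.1
  obtain ⟨v, hvc, hv0, hvP, hPv, -⟩ := hC φ ℓ hS h hh L hL P hP
  have hPc := (hS.continuous_of_mem hP).norm
  have hAh := hA h hh0
  have hB := integral_decayWeight_le_of_regular (τ := τ) (m := m) hh0 le_rfl hAh hc0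
    (hc φ ℓ hS h hh) hb0 hb
  have h1 := integral_rpow_le_of_le_decayAverage hp hh0 hAh hB hC0.le hvc
    (fun _ => norm_nonneg _) hv0 hPv
  have h2 := integral_rpow_le_of_le_decayAverage hp hh0 hAh hAh hC0.le hPc hv0
    (fun _ => norm_nonneg _) hvP
  calc ∫ x, ‖P x‖ ^ p ∂τ
      ≤ C ^ p * (A ^ (p - 1) * (2 ^ m * b / c * A) * ∫ y, v y ^ p ∂μ) := h1
    _ ≤ C ^ p * (A ^ (p - 1) * (2 ^ m * b / c * A) *
          (C ^ p * (A ^ (p - 1) * A * ∫ y, ‖P y‖ ^ p ∂μ))) :=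
        mul_le_mul_of_nonneg_left (mul_le_mul_of_nonneg_left h2 (by positivity)) (by positivity)
    _ = _ := by ring

/-- Dominant measures satisfy the lower Marcinkiewicz–Zygmund inequality. -/
theorem exists_integral_rpow_le_of_dominant (μ : Measure M) [IsFiniteMeasure μ]
    {α κ₁ κ₂ κ₃ : ℝ} (κ₄ : ℝ) (hα : 0 < α) (hκ₁ : 0 < κ₁) (hκ₂ : 0 < κ₂) (hκ₃ : 0 < κ₃)
    (hball : ∀ (x : M) (r : ℝ), 0 < r → μ.real (Metric.closedBall x r) ≤ κ₁ * r ^ α)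
    {p : ℝ} (hp : 1 ≤ p) :
    ∃ C δ : ℝ, 0 < C ∧ 0 < δ ∧ ∀ (φ : ℕ → M → ℂ) (ℓ : ℕ → ℝ),
      IsDiffusionSystem (n := n) μ α κ₂ κ₃ κ₄ φ ℓ → ∀ h ∈ Ioc (0 : ℝ) 1, ∀ L : ℝ, L * h ≤ 1 →
        ∀ (τ : Measure M) [IsFiniteMeasure τ] (b : ℝ), 0 < b →
        (∀ z, b * (δ * h) ^ α ≤ τ.real (Metric.closedBall z (δ * h))) →
        ∀ P ∈ diffusionPolynomials φ ℓ L, ∫ x, ‖P x‖ ^ p ∂μ ≤ C * b⁻¹ * ∫ x, ‖P x‖ ^ p ∂τ := by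
  have hp0 : 0 ≤ p := by linarith
  obtain ⟨m, hm⟩ := exists_nat_gt α
  obtain ⟨A, hA0, hA⟩ := exists_integral_decayWeight_le μ hκ₁ hball hm
  obtain ⟨C, hC0, hC⟩ := exists_decayAverage_bounds (n := n) μ κ₄ hα hκ₂ hκ₃ m
  -- Makes the oscillation at scale δh at most half of P in L^p(μ): passing from P to Q and back to
  -- averages costs (CA)².
  set δ : ℝ := min 1 ((2 * (C * A) ^ 2)⁻¹) with hδ
  have hδ0 : 0 < δ := lt_min one_pos (by positivity)
  refine ⟨2 * (2 ^ (p - 1) * κ₁), δ, by positivity, hδ0,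
    fun φ ℓ hS h hh L hL τ _ b hb0 hb P hP => ?_⟩
  have hh0 := hh.1
  obtain ⟨v, hvc, hv0, hvP, -, hosc⟩ := hC φ ℓ hS h hh L hL P hP
  have hPc := (hS.continuous_of_mem hP).norm
  have hAh := hA h hh0
  set u : M → ℝ := fun x => C * δ * decayAverage μ α h m v x with hu
  have huc : Continuous u := continuous_const.mul (continuous_decayAverage hh0 hvc)
  have hu0 : ∀ x, 0 ≤ u x := fun x => mul_nonneg (by positivity) (decayAverage_nonneg hh0 hv0 x)
  obtain ⟨U, hU⟩ := isCompact_univ.exists_bound_of_continuousOn huc.continuousOn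
  obtain ⟨F, hF⟩ := isCompact_univ.exists_bound_of_continuousOn hPc.continuousOn
  have hI0 : 0 ≤ ∫ x, ‖P x‖ ^ p ∂μ := integral_nonneg fun x => by positivity
  have hmain := integral_rpow_le_of_oscillation (μ := μ) (τ := τ) (f := fun x => ‖P x‖) (u := u)
    (F := F) (U := U) (d := δ * h) (c := b * (δ * h) ^ α) (b := κ₁ * (δ * h) ^ α) hp
    hPc.measurable (fun _ => norm_nonneg _) (fun x => (le_abs_self _).trans (hF x (mem_univ x)))
    huc.measurable hu0 (fun x => (le_abs_self _).trans (hU x (mem_univ x)))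
    (fun x y hxy => ?_) (by positivity) hb fun y => hball y _ (by positivity)
  · have h1 := integral_rpow_le_of_le_decayAverage hp hh0 hAh hAh
      (show 0 ≤ C * δ by positivity) hvc hu0 hv0 fun x => le_rfl
    have h2 := integral_rpow_le_of_le_decayAverage hp hh0 hAh hAh hC0.le hPc hv0
      (fun _ => norm_nonneg _) hvP
    have hAp : A ^ (p - 1) * A = A ^ p := by
      rw [← Real.rpow_add_one hA0.ne', sub_add_cancel]
    rw [hAp] at h1 h2
    have h4 : ∫ x, u x ^ p ∂μ ≤ ((C * A) ^ 2 * δ) ^ p * ∫ x, ‖P x‖ ^ p ∂μ := by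
      calc _ ≤ (C * δ) ^ p * (A ^ p * (C ^ p * (A ^ p * ∫ x, ‖P x‖ ^ p ∂μ))) :=
            h1.trans (mul_le_mul_of_nonneg_left (mul_le_mul_of_nonneg_left h2 (by positivity))
              (by positivity))
        _ = ((C * δ) ^ p * A ^ p * C ^ p * A ^ p) * ∫ x, ‖P x‖ ^ p ∂μ := by ring
        _ = _ := by
            rw [← Real.mul_rpow (by positivity) hA0.le, ← Real.mul_rpow (by positivity) hC0.le,
              ← Real.mul_rpow (by positivity) hA0.le]
            congr 2
            ring
    -- The convexity factor 2^(p-1) against 2^(-p) leaves 1/2, so the oscillation term is absorbed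
    -- on the left.
    have h6 : 2 ^ (p - 1) * ((C * A) ^ 2 * δ) ^ p ≤ (1 / 2 : ℝ) := by
      have h7 : (C * A) ^ 2 * δ ≤ 2⁻¹ := by
        calc _ ≤ (C * A) ^ 2 * (2 * (C * A) ^ 2)⁻¹ :=
              mul_le_mul_of_nonneg_left (min_le_right _ _) (by positivity)
          _ = 2⁻¹ := by field_simp
      calc _ ≤ 2 ^ (p - 1) * (2⁻¹ : ℝ) ^ p :=
            mul_le_mul_of_nonneg_left (Real.rpow_le_rpow (by positivity) h7 hp0) (by positivity)
        _ = 1 / 2 := by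
            rw [Real.inv_rpow zero_le_two, ← Real.rpow_neg zero_le_two, ← Real.rpow_add two_pos,
              show p - 1 + -p = -1 by ring, Real.rpow_neg_one, one_div]
    have h8 : (b * (δ * h) ^ α)⁻¹ * (κ₁ * (δ * h) ^ α) = κ₁ * b⁻¹ := by
      have : (δ * h) ^ α ≠ 0 := by positivity
      field_simp
    rw [h8] at hmain
    have h9 := mul_le_mul_of_nonneg_left h4 (show (0 : ℝ) ≤ 2 ^ (p - 1) by positivity)
    have h10 := mul_le_mul_of_nonneg_right h6 hI0
    rw [mul_assoc] at h10
    refine le_of_sub_nonneg ?_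
    have h11 : 2 * (2 ^ (p - 1) * κ₁) * b⁻¹ * ∫ x, ‖P x‖ ^ p ∂τ =
        2 * (2 ^ (p - 1) * (κ₁ * b⁻¹ * ∫ x, ‖P x‖ ^ p ∂τ)) := by ring
    rw [h11]
    linarith
  · have hle : dist x y ≤ h := hxy.trans (mul_le_of_le_one_left hh0.le (min_le_left _ _))
    have h1 := hosc x y hle
    have h2 : dist x y / h ≤ δ := (div_le_iff₀ hh0).2 hxy
    have h3 : C * (dist x y / h) * decayAverage μ α h m v x ≤ u x :=
      mul_le_mul_of_nonneg_right (mul_le_mul_of_nonneg_left h2 hC0.le) (decayAverage_nonneg hh0 hv0 x)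
    have h4 := norm_sub_norm_le (P x) (P y)
    rw [norm_sub_rev] at h4
    linarith

end MarcinkiewiczZygmund

/-! ### The converse inequalities. -/

section Converses

variable {n : ℕ} {M : Type*} [MetricSpace M] [ChartedSpace (EuclideanSpace ℝ (Fin n)) M]
  [RiemannianBundle (fun x : M => TangentSpace (𝓡 n) x)] [IsRiemannianManifold (𝓡 n) M]
  [MeasurableSpace M] [BorelSpace M] [CompactSpace M]

/-- One power of the weight is enough for integrability, and w^p ≤ w for w ≤ 1 ≤ p; hence the
required decay order does not depend on `p`. -/
theorem mul_rpow_mul_rpow_le {a h α p w : ℝ} (hp : 1 ≤ p) (ha : 0 ≤ a) (hh : 0 < h)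
    (hw0 : 0 ≤ w) (hw1 : w ≤ 1) : (a * h ^ (-α) * w) ^ p ≤ a ^ p * h ^ (-α * p) * w := by
  have h1 : w ^ p ≤ w := by
    simpa using Real.rpow_le_rpow_of_exponent_ge' hw0 hw1 zero_le_one hp
  rw [Real.mul_rpow (by positivity) hw0, Real.mul_rpow ha (by positivity), ← Real.rpow_mul hh.le]
  exact mul_le_mul_of_nonneg_left h1 (by positivity)

/-- The upper Marcinkiewicz–Zygmund inequality implies regularity. -/
theorem exists_measureReal_closedBall_le_of_integral_rpow_le (μ : Measure M)
    [IsProbabilityMeasure μ] {α κ₁ κ₂ κ₃ κ₄ : ℝ} (hα : 0 < α) (hκ₁ : 0 < κ₁) (hκ₂ : 0 < κ₂)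
    (hκ₃ : 0 < κ₃) (hκ₄ : 0 < κ₄)
    (hball : ∀ (x : M) (r : ℝ), 0 < r → μ.real (Metric.closedBall x r) ≤ κ₁ * r ^ α)
    {p : ℝ} (hp : 1 ≤ p) :
    ∃ K : ℝ, 0 < K ∧ ∀ (φ : ℕ → M → ℂ) (ℓ : ℕ → ℝ),
      IsDiffusionSystem (n := n) μ α κ₂ κ₃ κ₄ φ ℓ → ∀ L : ℝ, 1 ≤ L →
        ∀ (τ : Measure M) [IsFiniteMeasure τ] (A : ℝ), 0 < A →
        (∀ P ∈ diffusionPolynomials φ ℓ L, ∫ x, ‖P x‖ ^ p ∂τ ≤ A * ∫ x, ‖P x‖ ^ p ∂μ) →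
        ∀ x, τ.real (Metric.closedBall x (1 / L)) ≤ K * A * (1 / L) ^ α := by
  have hp0 : 0 ≤ p := by linarith
  obtain ⟨m, hm⟩ := exists_nat_gt α
  obtain ⟨I, hI0, hI⟩ := exists_integral_decayWeight_le μ hκ₁ hball hm
  obtain ⟨N, C, c, ε, hN1, hC0, hc0, hε0, hε1, hloc⟩ :=
    exists_localized_polynomials (n := n) μ hα hκ₂ hκ₃ hκ₄ m
  -- With h = N'/L, the localized polynomial lies in Π_L and is bounded below on all of B(x, 1/L).
  set N' : ℝ := max N ε⁻¹ with hN'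
  have hN'1 : 1 ≤ N' := hN1.trans (le_max_left _ _)
  have hN'0 : 0 < N' := by linarith
  refine ⟨((c ^ p)⁻¹ * C ^ p * I + 1) * N' ^ α, by positivity,
    fun φ ℓ hS L hL τ _ A hA0 hA x => ?_⟩
  have hL0 : 0 < L := by linarith
  rcases le_or_gt N' L with hNL | hNL
  · set h : ℝ := N' / L with hh
    have hh0 : 0 < h := by positivity
    have hhmem : h ∈ Ioc (0 : ℝ) 1 := ⟨hh0, (div_le_one hL0).2 hNL⟩
    obtain ⟨Φ, hΦm, hΦP, hΦle, hΦge⟩ := hloc φ ℓ hS h hhmem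
    have hLh : L * h = N' := by rw [hh]; field_simp
    have hP := hΦP L x (by rw [hLh]; exact le_max_left _ _)
    have hc := (hS.continuous_of_mem hP).norm.rpow_const fun _ => Or.inr hp0
    have hint : ∀ (ρ : Measure M) [IsFiniteMeasure ρ], Integrable (fun z => ‖Φ x z‖ ^ p) ρ :=
      fun ρ _ => hc.integrable_of_hasCompactSupport (HasCompactSupport.of_compactSpace _)
    have hpos : 0 < h ^ (-α * p) := by positivity
    have hlow : c ^ p * h ^ (-α * p) * τ.real (Metric.closedBall x (1 / L)) ≤
        ∫ z, ‖Φ x z‖ ^ p ∂τ := by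
      refine mul_measureReal_le_integral (hint τ) (fun z => by positivity)
        Metric.isClosed_closedBall.measurableSet fun z hz => ?_
      have h1 : 1 / L ≤ ε * h := by
        rw [hh, ← mul_div_assoc]
        refine div_le_div_of_nonneg_right ?_ hL0.le
        calc (1 : ℝ) = ε * ε⁻¹ := by field_simp
          _ ≤ ε * N' := mul_le_mul_of_nonneg_left (le_max_right _ _) hε0.le
      have h2 := hΦge x z ((Metric.mem_closedBall'.1 hz).trans h1)
      rw [Real.rpow_mul hh0.le, ← Real.mul_rpow hc0.le (by positivity)]
      exact Real.rpow_le_rpow (by positivity) h2 hp0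
    have hup : ∫ z, ‖Φ x z‖ ^ p ∂μ ≤ C ^ p * h ^ (-α * p) * (I * h ^ α) := by
      calc _ ≤ ∫ z, C ^ p * h ^ (-α * p) * decayWeight h m x z ∂μ := by
            refine integral_mono (hint μ) ((integrable_decayWeight hh0 m x).const_mul _)
              fun z => ?_
            have hd := decayWeight_pos hh0 m x z
            exact (Real.rpow_le_rpow (norm_nonneg _) (hΦle x z) hp0).trans
              (mul_rpow_mul_rpow_le hp hC0.le hh0 hd.le (decayWeight_le_one hh0 m x z))
        _ ≤ _ := by
            rw [integral_const_mul]
            exact mul_le_mul_of_nonneg_left (hI h hh0 x) (by positivity)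
    have h3 := hlow.trans ((hA _ hP).trans (mul_le_mul_of_nonneg_left hup hA0.le))
    have h4 : h ^ α = N' ^ α * (1 / L) ^ α := by
      rw [← Real.mul_rpow hN'0.le (by positivity), hh]
      congr 1
      ring
    have h5 : τ.real (Metric.closedBall x (1 / L)) ≤ (c ^ p)⁻¹ * C ^ p * I * A * h ^ α := by
      rw [← mul_le_mul_iff_right₀ (show 0 < c ^ p * h ^ (-α * p) by positivity)]
      refine h3.trans_eq ?_
      field_simp
    refine h5.trans ?_
    rw [h4]
    have h6 : 0 ≤ N' ^ α * A * (1 / L) ^ α := by positivity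
    refine le_of_sub_nonneg (le_of_le_of_eq h6 ?_)
    ring
  -- Here h would exceed 1. Testing with a constant gives τ(M) ≤ A, while (N'/L)^α ≥ 1; this is the
  -- source of the summand 1 in the constant.
  · have h1 := hA _ (hS.const_mem hL)
    simp only [norm_one, Real.one_rpow, integral_const, smul_eq_mul, mul_one, probReal_univ] at h1
    have h2 : 1 ≤ N' ^ α * (1 / L) ^ α := by
      rw [← Real.mul_rpow hN'0.le (by positivity), mul_one_div]
      exact Real.one_le_rpow ((one_le_div hL0).2 hNL.le) hα.le
    have h3 : 0 ≤ (c ^ p)⁻¹ * C ^ p * I := by positivity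
    calc τ.real (Metric.closedBall x (1 / L)) ≤ A := (measureReal_mono (subset_univ _)).trans h1
      _ ≤ A * (N' ^ α * (1 / L) ^ α) := le_mul_of_one_le_right hA0.le h2
      _ ≤ _ := by
          have h4 : 0 ≤ (c ^ p)⁻¹ * C ^ p * I * (A * (N' ^ α * (1 / L) ^ α)) := by positivity
          refine le_of_sub_nonneg (le_of_le_of_eq h4 ?_)
          ring

/-- Lower bounds for the `τ` measure of a ball `B(x, d)`, from lower bounds for the integrals with
respect to `τ` of nonnegative functions localized around the points of `B(x, d / 2)`. -/
theorem mul_measureReal_le_of_localized {μ τ : Measure M} [IsFiniteMeasure μ] [IsFiniteMeasure τ]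
    {g : M → M → ℝ} {G d b q T : ℝ} (hg : Measurable (Function.uncurry g))
    (hg0 : ∀ y z, 0 ≤ g y z) (hgG : ∀ y z, g y z ≤ G) {x : M}
    (hfar : ∀ y, dist x y ≤ d / 2 → ∫ z, (1 - nearIndicator d x z) * g y z ∂τ ≤ T)
    (hlow : ∀ y, q ≤ ∫ z, g y z ∂τ) (hup : ∀ z, ∫ y, g y z ∂μ ≤ b) :
    (q - T) * μ.real (Metric.closedBall x (d / 2)) ≤ b * τ.real (Metric.closedBall x d) := by
  have hgabs : ∀ r : M × M, |Function.uncurry g r| ≤ G := fun r => by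
    rw [Function.uncurry_def, abs_of_nonneg (hg0 r.1 r.2)]
    exact hgG r.1 r.2
  have hnear : ∀ z, |nearIndicator d x z| ≤ 1 := fun z => abs_uncurry_nearIndicator_le d (x, z)
  have hnm : Measurable (nearIndicator d x) := Measurable.of_uncurry_left (measurable_nearIndicator d)
  have hgy : ∀ y, Measurable (g y) := fun y => Measurable.of_uncurry_left hg
  have hint : Integrable (Function.uncurry fun y z => nearIndicator d x z * g y z) (μ.prod τ) :=
    integrable_mul_of_bound (hnm.comp measurable_snd) hg (fun r => hnear r.2) hgabs
  have hin : Integrable (nearIndicator d x) τ := Integrable.of_bound hnm.aestronglyMeasurable 1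
    (Eventually.of_forall hnear)
  have hpt : ∀ y ∈ Metric.closedBall x (d / 2), q - T ≤ ∫ z, nearIndicator d x z * g y z ∂τ := by
    intro y hy
    have h1 := integrable_mul_of_bound (μ := τ) hnm (hgy y) hnear fun z => hgabs (y, z)
    have h2 : Integrable (g y) τ := Integrable.of_bound (hgy y).aestronglyMeasurable G
      (Eventually.of_forall fun z => hgabs (y, z))
    have h3 := hfar y (Metric.mem_closedBall'.1 hy)
    simp only [sub_mul, one_mul] at h3
    rw [integral_sub h2 h1] at h3
    linarith [hlow y]
  have h4 := mul_measureReal_le_integral (τ := μ) hint.integral_prod_left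
    (fun y => integral_nonneg fun z => mul_nonneg (nearIndicator_nonneg d x z) (hg0 y z))
    Metric.isClosed_closedBall.measurableSet hpt
  refine h4.trans ?_
  -- Averaging over the centres `y` gives a bound proportional to the volume of B(x, d/2). A single
  -- centre would only give one of order h^α, losing the factor (d/h)^α.
  have h5 : ∫ y, ∫ z, nearIndicator d x z * g y z ∂τ ∂μ =
      ∫ z, nearIndicator d x z * ∫ y, g y z ∂μ ∂τ := by
    rw [integral_integral_swap hint]
    simp only [integral_const_mul]
  change ∫ y, ∫ z, nearIndicator d x z * g y z ∂τ ∂μ ≤ _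
  rw [h5]
  calc _ ≤ ∫ z, nearIndicator d x z * b ∂τ :=
        integral_mono_of_nonneg (Eventually.of_forall fun z =>
          mul_nonneg (nearIndicator_nonneg d x z) (integral_nonneg fun y => hg0 y z))
          (hin.mul_const b) (Eventually.of_forall fun z =>
            mul_le_mul_of_nonneg_left (hup z) (nearIndicator_nonneg d x z))
    _ = _ := by rw [integral_mul_const, integral_nearIndicator, mul_comm]

/-- The lower Marcinkiewicz–Zygmund inequality for a regular measure implies dominance at a
coarser scale. -/
theorem exists_le_mul_measureReal_closedBall_of_integral_rpow_le (μ : Measure M)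
    [IsProbabilityMeasure μ] {α κ₁ κ₂ κ₃ κ₄ : ℝ} (hα : 0 < α) (hκ₁ : 0 < κ₁) (hκ₂ : 0 < κ₂)
    (hκ₃ : 0 < κ₃) (hκ₄ : 0 < κ₄)
    (hball : ∀ (x : M) (r : ℝ), 0 < r → μ.real (Metric.closedBall x r) ≤ κ₁ * r ^ α)
    {p : ℝ} (hp : 1 ≤ p) (S : ℕ) (hαS : α < S) :
    ∃ K c' : ℝ, 0 < K ∧ 0 < c' ∧ ∀ (φ : ℕ → M → ℂ) (ℓ : ℕ → ℝ),
      IsDiffusionSystem (n := n) μ α κ₂ κ₃ κ₄ φ ℓ → ∀ L : ℝ, 1 ≤ L →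
        ∀ (τ : Measure M) [IsFiniteMeasure τ] (b : ℝ), 0 ≤ b →
        (∀ z, τ.real (Metric.closedBall z (1 / L)) ≤ b * (1 / L) ^ α) →
        ∀ A : ℝ, 0 < A →
        (∀ P ∈ diffusionPolynomials φ ℓ L, ∫ x, ‖P x‖ ^ p ∂μ ≤ A * ∫ x, ‖P x‖ ^ p ∂τ) →
        ∀ d : ℝ, d = K * max 1 (b * A) ^ (1 / (S - α)) / L →
        ∀ x, c' * min 1 d ^ α ≤ A * τ.real (Metric.closedBall x d) := by
  have hp0 : 0 ≤ p := by linarith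
  obtain ⟨m, hm⟩ := exists_nat_gt α
  obtain ⟨I, hI0, hI⟩ := exists_integral_decayWeight_le μ hκ₁ hball hm
  obtain ⟨c₀, hc₀, hc₀ball⟩ := exists_le_measureReal_closedBall (n := n) μ κ₄ hκ₁ hκ₂ hκ₃ hball
  -- `S` orders of decay make the tail outside B(x,d) small, and `m` orders make it integrable.
  obtain ⟨N, C, c, ε, hN1, hC0, hc0, hε0, hε1, hloc⟩ :=
    exists_localized_polynomials (n := n) μ hα hκ₂ hκ₃ hκ₄ (S + m)
  have hN0 : 0 < N := by linarith
  have hσ : 0 < (S : ℝ) - α := by linarith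
  set D := Metric.diam (univ : Set M) with hDdef
  have hD0 : 0 ≤ D := Metric.diam_nonneg
  set k₁ : ℝ := c ^ p * (c₀ * ε ^ α) with hk₁
  have hk₁0 : 0 < k₁ := by positivity
  set k₂ : ℝ := C ^ p * (2 ^ m / c₀ * I) with hk₂
  have hk₂0 : 0 < k₂ := by positivity
  set X : ℝ := (2 * k₂ / k₁) ^ (1 / ((S : ℝ) - α)) with hX
  have hX0 : 0 < X := by positivity
  set c' : ℝ := min 1 (k₁ / 2 * (c₀ * (1 / 2) ^ α) / (C ^ p * I)) with hc'
  have hc'0 : 0 < c' := lt_min one_pos (by positivity)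
  -- The first summand makes d/(2h) large enough for the tail to be at most half of the total when N
  -- ≤ L. The second makes `d` exceed the diameter when L < N.
  refine ⟨2 * N * X + N * (D + 1), c', by positivity, hc'0,
    fun φ ℓ hS L hL τ _ b hb0 hb A hA0 hA d hd x => ?_⟩
  set K : ℝ := 2 * N * X + N * (D + 1) with hK
  have hK0 : 0 < K := by positivity
  have hL0 : 0 < L := by linarith
  set Q : ℝ := max 1 (b * A) with hQ
  have hQ1 : 1 ≤ Q := le_max_left _ _
  have hQ0 : 0 < Q := by linarith
  have hQpow : 1 ≤ Q ^ (1 / ((S : ℝ) - α)) := Real.one_le_rpow hQ1 (by positivity)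
  have hd0 : 0 < d := by rw [hd]; positivity
  rcases le_or_gt N L with hNL | hNL
  · set h : ℝ := N / L with hh
    have hh0 : 0 < h := by positivity
    have hhmem : h ∈ Ioc (0 : ℝ) 1 := ⟨hh0, (div_le_one hL0).2 hNL⟩
    obtain ⟨Φ, hΦm, hΦP, hΦle, hΦge⟩ := hloc φ ℓ hS h hhmem
    have hLh : L * h = N := by rw [hh]; field_simp
    have hrh : 1 / L ≤ h := div_le_div_of_nonneg_right hN1 hL0.le
    have hrmem : 1 / L ∈ Ioc (0 : ℝ) 1 := ⟨by positivity, (div_le_one hL0).2 hL⟩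
    have hτw := integral_decayWeight_le_of_regular (τ := τ) (m := m) hrmem.1 hrh (hI h hh0) hc₀
      (hc₀ball φ ℓ hS _ hrmem) hb0 hb
    set s : ℝ := h ^ (-α * p) with hs
    have hs0 : 0 < s := by positivity
    have hhα : 0 < h ^ α := by positivity
    have hPc : ∀ y, Continuous fun z => ‖Φ y z‖ ^ p := fun y =>
      (hS.continuous_of_mem (hΦP L y hLh.ge)).norm.rpow_const fun _ => Or.inr hp0
    have hpow : ∀ y z : M, ‖Φ y z‖ ^ p ≤ C ^ p * s * decayWeight h (S + m) y z := fun y z =>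
      (Real.rpow_le_rpow (norm_nonneg _) (hΦle y z) hp0).trans
        (mul_rpow_mul_rpow_le hp hC0.le hh0 (decayWeight_pos hh0 _ y z).le
          (decayWeight_le_one hh0 _ y z))
    have hdm : ∀ y z : M, decayWeight h (S + m) y z ≤ decayWeight h m y z := fun y z => by
      rw [decayWeight_add]
      exact mul_le_of_le_one_left (decayWeight_pos hh0 m y z).le (decayWeight_le_one hh0 S y z)
    set w : ℝ := ((1 + d / (2 * h)) ^ S)⁻¹ with hw
    have hw0 : 0 < w := by positivity
    have hfar : ∀ y, dist x y ≤ d / 2 →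
        ∫ z, (1 - nearIndicator d x z) * ‖Φ y z‖ ^ p ∂τ ≤
          C ^ p * s * w * ((2 ^ m * b / c₀ * I) * h ^ α) := by
      intro y hy
      calc _ ≤ ∫ z, C ^ p * s * w * decayWeight h m y z ∂τ := by
            refine integral_mono_of_nonneg (Eventually.of_forall fun z => ?_)
              ((integrable_decayWeight hh0 m y).const_mul _) (Eventually.of_forall fun z => ?_)
            · exact mul_nonneg (sub_nonneg.2 (nearIndicator_le_one d x z)) (by positivity)
            · have hdz := decayWeight_pos hh0 m y z
              rcases le_or_gt (dist x z) d with hz | hz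
              · simp only [nearIndicator_of_le hz, sub_self, zero_mul]
                positivity
              · simp only [nearIndicator_of_lt hz, sub_zero, one_mul]
                refine (hpow y z).trans ?_
                rw [decayWeight_add, mul_assoc _ w, mul_comm (decayWeight h S y z),
                  mul_comm w]
                refine mul_le_mul_of_nonneg_left (mul_le_mul_of_nonneg_left ?_ hdz.le)
                  (by positivity)
                refine inv_anti₀ (by positivity) (pow_le_pow_left₀ (by positivity) ?_ S)
                have h1 : d / 2 ≤ dist y z := by linarith [dist_triangle x y z]
                have h2 : d / (2 * h) ≤ dist y z / h := by
                  rw [← div_div]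
                  exact div_le_div_of_nonneg_right h1 hh0.le
                linarith
        _ ≤ _ := by
            rw [integral_const_mul]
            exact mul_le_mul_of_nonneg_left (hτw y) (by positivity)
    have hlow : ∀ y, k₁ * s * h ^ α / A ≤ ∫ z, ‖Φ y z‖ ^ p ∂τ := by
      intro y
      have h1 := hA _ (hΦP L y hLh.ge)
      have h2 : c ^ p * s * μ.real (Metric.closedBall y (ε * h)) ≤ ∫ z, ‖Φ y z‖ ^ p ∂μ := by
        refine mul_measureReal_le_integral ((hPc y).integrable_of_hasCompactSupport
          (HasCompactSupport.of_compactSpace _)) (fun z => by positivity)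
          Metric.isClosed_closedBall.measurableSet fun z hz => ?_
        rw [hs, Real.rpow_mul hh0.le, ← Real.mul_rpow hc0.le (by positivity)]
        exact Real.rpow_le_rpow (by positivity) (hΦge y z (Metric.mem_closedBall'.1 hz)) hp0
      have h3 := hc₀ball φ ℓ hS (ε * h) ⟨by positivity, mul_le_one₀ hε1 hh0.le hhmem.2⟩ y
      rw [Real.mul_rpow hε0.le hh0.le] at h3
      rw [div_le_iff₀' hA0]
      refine le_trans ?_ (h2.trans h1)
      refine le_trans (le_of_eq ?_) (mul_le_mul_of_nonneg_left h3
        (show 0 ≤ c ^ p * s by positivity))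
      rw [hk₁]
      ring
    have hup : ∀ z, ∫ y, ‖Φ y z‖ ^ p ∂μ ≤ C ^ p * s * (I * h ^ α) := by
      intro z
      calc _ ≤ ∫ y, C ^ p * s * decayWeight h m z y ∂μ := by
            refine integral_mono_of_nonneg (Eventually.of_forall fun y => by positivity)
              ((integrable_decayWeight hh0 m z).const_mul _) (Eventually.of_forall fun y => ?_)
            change ‖Φ y z‖ ^ p ≤ C ^ p * s * decayWeight h m z y
            rw [decayWeight_comm h m z y]
            exact (hpow y z).trans (mul_le_mul_of_nonneg_left (hdm y z) (by positivity))
        _ ≤ _ := by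
            rw [integral_const_mul]
            exact mul_le_mul_of_nonneg_left (hI h hh0 z) (by positivity)
    have hwQ : w * (b * A) * k₂ ≤ k₁ / 2 := by
      set Y : ℝ := X * Q ^ (1 / ((S : ℝ) - α)) with hY
      have hY0 : 0 < Y := by positivity
      have h1 : Y ≤ d / (2 * h) := by
        rw [le_div_iff₀ (by positivity), hd, hh, hY]
        have h2 : 2 * N * X ≤ K := by rw [hK]; linarith [show 0 ≤ N * (D + 1) by positivity]
        calc X * Q ^ (1 / ((S : ℝ) - α)) * (2 * (N / L)) =
            2 * N * X * Q ^ (1 / ((S : ℝ) - α)) / L := by ring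
          _ ≤ _ := by gcongr
      -- The base is at least 1, so the decay of order `S` is more than the exponent S - α needs.
      have h2 : Y ^ ((S : ℝ) - α) ≤ (1 + d / (2 * h)) ^ S := by
        rw [← Real.rpow_natCast (1 + d / (2 * h)) S]
        calc _ ≤ (1 + d / (2 * h)) ^ ((S : ℝ) - α) :=
              Real.rpow_le_rpow hY0.le (by linarith) hσ.le
          _ ≤ _ := Real.rpow_le_rpow_of_exponent_le (by linarith [hY0.le.trans h1]) (by linarith)
      have h3 : Y ^ ((S : ℝ) - α) = 2 * k₂ / k₁ * Q := by
        rw [hY, Real.mul_rpow hX0.le (by positivity), hX, ← Real.rpow_mul (by positivity),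
          ← Real.rpow_mul hQ0.le, one_div_mul_cancel hσ.ne', Real.rpow_one, Real.rpow_one]
      have h4 : w ≤ (2 * k₂ / k₁ * Q)⁻¹ := by
        rw [hw, ← h3]
        exact inv_anti₀ (by positivity) h2
      calc w * (b * A) * k₂ ≤ (2 * k₂ / k₁ * Q)⁻¹ * Q * k₂ := by
            have h5 : b * A ≤ Q := le_max_right _ _
            gcongr
        _ = k₁ / 2 := by field_simp
    set T : ℝ := C ^ p * s * w * ((2 ^ m * b / c₀ * I) * h ^ α) with hT
    have hTle : T ≤ k₁ / 2 * (s * h ^ α / A) := by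
      have h1 : T = w * (b * A) * k₂ * (s * h ^ α / A) := by
        rw [hT, hk₂]
        field_simp
      rw [h1]
      exact mul_le_mul_of_nonneg_right hwQ (by positivity)
    have hqT : k₁ / 2 * (s * h ^ α / A) ≤ k₁ * s * h ^ α / A - T := by
      have h1 : k₁ * s * h ^ α / A = 2 * (k₁ / 2 * (s * h ^ α / A)) := by ring
      rw [h1]
      linarith
    have hmain := mul_measureReal_le_of_localized (μ := μ) (τ := τ) (x := x) (d := d)
      (g := fun y z => ‖Φ y z‖ ^ p) (G := C ^ p * s * 1) (hΦm.norm.pow_const p)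
      (fun y z => by positivity)
      (fun y z => (hpow y z).trans
        (mul_le_mul_of_nonneg_left (decayWeight_le_one hh0 _ y z) (by positivity)))
      hfar hlow hup
    have hmin0 : 0 < min 1 d := lt_min one_pos hd0
    -- Lower volume bounds are available only up to radius 1, hence the truncation at `min 1 d`.
    have hball2 : c₀ * ((1 / 2) ^ α * min 1 d ^ α) ≤ μ.real (Metric.closedBall x (d / 2)) := by
      have h1 := hc₀ball φ ℓ hS (1 / 2 * min 1 d)
        ⟨by positivity, by linarith [min_le_left 1 d]⟩ x
      rw [Real.mul_rpow (by norm_num) hmin0.le] at h1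
      exact h1.trans (measureReal_mono (Metric.closedBall_subset_closedBall
        (by linarith [min_le_right 1 d])))
    have h1 : k₁ / 2 * (s * h ^ α / A) * (c₀ * ((1 / 2) ^ α * min 1 d ^ α)) ≤
        C ^ p * s * (I * h ^ α) * τ.real (Metric.closedBall x d) :=
      le_trans (mul_le_mul hqT hball2 (by positivity) (le_trans (by positivity) hqT)) hmain
    have h2 : k₁ / 2 * (c₀ * (1 / 2) ^ α) / (C ^ p * I) * min 1 d ^ α ≤
        A * τ.real (Metric.closedBall x d) := by
      have h3 := mul_le_mul_of_nonneg_left h1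
        (show 0 ≤ A / (C ^ p * I * (s * h ^ α)) by positivity)
      refine le_trans (le_of_eq ?_) (h3.trans_eq ?_) <;> field_simp
    exact (mul_le_mul_of_nonneg_right (min_le_right _ _) (by positivity)).trans h2
  · have hDd : D + 1 ≤ d := by
      rw [hd, le_div_iff₀ hL0]
      have h1 : N * (D + 1) ≤ K := by rw [hK]; linarith [show 0 ≤ 2 * N * X by positivity]
      calc (D + 1) * L ≤ (D + 1) * N := mul_le_mul_of_nonneg_left hNL.le (by linarith)
        _ = N * (D + 1) := mul_comm _ _
        _ ≤ K := h1
        _ ≤ _ := le_mul_of_one_le_right hK0.le hQpow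
    have huniv : Metric.closedBall x d = univ := by
      refine eq_univ_of_forall fun y => ?_
      rw [Metric.mem_closedBall]
      have := Metric.dist_le_diam_of_mem isCompact_univ.isBounded (mem_univ y) (mem_univ x)
      linarith
    have h1 := hA _ (hS.const_mem hL)
    simp only [norm_one, Real.one_rpow, integral_const, smul_eq_mul, mul_one, probReal_univ] at h1
    rw [huniv]
    refine le_trans ?_ h1
    exact mul_le_one₀ (min_le_left _ _) (by positivity)
      (Real.rpow_le_one (by positivity) (min_le_left _ _) hα.le)

end Converses

/-! ### Regularity and dominance norms. -/

section Norms

/-- Lets all the estimates be carried out with integrals of p-th powers, in which the constants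
enter linearly. -/
theorem pNorm_le_rpow_mul_pNorm_iff {M : Type*} [MeasurableSpace M] {τ μ : Measure M} {p C : ℝ} (hp : 0 < p) (hC : 0 ≤ C)
    {f : M → ℂ} : pNorm τ p f ≤ C ^ (1 / p) * pNorm μ p f ↔
      ∫ x, ‖f x‖ ^ p ∂τ ≤ C * ∫ x, ‖f x‖ ^ p ∂μ := by
  have h : ∀ ρ : Measure M, 0 ≤ ∫ x, ‖f x‖ ^ p ∂ρ := fun ρ =>
    integral_nonneg fun x => Real.rpow_nonneg (norm_nonneg _) _
  rw [pNorm, pNorm, ← Real.mul_rpow hC (h μ),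
    Real.rpow_le_rpow_iff (h τ) (mul_nonneg hC (h μ)) (by positivity)]

variable {M : Type*} [MetricSpace M] [MeasurableSpace M] {ν : SignedMeasure M} {α d c : ℝ}

/-- The infimum defining `regularNorm` is attained. -/
theorem IsRegularMeasure.regularNorm_mem (h : IsRegularMeasure ν α d) (hd : 0 < d) :
    regularNorm ν α d ∈ regularConstants ν α d := by
  obtain ⟨c, -, hc⟩ := h
  intro x
  rw [← div_le_iff₀ (Real.rpow_pos_of_pos hd α)]
  exact le_csInf ⟨c, hc⟩ fun c' hc' => (div_le_iff₀ (Real.rpow_pos_of_pos hd α)).2 (hc' x)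

/-- The supremum defining `dominantNorm` is attained. -/
theorem IsDominantMeasure.sSup_mem (h : IsDominantMeasure ν α d) (hd : 0 < d) :
    sSup (dominantConstants ν α d) ∈ dominantConstants ν α d := by
  obtain ⟨c, -, hc⟩ := h
  intro x
  rw [← le_div_iff₀ (Real.rpow_pos_of_pos hd α)]
  exact csSup_le ⟨c, hc⟩ fun c' hc' => (le_div_iff₀ (Real.rpow_pos_of_pos hd α)).2 (hc' x)

variable [Nonempty M]

theorem nonneg_of_mem_regularConstants (hd : 0 < d) (hc : c ∈ regularConstants ν α d) : 0 ≤ c :=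
  nonneg_of_mul_nonneg_left (measureReal_nonneg.trans (hc (Classical.arbitrary M)))
    (Real.rpow_pos_of_pos hd α)

theorem regularNorm_le (hd : 0 < d) (hc : c ∈ regularConstants ν α d) : regularNorm ν α d ≤ c :=
  csInf_le ⟨0, fun _ => nonneg_of_mem_regularConstants hd⟩ hc

theorem regularNorm_nonneg (hd : 0 < d) : 0 ≤ regularNorm ν α d :=
  Real.sInf_nonneg fun _ => nonneg_of_mem_regularConstants hd

/-- A single ball bounds all the constants. Without this bound the real supremum would take its
default value 0. -/
theorem bddAbove_dominantConstants (ν : SignedMeasure M) (α : ℝ) (hd : 0 < d) :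
    BddAbove (dominantConstants ν α d) :=
  ⟨ν.totalVariation.real (Metric.closedBall (Classical.arbitrary M) d) / d ^ α, fun _ hc =>
    (le_div_iff₀ (Real.rpow_pos_of_pos hd α)).2 (hc _)⟩

theorem IsDominantMeasure.sSup_pos (h : IsDominantMeasure ν α d) (hd : 0 < d) :
    0 < sSup (dominantConstants ν α d) := by
  obtain ⟨c, hc0, hc⟩ := h
  exact hc0.trans_le (le_csSup (bddAbove_dominantConstants ν α hd) hc)

theorem dominantNorm_le_inv (hd : 0 < d) (hc0 : 0 < c) (hc : c ∈ dominantConstants ν α d) :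
    dominantNorm ν α d ≤ c⁻¹ :=
  inv_anti₀ hc0 (le_csSup (bddAbove_dominantConstants ν α hd) hc)

/-- Dominance at scale `d`, from lower bounds at all points which saturate for large `d`. -/
theorem isDominantMeasure_and_dominantNorm_le {c' A : ℝ} (hd : 0 < d) (hc' : 0 < c')
    (hA : 0 < A)
    (h : ∀ x, c' * min 1 d ^ α ≤ A * ν.totalVariation.real (Metric.closedBall x d)) :
    IsDominantMeasure ν α d ∧ dominantNorm ν α d ≤ c'⁻¹ * A * max 1 d ^ α := by
  have hmin : 0 < min 1 d := lt_min one_pos hd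
  have hmax : 0 < max 1 d := lt_max_of_lt_left one_pos
  have hdd : d ^ α = max 1 d ^ α * min 1 d ^ α := by
    rw [← Real.mul_rpow hmax.le hmin.le, max_mul_min, one_mul]
  have hq0 : 0 < (c'⁻¹ * A * max 1 d ^ α)⁻¹ := by positivity
  have hq : (c'⁻¹ * A * max 1 d ^ α)⁻¹ ∈ dominantConstants ν α d := by
    intro x
    have h1 : (c'⁻¹ * A * max 1 d ^ α)⁻¹ * d ^ α = c' * min 1 d ^ α / A := by
      rw [hdd]
      field_simp
    rw [h1, div_le_iff₀' hA]
    exact h x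
  exact ⟨⟨_, hq0, hq⟩, (dominantNorm_le_inv hd hq0 hq).trans_eq (inv_inv _)⟩

/-- If `d` exceeds the diameter, dominance is a lower bound for the total mass, and the dominance
norm is controlled by the relation between `d` and the total mass. -/
theorem dominantNorm_le_of_closedBall_eq_univ [CompactSpace M] {c' A K L σ : ℝ} (hα : 0 ≤ α)
    (hc' : 0 < c') (hA : 0 < A) (hK : 0 < K) (hL : 1 ≤ L) (hσ : 0 < σ) (hασ : α ≤ σ)
    (hd1 : 1 ≤ d) (hdiam : Metric.diam (univ : Set M) ≤ d)
    (hd : d = K * max 1 (regularNorm ν α (1 / L) * A) ^ (1 / σ) / L)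
    (h : ∀ x, c' ≤ A * ν.totalVariation.real (Metric.closedBall x d)) :
    dominantNorm ν α d ≤ K ^ α * (1 + c'⁻¹) * A := by
  have hd0 : 0 < d := by linarith
  have hL0 : 0 < L := by linarith
  have huniv : ∀ x : M, Metric.closedBall x d = univ := fun x => eq_univ_of_forall fun y =>
    (Metric.dist_le_diam_of_mem isCompact_univ.isBounded (mem_univ y) (mem_univ x)).trans hdiam
  set T := ν.totalVariation.real univ with hT
  have hcT : c' ≤ A * T := by simpa only [huniv] using h (Classical.arbitrary M)
  have hT0 : 0 < T := pos_of_mul_pos_right (hc'.trans_le hcT) hA.le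
  have hreg : regularNorm ν α (1 / L) ≤ T * L ^ α := by
    refine regularNorm_le (by positivity) fun x => ?_
    rw [one_div, Real.inv_rpow hL0.le, mul_inv_cancel_right₀ (by positivity)]
    exact measureReal_mono (subset_univ _)
  set Q := max 1 (regularNorm ν α (1 / L) * A) with hQ
  have hQ1 : 1 ≤ Q := le_max_left _ _
  have hQ0 : 0 < Q := by linarith
  have hQle : Q ≤ (1 + c'⁻¹) * (A * T) * L ^ α := by
    have hLα : 1 ≤ L ^ α := Real.one_le_rpow hL hα
    have h1 : 1 ≤ c'⁻¹ * (A * T) := by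
      rw [inv_mul_eq_div]
      exact (one_le_div hc').2 hcT
    refine max_le ?_ ?_
    · refine one_le_mul_of_one_le_of_one_le ?_ hLα
      linarith [mul_pos hA hT0]
    · have h2 : regularNorm ν α (1 / L) * A ≤ T * L ^ α * A :=
        mul_le_mul_of_nonneg_right hreg hA.le
      have h3 : 0 ≤ c'⁻¹ * (A * T) * L ^ α := by positivity
      linarith
  -- As α ≤ σ and Q ≥ 1, Q^(α/σ) ≤ Q. Since `Q` is at most a multiple of A T L^α, the power of `L`
  -- cancels against the one in `d`, and d^α is bounded by a multiple of A times the total mass.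
  have hdα : d ^ α ≤ K ^ α * ((1 + c'⁻¹) * (A * T)) := by
    have h1 : (Q ^ (1 / σ)) ^ α ≤ Q := by
      rw [← Real.rpow_mul hQ0.le]
      refine (Real.rpow_le_rpow_of_exponent_le hQ1 ?_).trans_eq (Real.rpow_one Q)
      rw [one_div_mul_eq_div]
      exact (div_le_one hσ).2 hασ
    rw [hd, Real.div_rpow (by positivity) hL0.le, Real.mul_rpow hK.le (by positivity),
      div_le_iff₀ (by positivity), mul_assoc]
    exact mul_le_mul_of_nonneg_left (h1.trans hQle) (by positivity)
  have hq0 : 0 < (K ^ α * (1 + c'⁻¹) * A)⁻¹ := by positivity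
  refine (dominantNorm_le_inv hd0 hq0 fun x => ?_).trans_eq (inv_inv _)
  rw [huniv, inv_mul_le_iff₀ (by positivity)]
  linarith

end Norms

/-! ### Assembly of the four statements. -/

theorem mainTheorem4 {n : ℕ} {M : Type*} [MetricSpace M] [CompactSpace M] [ConnectedSpace M]
    [ChartedSpace (EuclideanSpace ℝ (Fin n)) M] [IsManifold (𝓡 n) ∞ M]
    [RiemannianBundle (fun x : M => TangentSpace (𝓡 n) x)]
    [IsContMDiffRiemannianBundle (𝓡 n) ∞ (EuclideanSpace ℝ (Fin n))
      (fun x : M => TangentSpace (𝓡 n) x)]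
    [IsRiemannianManifold (𝓡 n) M]
    [MeasurableSpace M] [BorelSpace M]
    (μ : Measure M) [IsProbabilityMeasure μ]
    (α κ₁ κ₂ κ₃ κ₄ : ℝ) (hα : 0 < α) (hκ₁ : 0 < κ₁) (hκ₂ : 0 < κ₂) (hκ₃ : 0 < κ₃) (hκ₄ : 0 < κ₄)
    (hball : ∀ (x : M) (r : ℝ), 0 < r → μ.real (Metric.closedBall x r) ≤ κ₁ * r ^ α)
    (p : ℝ) (hp : 1 ≤ p) :
    -- (a), direct part
    (∃ c₁ : ℝ, 0 < c₁ ∧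
      ∀ (φ : ℕ → M → ℂ) (ℓ : ℕ → ℝ), IsDiffusionSystem (n := n) μ α κ₂ κ₃ κ₄ φ ℓ →
      ∀ (L : ℝ), 2 ≤ L → ∀ (ν : SignedMeasure M), IsRegularMeasure ν α (1 / L) →
      ∀ P ∈ diffusionPolynomials φ ℓ L,
        pNorm ν.totalVariation p P ≤ c₁ * regularNorm ν α (1 / L) ^ (1 / p) * pNorm μ p P) ∧
    -- (a), converse
    (∃ c₂ : ℝ, 0 < c₂ ∧
      ∀ (φ : ℕ → M → ℂ) (ℓ : ℕ → ℝ), IsDiffusionSystem (n := n) μ α κ₂ κ₃ κ₄ φ ℓ →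
      ∀ (L : ℝ), 2 ≤ L → ∀ (ν : SignedMeasure M) (A : ℝ), 0 < A →
      (∀ P ∈ diffusionPolynomials φ ℓ L,
        pNorm ν.totalVariation p P ≤ A ^ (1 / p) * pNorm μ p P) →
      IsRegularMeasure ν α (1 / L) ∧ regularNorm ν α (1 / L) ≤ c₂ * A) ∧
    -- (b), direct part
    (∃ c c₃ c₄ : ℝ, 0 < c ∧ 0 < c₃ ∧ 0 < c₄ ∧
      ∀ (φ : ℕ → M → ℂ) (ℓ : ℕ → ℝ), IsDiffusionSystem (n := n) μ α κ₂ κ₃ κ₄ φ ℓ →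
      ∀ (L : ℝ), 2 ≤ L → c ≤ L → ∀ (ν : SignedMeasure M), IsDominantMeasure ν α (c₄ / L) →
      ∀ P ∈ diffusionPolynomials φ ℓ L,
        pNorm μ p P ≤ c₃ * dominantNorm ν α (c₄ / L) ^ (1 / p) * pNorm ν.totalVariation p P) ∧
    -- (b), converse
    (∀ S : ℤ, α < S → ∃ c₅ c₆ : ℝ, 0 < c₅ ∧ 0 < c₆ ∧
      ∀ (φ : ℕ → M → ℂ) (ℓ : ℕ → ℝ), IsDiffusionSystem (n := n) μ α κ₂ κ₃ κ₄ φ ℓ →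
      ∀ (L : ℝ), 2 ≤ L → ∀ (ν : SignedMeasure M), IsRegularMeasure ν α (1 / L) →
      ∀ (A₁ : ℝ), 0 < A₁ →
      (∀ P ∈ diffusionPolynomials φ ℓ L,
        pNorm μ p P ≤ A₁ ^ (1 / p) * pNorm ν.totalVariation p P) →
      ∀ (d : ℝ), d = c₅ * max 1 (regularNorm ν α (1 / L) * A₁) ^ (1 / (S - α)) / L →
        IsDominantMeasure ν α d ∧
        dominantNorm ν α d ≤ c₆ * A₁ * max 1 d ^ α ∧
        (2 * α ≤ S → dominantNorm ν α d ≤ c₆ * A₁)) := by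
  have hp0 : 0 < p := by linarith
  have hmem : ∀ {L : ℝ}, 2 ≤ L → 1 / L ∈ Ioc (0 : ℝ) 1 ∧ L * (1 / L) ≤ 1 := fun {L} hL => by
    have hL0 : 0 < L := by linarith
    exact ⟨⟨by positivity, (div_le_one hL0).2 (by linarith)⟩, (mul_one_div_cancel hL0.ne').le⟩
  refine ⟨?_, ?_, ?_, ?_⟩
  · obtain ⟨C, hC0, hC⟩ :=
      exists_integral_rpow_le_of_regular (n := n) μ κ₄ hα hκ₁ hκ₂ hκ₃ hball hp
    refine ⟨C ^ (1 / p), by positivity, fun φ ℓ hS L hL ν hν P hP => ?_⟩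
    have hb := regularNorm_nonneg (ν := ν) (α := α) (hmem hL).1.1
    rw [← Real.mul_rpow hC0.le hb, pNorm_le_rpow_mul_pNorm_iff hp0 (by positivity)]
    exact hC φ ℓ hS _ (hmem hL).1 L (hmem hL).2 _ _ hb (hν.regularNorm_mem (hmem hL).1.1) P hP
  · obtain ⟨K, hK0, hK⟩ := exists_measureReal_closedBall_le_of_integral_rpow_le (n := n) μ hα hκ₁
      hκ₂ hκ₃ hκ₄ hball hp
    refine ⟨K, hK0, fun φ ℓ hS L hL ν A hA0 hA => ?_⟩
    have h : K * A ∈ regularConstants ν α (1 / L) :=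
      hK φ ℓ hS L (by linarith) _ A hA0 fun P hP =>
        (pNorm_le_rpow_mul_pNorm_iff hp0 hA0.le).1 (hA P hP)
    exact ⟨⟨_, by positivity, h⟩, regularNorm_le (hmem hL).1.1 h⟩
  · obtain ⟨C, δ, hC0, hδ0, hC⟩ :=
      exists_integral_rpow_le_of_dominant (n := n) μ κ₄ hα hκ₁ hκ₂ hκ₃ hball hp
    -- The scale h = 1/L is admissible for every L ≥ 2, so the threshold can be 1.
    refine ⟨1, C ^ (1 / p), δ, one_pos, by positivity, hδ0, fun φ ℓ hS L hL _ ν hν P hP => ?_⟩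
    have hd0 : 0 < δ / L := div_pos hδ0 (by linarith)
    have hb := hν.sSup_pos hd0
    rw [dominantNorm, ← Real.mul_rpow hC0.le (by positivity),
      pNorm_le_rpow_mul_pNorm_iff hp0 (by positivity)]
    refine hC φ ℓ hS _ (hmem hL).1 L (hmem hL).2 _ _ hb ?_ P hP
    rw [mul_one_div]
    exact hν.sSup_mem hd0
  · intro S hαS
    lift S to ℕ using by exact_mod_cast (hα.trans hαS).le
    simp only [Int.cast_natCast] at hαS ⊢
    obtain ⟨K, c', hK0, hc'0, hK⟩ := exists_le_mul_measureReal_closedBall_of_integral_rpow_le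
      (n := n) μ hα hκ₁ hκ₂ hκ₃ hκ₄ hball hp S hαS
    set D := Metric.diam (univ : Set M) with hD
    have hD0 : 0 ≤ D := Metric.diam_nonneg
    have hD1 : 1 ≤ (D + 1) ^ α := Real.one_le_rpow (by linarith) hα.le
    set k : ℝ := c'⁻¹ * (D + 1) ^ α + K ^ α * (1 + c'⁻¹) with hk
    have hk1 : c'⁻¹ * (D + 1) ^ α ≤ k := le_add_of_nonneg_right (by positivity)
    have hk2 : K ^ α * (1 + c'⁻¹) ≤ k := le_add_of_nonneg_left (by positivity)
    refine ⟨K, k, hK0, by positivity, fun φ ℓ hS L hL ν hν A hA0 hA d hd => ?_⟩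
    have hL0 : 0 < L := by linarith
    have hd0 : 0 < d := by
      rw [hd]
      have : 0 < max 1 (regularNorm ν α (1 / L) * A) := lt_max_of_lt_left one_pos
      positivity
    have h := hK φ ℓ hS L (by linarith) _ _ (regularNorm_nonneg (hmem hL).1.1)
      (hν.regularNorm_mem (hmem hL).1.1) A hA0
      (fun P hP => (pNorm_le_rpow_mul_pNorm_iff hp0 hA0.le).1 (hA P hP)) d hd
    obtain ⟨hdom, hle⟩ := isDominantMeasure_and_dominantNorm_le hd0 hc'0 hA0 h
    refine ⟨hdom, hle.trans ?_, fun hS2 => ?_⟩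
    · have : c'⁻¹ ≤ k := (le_mul_of_one_le_right (by positivity) hD1).trans hk1
      gcongr
    -- For bounded `d` the factor `max 1 d ^ α` is a constant. Otherwise the ball is the whole
    -- space, and S ≥ 2α enters as α ≤ S - α.
    · rcases le_or_gt d (D + 1) with hdD | hdD
      · refine hle.trans ?_
        have h1 : max 1 d ^ α ≤ (D + 1) ^ α :=
          Real.rpow_le_rpow (by positivity) (max_le (by linarith) hdD) hα.le
        calc c'⁻¹ * A * max 1 d ^ α ≤ c'⁻¹ * A * (D + 1) ^ α := by gcongr
          _ = c'⁻¹ * (D + 1) ^ α * A := by ring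
          _ ≤ k * A := by gcongr
      · have hd1 : 1 ≤ d := by linarith
        refine (dominantNorm_le_of_closedBall_eq_univ hα.le hc'0 hA0 hK0 (by linarith)
          (by linarith) (by linarith) hd1 (by linarith) hd fun x => ?_).trans
          (mul_le_mul_of_nonneg_right hk2 hA0.le)
        simpa [min_eq_left hd1] using h x
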